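/- Let $n\ge 1$ be an integer and let $s,p$ be real with $2<s<3$, $n>2s$, $p>\frac{n+2s}{n-2s}$ and $$p\,\frac{\Gamma\big(\frac n2-\frac{s}{p-1}\big)\,\Gamma\big(s+\frac{s}{p-1}\big)}{\Gamma\big(\frac{s}{p-1}\big)\,\Gamma\big(\frac{n-2s}{2}-\frac{s}{p-1}\big)}>\frac{\Gamma\big(\frac{n+2s}{4}\big)^2}{\Gamma\big(\frac{n-2s}{4}\big)^2}.$$ **Notation.** Put $b=5-2s$, $X=(x,y)\in\mathbb R^n\times\mathbb R$, $\mathbb R^{n+1}_+=\{y>0\}$ and $\Delta_b w=\Delta w+\frac by\,\partial_y w=y^{-b}\operatorname{div}(y^b\nabla w)$. For $\kappa>0$, an *extended solution* is a function $u_e$, continuous on $\{y\ge0\}$ and $C^6$ in $\mathbb R^{n+1}_+$, whose derivatives of order five are $O(1+y^{2s-5})$ on bounded subsets of $\mathbb R^{n+1}_+$, and which satisfies $\Delta_b^3u_e=0$ in $\mathbb R^{n+1}_+$ and, as $X\in\mathbb R^{n+1}_+$ tends to any point of $\{y=0\}$, $$y^b\partial_yu_e\to0,\qquad y^b\partial_y\Delta_bu_e\to0,\qquad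 y^b\partial_y\Delta_b^2u_e\to-\kappa\,|u_e|^{p-1}u_e .$$ For $x_0\in\mathbb R^n$ and $\lambda>0$ put $u_e^\lambda(X)=\lambda^{\frac{2s}{p-1}}u_e\big((x_0,0)+\lambda X\big)$. On the unit half-sphere put $\theta_1=y$ (that is, $y/r$ with $r=1$); let $\nabla_{S^n}$ be the spherical gradient and $\Delta_{S^n}f=\theta_1^{-b}\operatorname{div}_{S^n}(\theta_1^b\nabla_{S^n}f)$ the weighted spherical Laplacian. For real coefficients $C^1_{i,j},C^2_{t,q},C^3_{l,k}$ define $$\begin{aligned}E^c(\lambda,x_0,u_e)=&\int_{\mathbb R^{n+1}_+\cap B_1}\tfrac12y^b|\nabla\Delta_bu_e^\lambda|^2-\frac{\kappa}{p+1}\int_{\partial\mathbb R^{n+1}_+\cap B_1}|u_e^\lambda|^{p+1}\\&+\sum_{0\le i,j\le4,\ i+j\le5}C^1_{i,j}\int_{\mathbb R^{n+1}_+\cap\partial B_1}\theta_1^b\lambda^{i+j}\frac{d^iu_e^\lambda}{d\lambda^i}\frac{d^ju_e^\lambda}{d\lambda^j}\\&+\sum_{0\le t,q\le2,\ t+q\le3}C^2_{t,q}\int_{\mathbb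 R^{n+1}_+\cap\partial B_1}\theta_1^b\lambda^{t+q}\,\nabla_{S^n}\frac{d^tu_e^\lambda}{d\lambda^t}\cdot\nabla_{S^n}\frac{d^qu_e^\lambda}{d\lambda^q}\\&+\sum_{0\le l,k\le1,\ l+k\le1}C^3_{l,k}\int_{\mathbb R^{n+1}_+\cap\partial B_1}\theta_1^b\lambda^{l+k}\,\Delta_{S^n}\frac{d^lu_e^\lambda}{d\lambda^l}\,\Delta_{S^n}\frac{d^ku_e^\lambda}{d\lambda^k}\\&+\Big(\frac{s}{p-1}+1\Big)\int_{\mathbb R^{n+1}_+\cap\partial B_1}\theta_1^b(\Delta_bu_e^\lambda)^2.\end{aligned}$$ **Theorem.** There are coefficients $C^1_{i,j},C^2_{t,q},C^3_{l,k}\in\mathbb R$ and a constant $C(n,s,p)>0$, all depending only on $n,s,p$, such that for every $\kappa>0$, every extended solution $u_e$ and every $x_0\in\mathbb R^n$: for every $\lambda>0$ the integrals in $E^c(\lambda,x_0,u_e)$ (the sum of the terms over $\mathbb R^{n+1}_+\cap\partial B_1$ being taken as one integral) and the integral below converge, $\lambda\mapsto E^c(\lambda,x_0,u_e)$ is nondecreasing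 and differentiable on $(0,\infty)$, and for every $\lambda>0$ $$\frac{d}{d\lambda}E^c(\lambda,x_0,u_e)\ \ge\ C(n,s,p)\,\lambda^{2s\frac{p+1}{p-1}-6-n}\int_{\mathbb R^{n+1}_+\cap\partial B_\lambda((x_0,0))}y^b\Big(\frac{2s}{p-1}u_e+\lambda\,\partial_ru_e\Big)^2,$$ where $\partial_r$ is the derivative in the direction of the outer normal of $\partial B_\lambda((x_0,0))$. -/

import Mathlib

open MeasureTheory Set Filter Topology
open scoped InnerProductSpace

noncomputable section

namespace LaneEmden

/-- `ℝⁿ⁺¹` with its Euclidean structure. A point is `X = (x, y)`, `y` being the last coordinate. -/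
abbrev Space (n : ℕ) : Type := EuclideanSpace ℝ (Fin (n + 1))

/-- The last coordinate `y` of `X = (x, y)`. -/
def ht {n : ℕ} (X : Space n) : ℝ := X (Fin.last n)

/-- The open upper half-space `ℝⁿ⁺¹₊ = {(x, y) : y > 0}`. -/
def upper (n : ℕ) : Set (Space n) := {X | 0 < ht X}

/-- The point `(x, 0)` of the boundary `∂ℝⁿ⁺¹₊`. -/
def bdry {n : ℕ} (x : EuclideanSpace ℝ (Fin n)) : Space n :=
  WithLp.toLp 2 (Fin.snoc (α := fun _ => ℝ) (fun i => x i) 0)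

/-- The partial derivative `∂f/∂y`. -/
def dy {n : ℕ} (f : Space n → ℝ) (X : Space n) : ℝ :=
  fderiv ℝ f X (EuclideanSpace.single (Fin.last n) 1)

/-- `Δ_b f = Δ f + (b / y) ∂f/∂y`, which is `y⁻ᵇ div (yᵇ ∇f)` where `y > 0`. -/
def lapB {n : ℕ} (b : ℝ) (f : Space n → ℝ) (X : Space n) : ℝ :=
  Laplacian.laplacian f X + b / ht X * dy f X

/-- `u` is a (classical) solution of the extended Lane-Emden problem on the upper half-space, with
`b = 5 - 2 s` and normalising constant `κ`:
`Δ_b³ u = 0` for `y > 0`, and on `y = 0`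
`yᵇ ∂_y u → 0`, `yᵇ ∂_y Δ_b u → 0`, `yᵇ ∂_y Δ_b² u → - κ |u|ᵖ⁻¹ u`.
Regularity: `u` is `C⁶` inside, continuous up to the boundary, and, locally uniformly up to the
boundary, its derivatives of order five are `O(1 + y ^ (2 s - 5))`. -/
structure IsExtendedSolution (n : ℕ) (s p κ : ℝ) (u : Space n → ℝ) : Prop where
  contDiffOn : ContDiffOn ℝ 6 u (upper n)
  continuousOn : ContinuousOn u {X | 0 ≤ ht X}
  bound : ∀ R : ℝ, ∃ M : ℝ, ∀ X ∈ upper n, ‖X‖ ≤ R →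
    ‖iteratedFDeriv ℝ 5 u X‖ ≤ M * (1 + ht X ^ (2 * s - 5))
  eqn : ∀ X ∈ upper n, lapB (5 - 2 * s) (lapB (5 - 2 * s) (lapB (5 - 2 * s) u)) X = 0
  bdry_zero : ∀ x : EuclideanSpace ℝ (Fin n),
    Tendsto (fun X => ht X ^ (5 - 2 * s) * dy u X) (𝓝[upper n] bdry x) (𝓝 0)
  bdry_one : ∀ x : EuclideanSpace ℝ (Fin n),
    Tendsto (fun X => ht X ^ (5 - 2 * s) * dy (lapB (5 - 2 * s) u) X) (𝓝[upper n] bdry x) (𝓝 0)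
  bdry_two : ∀ x : EuclideanSpace ℝ (Fin n),
    Tendsto (fun X => ht X ^ (5 - 2 * s) * dy (lapB (5 - 2 * s) (lapB (5 - 2 * s) u)) X)
      (𝓝[upper n] bdry x) (𝓝 (-κ * (|u (bdry x)| ^ (p - 1) * u (bdry x))))

/-- The rescaling about `(x₀, 0)`: `u^lam (X) = lam ^ (2 s / (p - 1)) * u ((x₀, 0) + lam X)`. -/
def rescale {n : ℕ} (s p : ℝ) (x₀ : EuclideanSpace ℝ (Fin n)) (u : Space n → ℝ) (lam : ℝ)
    (X : Space n) : ℝ :=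
  lam ^ (2 * s / (p - 1)) * u (bdry x₀ + lam • X)

/-- `dⁱ u^lam / d lamⁱ`, as a function of `X`. -/
def dlam {n : ℕ} (s p : ℝ) (x₀ : EuclideanSpace ℝ (Fin n)) (u : Space n → ℝ) (i : ℕ) (lam : ℝ)
    (X : Space n) : ℝ :=
  iteratedDeriv i (fun t => rescale s p x₀ u t X) lam

/-- The extension, homogeneous of degree `0`, of the restriction of `f` to the unit sphere. -/
def homExt {n : ℕ} (f : Space n → ℝ) (X : Space n) : ℝ := f (‖X‖⁻¹ • X)

/-- The gradient `∇_{Sⁿ} f` along the unit sphere, at a point of the unit sphere. -/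
def sphGrad {n : ℕ} (f : Space n → ℝ) (X : Space n) : Space n := gradient (homExt f) X

/-- The weighted spherical Laplacian `θ₁⁻ᵇ div_{Sⁿ} (θ₁ᵇ ∇_{Sⁿ} f)`, `θ₁ = y / r`, at a point of
the unit sphere: it is the angular part of `Δ_b = ∂_rr + ((n + b) / r) ∂_r + r⁻² (…)`. -/
def sphLap {n : ℕ} (b : ℝ) (f : Space n → ℝ) (X : Space n) : ℝ := lapB b (homExt f) X

/-- The upper unit half-sphere `ℝⁿ⁺¹₊ ∩ ∂B₁`, inside the unit sphere. -/
def hemi (n : ℕ) : Set (Metric.sphere (0 : Space n) 1) := {ω | (ω : Space n) ∈ upper n}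

/-- Surface measure of the unit sphere of `ℝⁿ⁺¹`. -/
def surf (n : ℕ) : Measure (Metric.sphere (0 : Space n) 1) := (volume : Measure (Space n)).toSphere

/-- The integral of `g` over `ℝⁿ⁺¹₊ ∩ ∂B_lam((x₀, 0))` with respect to surface measure. -/
def halfSphereIntegral {n : ℕ} (x₀ : EuclideanSpace ℝ (Fin n)) (lam : ℝ) (g : Space n → ℝ) : ℝ :=
  lam ^ n * ∫ ω in hemi n, g (bdry x₀ + lam • (ω : Space n)) ∂(surf n)

/-- `½ yᵇ |∇ Δ_b u^lam|²`. -/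
def bulkDensity {n : ℕ} (s p : ℝ) (x₀ : EuclideanSpace ℝ (Fin n)) (u : Space n → ℝ) (lam : ℝ)
    (X : Space n) : ℝ :=
  1 / 2 * ht X ^ (5 - 2 * s) * ‖gradient (lapB (5 - 2 * s) (rescale s p x₀ u lam)) X‖ ^ 2

/-- `|u^lam|ᵖ⁺¹` on `∂ℝⁿ⁺¹₊`. -/
def traceDensity {n : ℕ} (s p : ℝ) (x₀ : EuclideanSpace ℝ (Fin n)) (u : Space n → ℝ) (lam : ℝ)
    (x : EuclideanSpace ℝ (Fin n)) : ℝ :=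
  |rescale s p x₀ u lam (bdry x)| ^ (p + 1)

/-- The coefficients of the boundary terms of the energy. -/
structure Coeffs where
  c₁ : ℕ → ℕ → ℝ
  c₂ : ℕ → ℕ → ℝ
  c₃ : ℕ → ℕ → ℝ

/-- The sum of all integrands over `ℝⁿ⁺¹₊ ∩ ∂B₁` in the energy (there `r = 1` and `θ₁ = y`). -/
def boundaryDensity {n : ℕ} (s p : ℝ) (c : Coeffs) (x₀ : EuclideanSpace ℝ (Fin n))
    (u : Space n → ℝ) (lam : ℝ) (X : Space n) : ℝ :=
  ht X ^ (5 - 2 * s) *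
    ((∑ i ∈ Finset.range 5, ∑ j ∈ Finset.range 5,
        if i + j ≤ 5 then
          c.c₁ i j * lam ^ (i + j) * (dlam s p x₀ u i lam X * dlam s p x₀ u j lam X)
        else 0)
    + (∑ i ∈ Finset.range 3, ∑ j ∈ Finset.range 3,
        if i + j ≤ 3 then
          c.c₂ i j * lam ^ (i + j) *
            ⟪sphGrad (dlam s p x₀ u i lam) X, sphGrad (dlam s p x₀ u j lam) X⟫_ℝ
        else 0)
    + (∑ i ∈ Finset.range 2, ∑ j ∈ Finset.range 2,
        if i + j ≤ 1 then
          c.c₃ i j * lam ^ (i + j) *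
            (sphLap (5 - 2 * s) (dlam s p x₀ u i lam) X *
              sphLap (5 - 2 * s) (dlam s p x₀ u j lam) X)
        else 0)
    + (s / (p - 1) + 1) * lapB (5 - 2 * s) (rescale s p x₀ u lam) X ^ 2)

/-- The energy functional `E(lam, x₀, u)` with boundary coefficients `c`. -/
def energy {n : ℕ} (s p κ : ℝ) (c : Coeffs) (x₀ : EuclideanSpace ℝ (Fin n)) (u : Space n → ℝ)
    (lam : ℝ) : ℝ :=
  (∫ X in upper n ∩ Metric.ball 0 1, bulkDensity s p x₀ u lam X)
    - κ / (p + 1) *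
      (∫ x in Metric.ball (0 : EuclideanSpace ℝ (Fin n)) 1, traceDensity s p x₀ u lam x)
    + ∫ ω in hemi n, boundaryDensity s p c x₀ u lam ω ∂(surf n)

/-- All the integrals in the definition of the energy converge. -/
structure EnergyConverges {n : ℕ} (s p : ℝ) (c : Coeffs) (x₀ : EuclideanSpace ℝ (Fin n))
    (u : Space n → ℝ) (lam : ℝ) : Prop where
  bulk : IntegrableOn (bulkDensity s p x₀ u lam) (upper n ∩ Metric.ball 0 1)
  trace : IntegrableOn (traceDensity s p x₀ u lam) (Metric.ball 0 1)
  boundary : IntegrableOn (fun ω : Metric.sphere (0 : Space n) 1 =>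
    boundaryDensity s p c x₀ u lam ω) (hemi n) (surf n)

/-- `yᵇ ((2 s / (p - 1)) u + lam ∂_r u)²` on `∂B_lam((x₀, 0))`, where `∂_r` is the derivative in the
direction `(X - (x₀, 0)) / lam` of the unit outer normal. -/
def dissipation {n : ℕ} (s p : ℝ) (x₀ : EuclideanSpace ℝ (Fin n)) (u : Space n → ℝ) (lam : ℝ)
    (X : Space n) : ℝ :=
  ht X ^ (5 - 2 * s) *
    (2 * s / (p - 1) * u X + lam * fderiv ℝ u X (lam⁻¹ • (X - bdry x₀))) ^ 2

end LaneEmden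

end

/-! Write b = 5 - 2s, which lies in (-1, 1), k = 2s/(p-1), and E = X·∇. Rescalings compose
multiplicatively, so the derivative of the energy at λ is λ⁻¹ times its derivative at scale one for
the rescaled solution, and at scale one λ d/dλ acts on u^λ as E + k. Let p_j = (E + k)^j u, v = Δ_b
u, w = Δ_b v and V = (E + k + 2) v.

Bulk and trace terms. The bulk term has derivative ∫ y^b ∇V·∇v. Since Δ_b p_1 = V and Δ_b w = 0,
this integrand is the divergence of y^b (V∇v - w∇p_1 + p_1∇w). On {y = 0} only the last summand
survives, and by the nonlinear boundary condition it cancels the derivative of the |u|^(p+1) term.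
What is left is a flux through the half-sphere (`RegularSolution.integral_bulk`,
`RegularSolution.hasDerivAt_scaledEnergy`).

Sphere terms. On the unit sphere Δ_b = SL + (E + k)² + α (E + k) - β, with SL the weighted spherical
Laplacian, α = n + b - 1 - 2k and β = k (n + b - 1 - k). The flux thus becomes quadratic in the p_j
and their spherical derivatives. The coefficients of the energy are chosen so that, after adding the
derivative of the sphere terms and discarding combinations f SL g + ∇f·∇g of zero weighted integral
(`null_green`), there remains 3 p_3² + A p_2² + C p_1² + 6 |∇p_2|² + (6β + 12(α - 2)) |∇p_1|² + 3
(SL p_1)², with A = 6β + 20α - 24 - α² and C = 3β² + 12(α - 2)β + 8α(α - 2); this is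
`flux_add_bdryForm'`. The term C p_1² is the dissipation in the theorem.

Signs. Supercriticality of p gives α > 2 and β > 0, so only A ≥ 0 is at stake. With c = (n - 2s)/4
and t = s/(p-1) one finds A = 24(c+1)² + 16 - 40(c-t)². The hypothesis on Gamma functions compares
Γ(x+s)/Γ(x) at x = c, twice, with its values at 2c - t and t + 1; log-convexity of Γ shows that the
comparison would fail if c - t were so large that A < 0 (`quadratic_bound_of_Gamma`).

Regularity. All integrations by parts need control up to {y = 0}, where Δ_b is singular.
`IsExtendedSolution.cls` shows that an extended solution behaves like an even function of y to order
five: derivatives of order at most four are bounded, and those with an odd number of normal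
derivatives vanish on the boundary. The average y⁻¹ ∂_y f = ∫₀¹ ∂_yy f(x, ty) dt shows that Δ_b
preserves such classes, losing two orders. -/

noncomputable section

namespace LaneEmden

variable {n : ℕ}

/-! ### Partial derivatives on the half-space -/

/-- The partial derivative in the direction of the `j`-th coordinate. -/
def pd (j : Fin (n + 1)) (f : Space n → ℝ) (X : Space n) : ℝ :=
  fderiv ℝ f X (EuclideanSpace.single j 1)

lemma dy_eq_pd (f : Space n → ℝ) : dy f = pd (Fin.last n) f := rfl

/-- The `i`-th coordinate as a linear functional. -/
def coordL (i : Fin (n + 1)) : Space n →L[ℝ] ℝ := EuclideanSpace.proj i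

@[simp] lemma coordL_apply (i : Fin (n + 1)) (X : Space n) : coordL i X = X i := rfl

lemma continuous_ht : Continuous (ht : Space n → ℝ) := (coordL (Fin.last n)).continuous

lemma isOpen_upper : IsOpen (upper n) := isOpen_lt continuous_const continuous_ht

lemma upper_mem_nhds {X : Space n} (hX : X ∈ upper n) : upper n ∈ 𝓝 X :=
  isOpen_upper.mem_nhds hX

lemma measurableSet_upper : MeasurableSet (upper n) := isOpen_upper.measurableSet

lemma abs_coord_le (X : Space n) (i : Fin (n + 1)) : |X i| ≤ ‖X‖ := by
  simpa using PiLp.norm_apply_le X i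

lemma ht_le_norm (X : Space n) : ht X ≤ ‖X‖ := (le_abs_self _).trans (abs_coord_le X _)

lemma hasFDerivAt_coord (i : Fin (n + 1)) (X : Space n) :
    HasFDerivAt (fun Y : Space n => Y i) (coordL i) X := (coordL i).hasFDerivAt

lemma differentiableAt_coord (i : Fin (n + 1)) (X : Space n) :
    DifferentiableAt ℝ (fun Y : Space n => Y i) X := (hasFDerivAt_coord i X).differentiableAt

lemma pd_coord (i j : Fin (n + 1)) (X : Space n) :
    pd j (fun Y : Space n => Y i) X = if i = j then 1 else 0 := by
  rw [pd, (hasFDerivAt_coord i X).fderiv]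
  simp

lemma fderiv_eq_sum_pd (f : Space n → ℝ) (X v : Space n) :
    fderiv ℝ f X v = ∑ j, v j * pd j f X := by
  have h : v = ∑ j, v j • (EuclideanSpace.single j (1 : ℝ) : Space n) := by
    ext i; simp [Pi.single_apply]
  conv_lhs => rw [h]
  simp [pd]

lemma pd_congr_of_eventuallyEq {f g : Space n → ℝ} {X : Space n} (h : f =ᶠ[𝓝 X] g)
    (j : Fin (n + 1)) : pd j f X = pd j g X := by
  rw [pd, pd, h.fderiv_eq]

lemma eventuallyEq_of_eqOn {f g : Space n → ℝ} (h : EqOn f g (upper n)) {X : Space n}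
    (hX : X ∈ upper n) : f =ᶠ[𝓝 X] g :=
  h.eventuallyEq_of_mem (upper_mem_nhds hX)

lemma pd_eqOn {f g : Space n → ℝ} (h : EqOn f g (upper n)) (j : Fin (n + 1)) :
    EqOn (pd j f) (pd j g) (upper n) := fun _ hX =>
  pd_congr_of_eventuallyEq (eventuallyEq_of_eqOn h hX) j

lemma pd_add {f g : Space n → ℝ} {X : Space n} (hf : DifferentiableAt ℝ f X)
    (hg : DifferentiableAt ℝ g X) (j : Fin (n + 1)) :
    pd j (fun Y => f Y + g Y) X = pd j f X + pd j g X := by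
  rw [pd, fderiv_fun_add hf hg]; rfl

lemma pd_const_mul {f : Space n → ℝ} {X : Space n} (c : ℝ) (hf : DifferentiableAt ℝ f X)
    (j : Fin (n + 1)) : pd j (fun Y => c * f Y) X = c * pd j f X := by
  rw [pd, fderiv_const_mul hf]; rfl

lemma pd_mul {f g : Space n → ℝ} {X : Space n} (hf : DifferentiableAt ℝ f X)
    (hg : DifferentiableAt ℝ g X) (j : Fin (n + 1)) :
    pd j (fun Y => f Y * g Y) X = f X * pd j g X + pd j f X * g X := by
  rw [pd, fderiv_fun_mul hf hg]; simp [pd, mul_comm]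

lemma pd_sum {ι : Type*} (s : Finset ι) {f : ι → Space n → ℝ} {X : Space n}
    (hf : ∀ i ∈ s, DifferentiableAt ℝ (f i) X) (j : Fin (n + 1)) :
    pd j (fun Y => ∑ i ∈ s, f i Y) X = ∑ i ∈ s, pd j (f i) X := by
  rw [pd, fderiv_fun_sum hf]; simp [pd]

lemma contDiffOn_pd {m : ℕ} {f : Space n → ℝ} (hf : ContDiffOn ℝ (m + 1 : ℕ) f (upper n))
    (j : Fin (n + 1)) : ContDiffOn ℝ m (pd j f) (upper n) :=
  (hf.fderiv_of_isOpen isOpen_upper (m := m) (by norm_cast)).clm_apply contDiffOn_const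

lemma pd_comm {f : Space n → ℝ} (hf : ContDiffOn ℝ 2 f (upper n)) (i j : Fin (n + 1))
    {X : Space n} (hX : X ∈ upper n) : pd i (pd j f) X = pd j (pd i f) X := by
  have h2 : ContDiffAt ℝ 2 f X := hf.contDiffAt (upper_mem_nhds hX)
  have hd : DifferentiableAt ℝ (fderiv ℝ f) X :=
    (h2.fderiv_right (m := 1) (by norm_num)).differentiableAt (by norm_num)
  have hs := h2.isSymmSndFDerivAt (by simp)
  have key : ∀ a b : Fin (n + 1), pd a (pd b f) X =
      fderiv ℝ (fderiv ℝ f) X (EuclideanSpace.single a 1) (EuclideanSpace.single b 1) := by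
    intro a b
    have : pd b f = fun Y => fderiv ℝ f Y (EuclideanSpace.single b 1) := rfl
    rw [pd, this, fderiv_clm_apply hd (differentiableAt_const _)]
    simp
  rw [key, key]
  exact hs _ _

lemma laplacian_eq_sum_pd {f : Space n → ℝ} {X : Space n} (hf : ContDiffAt ℝ 2 f X) :
    Laplacian.laplacian f X = ∑ j, pd j (pd j f) X := by
  rw [InnerProductSpace.laplacian_eq_iteratedFDeriv_orthonormalBasis f
    (EuclideanSpace.basisFun (Fin (n + 1)) ℝ)]
  refine Finset.sum_congr rfl fun j _ => ?_
  have hd : DifferentiableAt ℝ (fderiv ℝ f) X :=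
    (hf.fderiv_right (m := 1) (by norm_num)).differentiableAt (by norm_num)
  have : pd j f = fun Y => fderiv ℝ f Y (EuclideanSpace.single j 1) := rfl
  rw [iteratedFDeriv_two_apply, pd, this, fderiv_clm_apply hd (differentiableAt_const _)]
  simp

lemma lapB_eq_sum_pd {f : Space n → ℝ} (hf : ContDiffOn ℝ 2 f (upper n)) (b : ℝ) {X : Space n}
    (hX : X ∈ upper n) :
    lapB b f X = ∑ j, pd j (pd j f) X + b / ht X * pd (Fin.last n) f X := by
  rw [lapB, laplacian_eq_sum_pd (hf.contDiffAt (upper_mem_nhds hX)), dy_eq_pd]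

lemma lapB_eqOn {f g : Space n → ℝ} (h : EqOn f g (upper n)) (b : ℝ) :
    EqOn (lapB b f) (lapB b g) (upper n) := fun X hX => by
  have he := eventuallyEq_of_eqOn h hX
  rw [lapB, lapB, InnerProductSpace.laplacian_congr_nhds he |>.self_of_nhds, dy_eq_pd, dy_eq_pd,
    pd_eqOn h _ hX]

/-! ### Local bounds up to the boundary -/

/-- `f` is `O(w)` on bounded subsets of the half-space. -/
def LocBdd (w f : Space n → ℝ) : Prop :=
  ∀ R : ℝ, ∃ M : ℝ, 0 ≤ M ∧ ∀ X ∈ upper n, ‖X‖ ≤ R → |f X| ≤ M * w X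

lemma LocBdd.congr {w f g : Space n → ℝ} (hf : LocBdd w f) (h : EqOn f g (upper n)) :
    LocBdd w g := fun R => by
  obtain ⟨M, hM, H⟩ := hf R
  exact ⟨M, hM, fun X hX hR => by rw [← h hX]; exact H X hX hR⟩

/-- Gauges are themselves compared through `LocBdd`, so that weights can be exchanged without
tracking constants on each bounded set. -/
lemma LocBdd.trans {w₁ w₂ f : Space n → ℝ} (hf : LocBdd w₁ f) (hw : LocBdd w₂ w₁) :
    LocBdd w₂ f := fun R => by
  obtain ⟨M, hM, H⟩ := hf R
  obtain ⟨M', hM', H'⟩ := hw R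
  refine ⟨M * M', by positivity, fun X hX hR => (H X hX hR).trans ?_⟩
  rw [mul_assoc]
  exact mul_le_mul_of_nonneg_left ((le_abs_self _).trans (H' X hX hR)) hM

lemma LocBdd.add {w f g : Space n → ℝ} (hf : LocBdd w f) (hg : LocBdd w g) :
    LocBdd w (fun X => f X + g X) := fun R => by
  obtain ⟨M, hM, H⟩ := hf R
  obtain ⟨M', hM', H'⟩ := hg R
  refine ⟨M + M', by positivity, fun X hX hR => (abs_add_le _ _).trans ?_⟩
  linarith [H X hX hR, H' X hX hR, add_mul M M' (w X)]

lemma LocBdd.mul {w₁ w₂ f g : Space n → ℝ} (hf : LocBdd w₁ f) (hg : LocBdd w₂ g) :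
    LocBdd (fun X => w₁ X * w₂ X) (fun X => f X * g X) := fun R => by
  obtain ⟨M, hM, H⟩ := hf R
  obtain ⟨M', hM', H'⟩ := hg R
  refine ⟨M * M', by positivity, fun X hX hR => ?_⟩
  rw [abs_mul]
  calc |f X| * |g X| ≤ (M * w₁ X) * (M' * w₂ X) :=
        mul_le_mul (H X hX hR) (H' X hX hR) (abs_nonneg _) ((abs_nonneg _).trans (H X hX hR))
    _ = _ := by ring

lemma LocBdd.self {w : Space n → ℝ} (hw : ∀ X ∈ upper n, 0 ≤ w X) : LocBdd w w := fun _ =>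
  ⟨1, zero_le_one, fun X hX _ => by rw [one_mul, abs_of_nonneg (hw X hX)]⟩

lemma locBdd_coord (i : Fin (n + 1)) : LocBdd (fun _ => 1) (fun X : Space n => X i) := fun R =>
  ⟨max R 0, le_max_right _ _, fun X _ hR => by
    rw [mul_one]; exact (abs_coord_le X i).trans (hR.trans (le_max_left _ _))⟩

lemma locBdd_const (c : ℝ) : LocBdd (fun _ => 1) (fun _ : Space n => c) := fun _ =>
  ⟨|c|, abs_nonneg c, fun X _ _ => by simp⟩

lemma LocBdd.one_mul' {w f g : Space n → ℝ} (hf : LocBdd (fun _ => 1) f) (hg : LocBdd w g) :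
    LocBdd w (fun X => f X * g X) := by
  simpa using hf.mul hg

lemma LocBdd.zero {w : Space n → ℝ} (hw : ∀ X ∈ upper n, 0 ≤ w X) :
    LocBdd w (fun _ => 0) := fun _ =>
  ⟨1, zero_le_one, fun X hX _ => by simpa using hw X hX⟩

lemma LocBdd.sum {ι : Type*} (s : Finset ι) {w : Space n → ℝ} (hw : ∀ X ∈ upper n, 0 ≤ w X)
    {f : ι → Space n → ℝ} (hf : ∀ i ∈ s, LocBdd w (f i)) :
    LocBdd w (fun X => ∑ i ∈ s, f i X) := by
  classical
  induction s using Finset.induction_on with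
  | empty => simpa using LocBdd.zero hw
  | insert a s ha ih =>
    simp only [Finset.sum_insert ha]
    exact (hf a (by simp)).add (ih fun i hi => hf i (by simp [hi]))

/-! ### Regularity classes up to the boundary, with parity in y -/

/-- The gauge `1 + y ^ σ`. -/
def rho (σ : ℝ) (X : Space n) : ℝ := 1 + ht X ^ σ

lemma one_le_rho (σ : ℝ) {X : Space n} (hX : X ∈ upper n) : 1 ≤ rho σ X :=
  le_add_of_nonneg_right (Real.rpow_nonneg (le_of_lt hX) _)

lemma rho_nonneg (σ : ℝ) {X : Space n} (hX : X ∈ upper n) : 0 ≤ rho σ X :=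
  zero_le_one.trans (one_le_rho σ hX)

/-- The behaviour of a function under the reflection in the boundary. -/
inductive Par
  | any
  | even
  | odd

/-- The parity of a normal derivative. -/
def Par.flip : Par → Par
  | .any => .any
  | .even => .odd
  | .odd => .even

@[simp] lemma Par.flip_flip (q : Par) : q.flip.flip = q := by cases q <;> rfl

/-- The parity of the `j`-th partial derivative. -/
def Par.at (q : Par) (j : Fin (n + 1)) : Par := if j = Fin.last n then q.flip else q

lemma Par.at_last (q : Par) : q.at (Fin.last n) = q.flip := by simp [Par.at]

lemma Par.at_of_ne (q : Par) {j : Fin (n + 1)} (h : j ≠ Fin.last n) : q.at j = q := by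
  simp [Par.at, h]

lemma Par.at_at (q : Par) (j : Fin (n + 1)) : (q.at j).at j = q := by
  by_cases h : j = Fin.last n <;> simp [Par.at, h]

lemma Par.flip_at (q : Par) (j : Fin (n + 1)) : q.flip.at j = (q.at j).flip := by
  by_cases h : j = Fin.last n <;> simp [Par.at, h]

lemma Par.any_at (j : Fin (n + 1)) : Par.any.at j = .any := by
  by_cases h : j = Fin.last n <;> simp [Par.at, h, Par.flip]

/-- The size of a function of given parity. -/
def Par.wt (σ : ℝ) : Par → Space n → ℝ
  | .odd => fun X => ht X * rho σ X
  | _ => fun _ => 1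

lemma Par.wt_nonneg (σ : ℝ) (q : Par) {X : Space n} (hX : X ∈ upper n) : 0 ≤ q.wt σ X := by
  cases q
  · exact zero_le_one
  · exact zero_le_one
  · exact mul_nonneg (le_of_lt hX) (rho_nonneg σ hX)

/-- Functions on the half-space whose derivatives of order less than `m` are bounded up to the
boundary, the derivatives of order `m` being `O(1 + y ^ σ)`; if the parity is prescribed, then odd
normal derivatives (or even ones) vanish on the boundary. -/
def Cls (σ : ℝ) : ℕ → Par → (Space n → ℝ) → Prop
  | 0, _, f => ContinuousOn f (upper n) ∧ LocBdd (rho σ) f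
  | m + 1, q, f => DifferentiableOn ℝ f (upper n) ∧ LocBdd (q.wt σ) f ∧
      ∀ j, Cls σ m (q.at j) (pd j f)

variable {σ : ℝ}

lemma Cls.congr {m : ℕ} {q : Par} {f g : Space n → ℝ} (hf : Cls σ m q f)
    (h : EqOn f g (upper n)) : Cls σ m q g := by
  induction m generalizing q f g with
  | zero => exact ⟨hf.1.congr h.symm, hf.2.congr h⟩
  | succ m ih =>
    exact ⟨hf.1.congr fun X hX => (h hX).symm, hf.2.1.congr h, fun j => ih (hf.2.2 j) (pd_eqOn h j)⟩

lemma Cls.differentiableAt {m : ℕ} {q : Par} {f : Space n → ℝ} (hf : Cls σ (m + 1) q f)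
    {X : Space n} (hX : X ∈ upper n) : DifferentiableAt ℝ f X :=
  hf.1.differentiableAt (upper_mem_nhds hX)

lemma Cls.continuousOn {m : ℕ} {q : Par} {f : Space n → ℝ} (hf : Cls σ m q f) :
    ContinuousOn f (upper n) := by
  cases m with
  | zero => exact hf.1
  | succ m => exact hf.1.continuousOn

lemma Cls.pderiv {m : ℕ} {q : Par} {f : Space n → ℝ} (hf : Cls σ (m + 1) q f) (j : Fin (n + 1)) :
    Cls σ m (q.at j) (pd j f) := hf.2.2 j

lemma locBdd_one_rho : LocBdd (rho σ) (fun _ : Space n => 1) := fun _ =>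
  ⟨1, zero_le_one, fun X hX _ => by simpa using one_le_rho σ hX⟩

/-- This is where σ > -1 enters: the odd weight y (1 + y^σ) = y + y^(1+σ), the size obtained by
integrating 1 + y^σ from the boundary, stays bounded near y = 0. -/
lemma locBdd_wt_one (hσ : -1 < σ) (q : Par) : LocBdd (fun _ : Space n => 1) (q.wt σ) := by
  cases q
  · exact locBdd_const 1
  · exact locBdd_const 1
  · intro R
    refine ⟨|R| + |R| ^ (1 + σ), by positivity, fun X hX hR => ?_⟩
    have hy : 0 < ht X := hX
    have h1 : ht X ≤ |R| := (ht_le_norm X).trans (hR.trans (le_abs_self R))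
    have h2 : ht X * rho σ X = ht X + ht X ^ (1 + σ) := by
      rw [rho, mul_add, mul_one, Real.rpow_add hy, Real.rpow_one]
    simp only [Par.wt]
    rw [abs_of_nonneg (mul_nonneg hy.le (rho_nonneg σ hX)), h2, mul_one]
    exact add_le_add h1 (Real.rpow_le_rpow hy.le h1 (by linarith))

lemma Cls.locBdd_one (hσ : -1 < σ) {m : ℕ} {q : Par} {f : Space n → ℝ}
    (hf : Cls σ (m + 1) q f) : LocBdd (fun _ => 1) f := hf.2.1.trans (locBdd_wt_one hσ q)

lemma Cls.locBdd_rho (hσ : -1 < σ) {m : ℕ} {q : Par} {f : Space n → ℝ}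
    (hf : Cls σ m q f) : LocBdd (rho σ) f := by
  cases m with
  | zero => exact hf.2
  | succ m => exact (hf.locBdd_one hσ).trans locBdd_one_rho

lemma Cls.of_succ (hσ : -1 < σ) {m : ℕ} {q : Par} {f : Space n → ℝ} (hf : Cls σ (m + 1) q f) :
    Cls σ m q f := by
  induction m generalizing q f with
  | zero => exact ⟨hf.continuousOn, hf.locBdd_rho hσ⟩
  | succ m ih => exact ⟨hf.1, hf.2.1, fun j => ih (hf.2.2 j)⟩

lemma Cls.of_le (hσ : -1 < σ) {m m' : ℕ} {q : Par} {f : Space n → ℝ} (hf : Cls σ m q f)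
    (h : m' ≤ m) : Cls σ m' q f := by
  induction m, h using Nat.le_induction with
  | base => exact hf
  | succ m _ ih => exact ih (hf.of_succ hσ)

/-- Parity is recorded only by the weights of the derivatives of order below m; at order 0 nothing
of it remains, which makes the base case free. -/
lemma Cls.to_any (hσ : -1 < σ) {m : ℕ} {q : Par} {f : Space n → ℝ} (hf : Cls σ m q f) :
    Cls σ m .any f := by
  induction m generalizing q f with
  | zero => exact hf
  | succ m ih =>
    exact ⟨hf.1, hf.locBdd_one hσ, fun j => by rw [Par.any_at]; exact ih (hf.2.2 j)⟩

lemma Cls.contDiffOn {m : ℕ} {q : Par} {f : Space n → ℝ} (hf : Cls σ m q f) :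
    ContDiffOn ℝ m f (upper n) := by
  induction m generalizing q f with
  | zero => exact contDiffOn_zero.2 hf.1
  | succ m ih =>
    have : ((m + 1 : ℕ) : WithTop ℕ∞) = (m : WithTop ℕ∞) + 1 := by norm_cast
    rw [this, contDiffOn_succ_iff_fderiv_of_isOpen isOpen_upper]
    refine ⟨hf.1, by simp, ?_⟩
    have hs : fderiv ℝ f = fun X => ∑ j, pd j f X • coordL j := by
      funext X
      ext v
      rw [fderiv_eq_sum_pd]
      simp [mul_comm]
    rw [hs]
    exact ContDiffOn.sum fun j _ => (ih (hf.2.2 j)).smul contDiffOn_const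

lemma Cls.add {m : ℕ} {q : Par} {f g : Space n → ℝ} (hf : Cls σ m q f) (hg : Cls σ m q g) :
    Cls σ m q (fun X => f X + g X) := by
  induction m generalizing q f g with
  | zero => exact ⟨hf.1.add hg.1, hf.2.add hg.2⟩
  | succ m ih =>
    refine ⟨hf.1.add hg.1, hf.2.1.add hg.2.1, fun j => (ih (hf.2.2 j) (hg.2.2 j)).congr ?_⟩
    exact fun X hX => (pd_add (hf.differentiableAt hX) (hg.differentiableAt hX) j).symm

lemma Cls.const_mul {m : ℕ} {q : Par} {f : Space n → ℝ} (hf : Cls σ m q f) (c : ℝ) :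
    Cls σ m q (fun X => c * f X) := by
  induction m generalizing q f with
  | zero => exact ⟨continuousOn_const.mul hf.1, (locBdd_const c).one_mul' hf.2⟩
  | succ m ih =>
    refine ⟨(differentiableOn_const c).mul hf.1, (locBdd_const c).one_mul' hf.2.1,
      fun j => (ih (hf.2.2 j)).congr ?_⟩
    exact fun X hX => (pd_const_mul c (hf.differentiableAt hX) j).symm

lemma Cls.zero (m : ℕ) (q : Par) : Cls σ m q (fun _ : Space n => 0) := by
  induction m generalizing q with
  | zero => exact ⟨continuousOn_const, LocBdd.zero fun X hX => rho_nonneg σ hX⟩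
  | succ m ih =>
    refine ⟨differentiableOn_const _, LocBdd.zero fun X hX => q.wt_nonneg σ hX, fun j =>
      (ih (q.at j)).congr fun X _ => by simp [pd]⟩

lemma Cls.sum {ι : Type*} (s : Finset ι) {m : ℕ} {q : Par} {f : ι → Space n → ℝ}
    (hf : ∀ i ∈ s, Cls σ m q (f i)) : Cls σ m q (fun X => ∑ i ∈ s, f i X) := by
  classical
  induction s using Finset.induction_on with
  | empty => simpa using Cls.zero m q
  | insert a s ha ih =>
    simp only [Finset.sum_insert ha]
    exact (hf a (by simp)).add (ih fun i hi => hf i (by simp [hi]))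

lemma Cls.coord_mul (hσ : -1 < σ) {m : ℕ} {q : Par} {f : Space n → ℝ} (hf : Cls σ m q f)
    {i : Fin (n + 1)} (hi : i ≠ Fin.last n) : Cls σ m q (fun X => X i * f X) := by
  induction m generalizing q f with
  | zero =>
    exact ⟨(coordL i).continuous.continuousOn.mul hf.1,
      (locBdd_coord i).one_mul' hf.2⟩
  | succ m ih =>
    refine ⟨(coordL i).differentiable.differentiableOn.mul hf.1,
      (locBdd_coord i).one_mul' hf.2.1, fun j => ?_⟩
    have h1 := ih (hf.2.2 j)
    have h2 : EqOn (fun X => X i * pd j f X + (if i = j then 1 else 0) * f X)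
        (pd j fun X => X i * f X) (upper n) := fun X hX => by
      rw [pd_mul (differentiableAt_coord i X) (hf.differentiableAt hX), pd_coord]
    refine Cls.congr ?_ h2
    by_cases hij : i = j
    · have : q.at j = q := q.at_of_ne (hij ▸ hi)
      rw [this] at h1 ⊢
      exact h1.add ((hf.of_succ hσ).const_mul _)
    · simpa [hij] using h1

/-- The factor y is odd, so it exchanges the parities. In the product rule the extra term δ f
appears only for the normal derivative, where flipping twice gives back the parity of f. -/
lemma Cls.ht_mul (hσ : -1 < σ) {m : ℕ} {q : Par} {f : Space n → ℝ} (hf : Cls σ m q f) :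
    Cls σ m q.flip (fun X => ht X * f X) := by
  induction m generalizing q f with
  | zero =>
    exact ⟨continuous_ht.continuousOn.mul hf.1, (locBdd_coord (Fin.last n)).one_mul' hf.2⟩
  | succ m ih =>
    refine ⟨(coordL (Fin.last n)).differentiable.differentiableOn.mul hf.1, ?_, fun j => ?_⟩
    · have h0 := hf.2.1
      -- Even to odd: y times a bounded function is O(y (1 + y^σ)). Odd to even: the odd weight is
      -- bounded, and so is y times it.
      cases q
      · exact (locBdd_coord (Fin.last n)).one_mul' h0
      · have h3 : LocBdd (ht : Space n → ℝ) ht := LocBdd.self fun X hX => le_of_lt hX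
        have := h3.mul (h0.trans (locBdd_one_rho (σ := σ)))
        exact this
      · exact (locBdd_coord (Fin.last n)).one_mul' (h0.trans (locBdd_wt_one hσ .odd))
    · have h1 := ih (hf.2.2 j)
      have h2 : EqOn (fun X => ht X * pd j f X +
          (if Fin.last n = j then 1 else 0) * f X)
          (pd j fun X => ht X * f X) (upper n) := fun X hX => by
        have := pd_mul (differentiableAt_coord (Fin.last n) X) (hf.differentiableAt hX) j
        rw [pd_coord] at this
        exact this.symm
      refine Cls.congr ?_ h2
      rw [Par.flip_at]
      by_cases hij : Fin.last n = j
      · subst hij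
        rw [Par.at_last, Par.flip_flip] at h1 ⊢
        exact h1.add ((hf.of_succ hσ).const_mul _)
      · simpa [hij] using h1

/-- In each term of the product rule one factor is undifferentiated, hence bounded, so the possibly
unbounded gauge 1 + y^σ is never squared. -/
lemma Cls.mul_any {f g : Space n → ℝ} (hf : Cls σ 1 .any f)
    (hg : Cls σ 1 .any g) : Cls σ 1 .any (fun X => f X * g X) := by
  refine ⟨hf.1.mul hg.1, by simpa [Par.wt] using hf.2.1.mul hg.2.1, fun j => ?_⟩
  have h2 : EqOn (fun X => f X * pd j g X + g X * pd j f X)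
      (pd j fun X => f X * g X) (upper n) := fun X hX => by
    rw [pd_mul (hf.differentiableAt hX) (hg.differentiableAt hX)]; ring
  refine Cls.congr (Cls.add ?_ ?_) h2
  · exact ⟨hf.continuousOn.mul (hg.2.2 j).1, hf.2.1.one_mul' (hg.2.2 j).2⟩
  · exact ⟨hg.continuousOn.mul (hf.2.2 j).1, hg.2.1.one_mul' (hf.2.2 j).2⟩

end LaneEmden

end

noncomputable section

namespace LaneEmden

variable {n : ℕ} {σ : ℝ}

/-! ### Vertical averages -/

/-- The contraction `(x, y) ↦ (x, s y)`. -/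
def vscale (s : ℝ) : Space n →L[ℝ] Space n :=
  ContinuousLinearMap.id ℝ (Space n) +
    (coordL (Fin.last n)).smulRight ((s - 1) • EuclideanSpace.single (Fin.last n) (1 : ℝ))

lemma vscale_apply (s : ℝ) (X : Space n) : vscale s X =
    X + (s - 1) • ht X • (EuclideanSpace.single (Fin.last n) (1 : ℝ) : Space n) := by
  simp only [vscale, add_apply, ContinuousLinearMap.smulRight_apply,
    ContinuousLinearMap.id_apply, coordL_apply, ht]
  rw [smul_comm]

lemma vscale_last (s : ℝ) (X : Space n) : vscale s X (Fin.last n) = s * X (Fin.last n) := by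
  simp [vscale]; ring

lemma ht_vscale (s : ℝ) (X : Space n) : ht (vscale s X) = s * ht X := vscale_last s X

lemma vscale_of_ne (s : ℝ) (X : Space n) {i : Fin (n + 1)} (hi : i ≠ Fin.last n) :
    vscale s X i = X i := by
  simp [vscale, hi]

lemma vscale_one (X : Space n) : vscale 1 X = X := by simp [vscale]

lemma norm_vscale_le {s : ℝ} (h0 : 0 ≤ s) (h1 : s ≤ 1) (X : Space n) : ‖vscale s X‖ ≤ ‖X‖ := by
  rw [EuclideanSpace.norm_eq, EuclideanSpace.norm_eq]
  refine Real.sqrt_le_sqrt (Finset.sum_le_sum fun i _ => ?_)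
  by_cases hi : i = Fin.last n
  · subst hi
    rw [vscale_last, norm_mul, mul_pow]
    refine mul_le_of_le_one_left (by positivity) ?_
    rw [Real.norm_eq_abs, abs_of_nonneg h0]
    exact pow_le_one₀ h0 h1
  · rw [vscale_of_ne s X hi]

lemma vscale_mem_upper {s : ℝ} (hs : 0 < s) {X : Space n} (hX : X ∈ upper n) :
    vscale s X ∈ upper n := by
  change 0 < ht (vscale s X)
  rw [ht_vscale]
  exact mul_pos hs hX

lemma continuous_vscale_left (X : Space n) : Continuous fun s : ℝ => vscale s X := by
  simp only [vscale_apply]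
  fun_prop

lemma continuous_vscaleL : Continuous fun s : ℝ => (vscale s : Space n →L[ℝ] Space n) := by
  unfold vscale
  refine continuous_const.add ?_
  have : (fun s : ℝ => (coordL (Fin.last n)).smulRight
      ((s - 1) • (EuclideanSpace.single (Fin.last n) (1 : ℝ) : Space n))) =
      fun s : ℝ => (s - 1) • (coordL (Fin.last n)).smulRight
        (EuclideanSpace.single (Fin.last n) (1 : ℝ) : Space n) := by
    funext s; ext; simp; ring_nf
  rw [this]
  fun_prop

lemma vscale_single_last (s : ℝ) :
    vscale s (EuclideanSpace.single (Fin.last n) (1 : ℝ) : Space n) =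
      s • EuclideanSpace.single (Fin.last n) (1 : ℝ) := by
  simp [vscale, sub_smul]

lemma vscale_single_of_ne (s : ℝ) {i : Fin (n + 1)} (hi : i ≠ Fin.last n) :
    vscale s (EuclideanSpace.single i (1 : ℝ) : Space n) = EuclideanSpace.single i (1 : ℝ) := by
  simp [vscale, Ne.symm hi]

lemma norm_vscaleL_le {s : ℝ} (h0 : 0 ≤ s) (h1 : s ≤ 1) :
    ‖(vscale s : Space n →L[ℝ] Space n)‖ ≤ 1 :=
  ContinuousLinearMap.opNorm_le_bound _ zero_le_one fun X => by
    rw [one_mul]; exact norm_vscale_le h0 h1 X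

/-- The sign of σ is not fixed, so either endpoint may carry the maximum; the sum covers both cases.
-/
lemma rpow_le_of_mem_Icc {y a c σ : ℝ} (ha : 0 < a) (h1 : a ≤ y) (h2 : y ≤ c) :
    y ^ σ ≤ a ^ σ + c ^ σ := by
  rcases le_total 0 σ with h | h
  · exact (Real.rpow_le_rpow (ha.le.trans h1) h2 h).trans
      (le_add_of_nonneg_left (Real.rpow_nonneg ha.le _))
  · exact (Real.rpow_le_rpow_of_nonpos ha h1 h).trans
      (le_add_of_nonneg_right (Real.rpow_nonneg (ha.le.trans (h1.trans h2)) _))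

lemma integrableOn_one_add_rpow (hσ : -1 < σ) (C : ℝ) :
    IntegrableOn (fun s : ℝ => 1 + s ^ σ * C) (Ioc 0 1) := by
  have h := (intervalIntegral.intervalIntegrable_rpow' (a := 0) (b := 1) hσ)
  rw [intervalIntegrable_iff_integrableOn_Ioc_of_le zero_le_one] at h
  exact (integrableOn_const (by simp)).add (h.mul_const C)

lemma integral_one_add_rpow (hσ : -1 < σ) (C : ℝ) :
    ∫ s in Ioc (0 : ℝ) 1, (1 + s ^ σ * C) = 1 + C / (σ + 1) := by
  have h := (intervalIntegral.intervalIntegrable_rpow' (a := 0) (b := 1) hσ)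
  rw [← intervalIntegral.integral_of_le zero_le_one, intervalIntegral.integral_add (by simp)
    (h.mul_const C), intervalIntegral.integral_mul_const, integral_rpow (Or.inl hσ)]
  have : σ + 1 ≠ 0 := by linarith
  simp [Real.zero_rpow this]
  ring

/-- The average `∫₀¹ sʲ g(x, s y) ds`. -/
def vavg (j : ℕ) (g : Space n → ℝ) (X : Space n) : ℝ :=
  ∫ s in Ioc (0 : ℝ) 1, s ^ j * g (vscale s X)

lemma abs_vavg_le {j : ℕ} {g : Space n → ℝ} {X : Space n} {B : ℝ → ℝ}
    (hB : IntegrableOn B (Ioc 0 1)) (h : ∀ s ∈ Ioc (0 : ℝ) 1, |g (vscale s X)| ≤ B s) :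
    |vavg j g X| ≤ ∫ s in Ioc (0 : ℝ) 1, B s := by
  refine norm_integral_le_of_norm_le (f := fun s : ℝ => s ^ j * g (vscale s X)) hB ?_
  filter_upwards [ae_restrict_mem measurableSet_Ioc] with s hs
  rw [norm_mul, Real.norm_eq_abs, Real.norm_eq_abs, abs_of_nonneg (pow_nonneg hs.1.le j)]
  exact (mul_le_of_le_one_left (abs_nonneg _) (pow_le_one₀ hs.1.le hs.2)).trans (h s hs)

lemma continuousOn_slice {g : Space n → ℝ} (hg : ContinuousOn g (upper n)) {X : Space n}
    (hX : X ∈ upper n) : ContinuousOn (fun s : ℝ => g (vscale s X)) (Ioc 0 1) :=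
  hg.comp (continuous_vscale_left X).continuousOn fun _ hs => vscale_mem_upper hs.1 hX

lemma aestronglyMeasurable_slice (j : ℕ) {g : Space n → ℝ} (hg : ContinuousOn g (upper n))
    {X : Space n} (hX : X ∈ upper n) :
    AEStronglyMeasurable (fun s : ℝ => s ^ j * g (vscale s X))
      (volume.restrict (Ioc (0 : ℝ) 1)) :=
  ((continuous_pow j).continuousOn.mul (continuousOn_slice hg hX)).aestronglyMeasurable
    measurableSet_Ioc

lemma rho_vscale {s : ℝ} (hs : s ∈ Ioc (0 : ℝ) 1) {X : Space n}
    (hX : X ∈ upper n) : rho σ (vscale s X) = 1 + s ^ σ * ht X ^ σ := by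
  rw [rho, ht_vscale, Real.mul_rpow hs.1.le (le_of_lt hX)]

lemma integrableOn_slice (hσ : -1 < σ) {g : Space n → ℝ} (hg : ContinuousOn g (upper n))
    (hb : LocBdd (rho σ) g) {X : Space n} (hX : X ∈ upper n) (j : ℕ) :
    IntegrableOn (fun s : ℝ => s ^ j * g (vscale s X)) (Ioc 0 1) := by
  obtain ⟨M, hM, H⟩ := hb ‖X‖
  refine Integrable.mono' ((integrableOn_one_add_rpow hσ (ht X ^ σ)).const_mul M)
    (aestronglyMeasurable_slice j hg hX) ?_
  filter_upwards [ae_restrict_mem measurableSet_Ioc] with s hs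
  rw [norm_mul, Real.norm_eq_abs, Real.norm_eq_abs, abs_of_nonneg (pow_nonneg hs.1.le j)]
  refine (mul_le_of_le_one_left (abs_nonneg _) (pow_le_one₀ hs.1.le hs.2)).trans ?_
  rw [← rho_vscale hs hX]
  exact H _ (vscale_mem_upper hs.1 hX) (norm_vscale_le hs.1.le hs.2 X)

lemma locBdd_vavg_rho (hσ : -1 < σ) {g : Space n → ℝ} (hb : LocBdd (rho σ) g) (j : ℕ) :
    LocBdd (rho σ) (vavg j g) := fun R => by
  obtain ⟨M, hM, H⟩ := hb R
  have h0 : 0 < σ + 1 := by linarith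
  refine ⟨M * (1 + 1 / (σ + 1)), by positivity, fun X hX hR => ?_⟩
  refine (abs_vavg_le ((integrableOn_one_add_rpow hσ (ht X ^ σ)).const_mul M) fun s hs => ?_).trans
    ?_
  · rw [← rho_vscale hs hX]
    exact H _ (vscale_mem_upper hs.1 hX) ((norm_vscale_le hs.1.le hs.2 X).trans hR)
  · rw [integral_const_mul, integral_one_add_rpow hσ, mul_assoc]
    refine mul_le_mul_of_nonneg_left ?_ hM
    have h3 : 0 ≤ ht X ^ σ := Real.rpow_nonneg (le_of_lt hX) _
    have h4 : 0 ≤ 1 / (σ + 1) := by positivity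
    rw [rho, div_eq_mul_one_div]
    nlinarith

lemma locBdd_vavg_wt (hσ : -1 < σ) {g : Space n → ℝ} (q : Par) (hb : LocBdd (q.wt σ) g) (j : ℕ) :
    LocBdd (q.wt σ) (vavg j g) := by
  have key : LocBdd (fun _ => 1) g → LocBdd (fun _ => 1) (vavg j g) := fun hb R => by
    obtain ⟨M, hM, H⟩ := hb R
    refine ⟨M, hM, fun X hX hR => ?_⟩
    refine (abs_vavg_le (B := fun _ => M * 1) (by simp) fun s hs =>
      H _ (vscale_mem_upper hs.1 hX) ((norm_vscale_le hs.1.le hs.2 X).trans hR)).trans ?_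
    simp
  cases q
  · exact key hb
  · exact key hb
  · intro R
    obtain ⟨M, hM, H⟩ := hb R
    have h0 : 0 < σ + 1 := by linarith
    refine ⟨M * (1 + 1 / (σ + 1)), by positivity, fun X hX hR => ?_⟩
    have hy : 0 < ht X := hX
    refine (abs_vavg_le ((integrableOn_one_add_rpow hσ (ht X ^ σ)).const_mul (M * ht X))
      fun s hs => ?_).trans ?_
    · refine (H _ (vscale_mem_upper hs.1 hX) ((norm_vscale_le hs.1.le hs.2 X).trans hR)).trans ?_
      simp only [Par.wt]
      rw [rho_vscale hs hX, ht_vscale, mul_assoc M]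
      refine mul_le_mul_of_nonneg_left ?_ hM
      have h3 : 0 ≤ 1 + s ^ σ * ht X ^ σ := by
        have := Real.rpow_nonneg hs.1.le σ
        have := Real.rpow_nonneg hy.le σ
        positivity
      exact mul_le_mul_of_nonneg_right (mul_le_of_le_one_left hy.le hs.2) h3
    · rw [integral_const_mul, integral_one_add_rpow hσ]
      simp only [Par.wt]
      have h3 : 0 ≤ ht X ^ σ := Real.rpow_nonneg hy.le _
      have h4 : 0 ≤ 1 / (σ + 1) := by positivity
      have h5 : 1 + ht X ^ σ / (σ + 1) ≤ (1 + 1 / (σ + 1)) * rho σ X := by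
        rw [rho, div_eq_mul_one_div]; nlinarith
      calc M * ht X * (1 + ht X ^ σ / (σ + 1)) ≤ M * ht X * ((1 + 1 / (σ + 1)) * rho σ X) :=
            mul_le_mul_of_nonneg_left h5 (by positivity)
        _ = _ := by ring

/-- Near a point of the half-space, `O(1 + y ^ σ)` functions are dominated along vertical
segments. -/
lemma slice_dominated {g : Space n → ℝ} (hb : LocBdd (rho σ) g) {X₀ : Space n}
    (hX₀ : X₀ ∈ upper n) : ∃ U ∈ 𝓝 X₀, U ⊆ upper n ∧ ∃ M C : ℝ, ∀ s ∈ Ioc (0 : ℝ) 1, ∀ X ∈ U,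
      |g (vscale s X)| ≤ M * (1 + s ^ σ * C) := by
  obtain ⟨M, hM, H⟩ := hb (‖X₀‖ + 1)
  have hy : 0 < ht X₀ := hX₀
  refine ⟨{X | ht X₀ / 2 < ht X} ∩ {X | ht X < 2 * ht X₀} ∩ {X | ‖X‖ < ‖X₀‖ + 1}, ?_, ?_, M,
    (ht X₀ / 2) ^ σ + (2 * ht X₀) ^ σ, ?_⟩
  · refine IsOpen.mem_nhds (((isOpen_lt continuous_const continuous_ht).inter
      (isOpen_lt continuous_ht continuous_const)).inter
      (isOpen_lt continuous_norm continuous_const)) ⟨⟨?_, ?_⟩, ?_⟩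
    · change ht X₀ / 2 < ht X₀; linarith
    · change ht X₀ < 2 * ht X₀; linarith
    · change ‖X₀‖ < ‖X₀‖ + 1; linarith
  · rintro X ⟨⟨h1, -⟩, -⟩
    exact (half_pos hy).trans h1
  · rintro s hs X ⟨⟨h1, h2⟩, h3⟩
    have hX : X ∈ upper n := (half_pos hy).trans h1
    refine (H _ (vscale_mem_upper hs.1 hX)
      ((norm_vscale_le hs.1.le hs.2 X).trans (le_of_lt h3))).trans ?_
    rw [rho_vscale hs hX]
    have := rpow_le_of_mem_Icc (σ := σ) (half_pos hy) (le_of_lt h1) (le_of_lt h2)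
    have h5 := Real.rpow_nonneg hs.1.le σ
    gcongr

lemma continuousOn_vavg (hσ : -1 < σ) {g : Space n → ℝ} (hg : ContinuousOn g (upper n))
    (hb : LocBdd (rho σ) g) (j : ℕ) : ContinuousOn (vavg j g) (upper n) := fun X₀ hX₀ => by
  obtain ⟨U, hU, hUs, M, C, H⟩ := slice_dominated hb hX₀
  refine ContinuousAt.continuousWithinAt ?_
  refine continuousAt_of_dominated (bound := fun s => M * (1 + s ^ σ * C)) ?_ ?_
    ((integrableOn_one_add_rpow hσ C).const_mul M) ?_
  · filter_upwards [hU] with X hX using aestronglyMeasurable_slice j hg (hUs hX)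
  · filter_upwards [hU] with X hX
    filter_upwards [ae_restrict_mem measurableSet_Ioc] with s hs
    rw [norm_mul, Real.norm_eq_abs, Real.norm_eq_abs, abs_of_nonneg (pow_nonneg hs.1.le j)]
    exact (mul_le_of_le_one_left (abs_nonneg _) (pow_le_one₀ hs.1.le hs.2)).trans (H s hs X hX)
  · filter_upwards [ae_restrict_mem measurableSet_Ioc] with s hs
    have := (hg.continuousAt (upper_mem_nhds (vscale_mem_upper hs.1 hX₀))).comp
      (vscale s).continuous.continuousAt
    exact continuousAt_const.mul this

lemma norm_fderiv_le_sum_pd (f : Space n → ℝ) (X : Space n) :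
    ‖fderiv ℝ f X‖ ≤ ∑ j, |pd j f X| := by
  refine ContinuousLinearMap.opNorm_le_bound _ (Finset.sum_nonneg fun j _ => abs_nonneg _)
    fun v => ?_
  rw [fderiv_eq_sum_pd, Finset.sum_mul]
  refine (Finset.abs_sum_le_sum_abs _ _).trans (Finset.sum_le_sum fun j _ => ?_)
  rw [abs_mul, mul_comm]
  exact mul_le_mul_of_nonneg_left (abs_coord_le v j) (abs_nonneg _)

lemma hasFDerivAt_vavg (hσ : -1 < σ) {q : Par} {g : Space n → ℝ} (hg : Cls σ 1 q g) (j : ℕ)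
    {X₀ : Space n} (hX₀ : X₀ ∈ upper n) :
    IntegrableOn (fun s : ℝ => s ^ j • (fderiv ℝ g (vscale s X₀)).comp (vscale s)) (Ioc 0 1) ∧
    HasFDerivAt (vavg j g)
      (∫ s in Ioc (0 : ℝ) 1, s ^ j • (fderiv ℝ g (vscale s X₀)).comp (vscale s)) X₀ := by
  have hb : LocBdd (rho σ) fun X => ∑ i, |pd i g X| := by
    refine LocBdd.sum _ (fun X hX => rho_nonneg σ hX) fun i _ R => ?_
    obtain ⟨M, hM, H⟩ := ((hg.pderiv i).locBdd_rho hσ) R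
    exact ⟨M, hM, fun X hX hR => by rw [abs_abs]; exact H X hX hR⟩
  obtain ⟨U, hU, hUs, M, C, H⟩ := slice_dominated hb hX₀
  have hc : ContinuousOn (fderiv ℝ g) (upper n) :=
    hg.contDiffOn.continuousOn_fderiv_of_isOpen isOpen_upper (by norm_num)
  have hbd : ∀ s ∈ Ioc (0 : ℝ) 1, ∀ X ∈ U,
      ‖s ^ j • (fderiv ℝ g (vscale s X)).comp (vscale s)‖ ≤ M * (1 + s ^ σ * C) := by
    intro s hs X hX
    rw [norm_smul, Real.norm_eq_abs, abs_of_nonneg (pow_nonneg hs.1.le j)]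
    refine (mul_le_of_le_one_left (norm_nonneg _) (pow_le_one₀ hs.1.le hs.2)).trans ?_
    refine (ContinuousLinearMap.opNorm_comp_le _ _).trans ?_
    refine (mul_le_of_le_one_right (norm_nonneg _) (norm_vscaleL_le hs.1.le hs.2)).trans ?_
    exact (norm_fderiv_le_sum_pd g _).trans ((le_abs_self _).trans (H s hs X hX))
  have hm : AEStronglyMeasurable
      (fun s : ℝ => s ^ j • (fderiv ℝ g (vscale s X₀)).comp (vscale s))
      (volume.restrict (Ioc (0 : ℝ) 1)) := by
    refine ContinuousOn.aestronglyMeasurable ?_ measurableSet_Ioc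
    refine (continuous_pow j).continuousOn.smul (ContinuousOn.clm_comp ?_
      continuous_vscaleL.continuousOn)
    exact hc.comp (continuous_vscale_left X₀).continuousOn fun s hs => vscale_mem_upper hs.1 hX₀
  have hi : IntegrableOn (fun s => M * (1 + s ^ σ * C)) (Ioc 0 1) :=
    (integrableOn_one_add_rpow hσ C).const_mul M
  refine ⟨Integrable.mono' hi hm ?_, ?_⟩
  · filter_upwards [ae_restrict_mem measurableSet_Ioc] with s hs using
      hbd s hs X₀ (mem_of_mem_nhds hU)
  refine hasFDerivAt_integral_of_dominated_of_fderiv_le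
    (F' := fun X s => s ^ j • (fderiv ℝ g (vscale s X)).comp (vscale s)) hU ?_
    (integrableOn_slice hσ hg.continuousOn (hg.locBdd_rho hσ) hX₀ j) hm ?_ hi ?_
  · filter_upwards [hU] with X hX using aestronglyMeasurable_slice j hg.continuousOn (hUs hX)
  · filter_upwards [ae_restrict_mem measurableSet_Ioc] with s hs X hX using hbd s hs X hX
  · filter_upwards [ae_restrict_mem measurableSet_Ioc] with s hs X hX
    have h1 := (hg.differentiableAt (vscale_mem_upper hs.1 (hUs hX))).hasFDerivAt
    exact (h1.comp X (vscale s).hasFDerivAt).const_mul (s ^ j)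

/-- The chain rule for (x, y) ↦ (x, sy) brings out one factor s per normal derivative and none per
tangential one. This is why the averages carry a power of s. -/
lemma pd_vavg (hσ : -1 < σ) {q : Par} {g : Space n → ℝ} (hg : Cls σ 1 q g) (j : ℕ)
    (i : Fin (n + 1)) {X : Space n} (hX : X ∈ upper n) :
    pd i (vavg j g) X = vavg (if i = Fin.last n then j + 1 else j) (pd i g) X := by
  obtain ⟨h1, h2⟩ := hasFDerivAt_vavg hσ hg j hX
  rw [pd, h2.fderiv, ContinuousLinearMap.integral_apply h1]
  refine setIntegral_congr_fun measurableSet_Ioc fun s _ => ?_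
  by_cases hi : i = Fin.last n
  · subst hi
    simp only [smul_apply, ContinuousLinearMap.comp_apply, if_true,
      vscale_single_last, map_smul, smul_eq_mul, pd]
    ring
  · simp only [smul_apply, ContinuousLinearMap.comp_apply, hi, if_false,
      vscale_single_of_ne s hi, smul_eq_mul, pd]

lemma Cls.vavg (hσ : -1 < σ) {m : ℕ} {q : Par} {g : Space n → ℝ} (hg : Cls σ m q g) (j : ℕ) :
    Cls σ m q (vavg j g) := by
  induction m generalizing q g j with
  | zero => exact ⟨continuousOn_vavg hσ hg.1 hg.2 j, locBdd_vavg_rho hσ hg.2 j⟩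
  | succ m ih =>
    have h1 : Cls σ 1 q g := hg.of_le hσ (by omega)
    refine ⟨fun X hX => (hasFDerivAt_vavg hσ h1 j hX).2.differentiableAt.differentiableWithinAt,
      locBdd_vavg_wt hσ q hg.2.1 j, fun i => ?_⟩
    exact (ih (hg.2.2 i) _).congr fun X hX => (pd_vavg hσ h1 j i hX).symm

lemma hasDerivAt_slice {f : Space n → ℝ} {X : Space n} {s : ℝ}
    (hf : DifferentiableAt ℝ f (vscale s X)) :
    HasDerivAt (fun t : ℝ => f (vscale t X)) (ht X * pd (Fin.last n) f (vscale s X)) s := by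
  have h1 : HasDerivAt (fun t : ℝ => vscale t X)
      (ht X • (EuclideanSpace.single (Fin.last n) (1 : ℝ) : Space n)) s := by
    simp only [vscale_apply]
    simpa using (((hasDerivAt_id s).sub_const 1).smul_const
      (ht X • (EuclideanSpace.single (Fin.last n) (1 : ℝ) : Space n))).const_add X
  have := hf.hasFDerivAt.comp_hasDerivAt s h1
  rw [map_smul, smul_eq_mul] at this
  exact this

/-- Control of vertical increments by the normal derivative. -/
lemma abs_sub_vscale_le (hσ : -1 < σ) {f : Space n → ℝ} (hf : DifferentiableOn ℝ f (upper n))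
    {M R : ℝ} (hM : 0 ≤ M)
    (hb : ∀ X ∈ upper n, ‖X‖ ≤ R → |pd (Fin.last n) f X| ≤ M * rho σ X)
    {X : Space n} (hX : X ∈ upper n) (hR : ‖X‖ ≤ R) {s : ℝ} (hs : s ∈ Ioc (0 : ℝ) 1) :
    |f X - f (vscale s X)| ≤ M * (1 + 1 / (σ + 1)) * (ht X * rho σ X) := by
  have hy : 0 < ht X := hX
  have h0 : 0 < σ + 1 := by linarith
  -- A primitive in t of M y (1 + (ty)^σ), which dominates the derivative of t ↦ f(x, ty). It is
  -- bounded on (0, 1] because σ + 1 > 0, whence an estimate uniform in s.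
  set B : ℝ → ℝ := fun t => M * ht X * (t + t ^ (σ + 1) * (ht X ^ σ / (σ + 1))) with hB
  have hB' : ∀ t ∈ Ioc (0 : ℝ) 1, HasDerivAt B (M * ht X * (1 + t ^ σ * ht X ^ σ)) t := by
    intro t ht'
    have h1 := Real.hasDerivAt_rpow_const (x := t) (p := σ + 1) (Or.inl ht'.1.ne')
    have h2 := ((hasDerivAt_id t).add (h1.mul_const (ht X ^ σ / (σ + 1)))).const_mul (M * ht X)
    rw [add_sub_cancel_right] at h2
    have h3 : M * ht X * (1 + t ^ σ * ht X ^ σ) =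
        M * ht X * (1 + (σ + 1) * t ^ σ * (ht X ^ σ / (σ + 1))) := by field_simp
    rw [h3]
    exact h2
  have hF : ∀ t ∈ Ioc (0 : ℝ) 1, HasDerivAt (fun t : ℝ => f (vscale t X))
      (ht X * pd (Fin.last n) f (vscale t X)) t := fun t ht' =>
    hasDerivAt_slice (hf.differentiableAt (upper_mem_nhds (vscale_mem_upper ht'.1 hX)))
  have hsub : Icc s 1 ⊆ Ioc (0 : ℝ) 1 := fun t ht' => ⟨hs.1.trans_le ht'.1, ht'.2⟩
  have key := image_norm_le_of_norm_deriv_right_le_deriv_boundary'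
    (f := fun t => f (vscale t X) - f (vscale s X)) (a := s) (b := 1)
    (f' := fun t => ht X * pd (Fin.last n) f (vscale t X))
    (B := fun t => B t - B s) (B' := fun t => M * ht X * (1 + t ^ σ * ht X ^ σ))
    (fun t ht' => ((hF t (hsub ht')).sub_const _).continuousAt.continuousWithinAt)
    (fun t ht' => ((hF t (hsub (Ico_subset_Icc_self ht'))).sub_const _).hasDerivWithinAt)
    (by simp)
    (fun t ht' => ((hB' t (hsub ht')).sub_const _).continuousAt.continuousWithinAt)
    (fun t ht' => ((hB' t (hsub (Ico_subset_Icc_self ht'))).sub_const _).hasDerivWithinAt)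
    (fun t ht' => by
      have ht2 := hsub (Ico_subset_Icc_self ht')
      rw [norm_mul, Real.norm_eq_abs, abs_of_pos hy, mul_comm M, mul_assoc,
        ← rho_vscale ht2 hX]
      exact mul_le_mul_of_nonneg_left (hb _ (vscale_mem_upper ht2.1 hX)
        ((norm_vscale_le ht2.1.le ht2.2 X).trans hR)) hy.le)
    (right_mem_Icc.2 hs.2)
  simp only [vscale_one, Real.norm_eq_abs] at key
  refine key.trans ?_
  have h3 : 0 ≤ ht X ^ σ := Real.rpow_nonneg hy.le _
  have h4 : 0 ≤ 1 / (σ + 1) := by positivity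
  have hs0 : 0 ≤ B s := by
    have := Real.rpow_nonneg hs.1.le (σ + 1)
    have := hs.1
    simp only [hB]; positivity
  have h5 : B 1 ≤ M * (1 + 1 / (σ + 1)) * (ht X * rho σ X) := by
    simp only [hB, Real.one_rpow, one_mul, rho]
    rw [div_eq_mul_one_div]
    have : 1 + ht X ^ σ * (1 / (σ + 1)) ≤ (1 + 1 / (σ + 1)) * (1 + ht X ^ σ) := by nlinarith
    calc M * ht X * (1 + ht X ^ σ * (1 / (σ + 1)))
        ≤ M * ht X * ((1 + 1 / (σ + 1)) * (1 + ht X ^ σ)) :=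
          mul_le_mul_of_nonneg_left this (by positivity)
      _ = _ := by ring
  linarith

lemma tendsto_wt_odd_slice (hσ : -1 < σ) {X : Space n} (hX : X ∈ upper n) :
    Tendsto (fun s : ℝ => Par.odd.wt σ (vscale s X)) (𝓝[>] 0) (𝓝 0) := by
  have h0 : 0 < σ + 1 := by linarith
  have h1 : Tendsto (fun s : ℝ => s * ht X + s ^ (σ + 1) * ht X ^ (σ + 1)) (𝓝 0)
      (𝓝 (0 * ht X + 0 ^ (σ + 1) * ht X ^ (σ + 1))) :=
    (tendsto_id.mul_const _).add
      (((Real.continuousAt_rpow_const 0 (σ + 1) (Or.inr h0.le)).tendsto).mul_const _)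
  rw [Real.zero_rpow h0.ne', zero_mul, zero_mul, add_zero] at h1
  refine (h1.mono_left nhdsWithin_le_nhds).congr' ?_
  filter_upwards [self_mem_nhdsWithin] with s hs
  have hs' : (0 : ℝ) < s := hs
  have hy : 0 < ht X := hX
  simp only [Par.wt]
  rw [rho, ht_vscale, Real.mul_rpow hs'.le hy.le, Real.rpow_add hs', Real.rpow_add hy,
    Real.rpow_one, Real.rpow_one]
  ring

lemma Cls.tendsto_odd_slice (hσ : -1 < σ) {m : ℕ} {f : Space n → ℝ} (hf : Cls σ (m + 1) .odd f)
    {X : Space n} (hX : X ∈ upper n) :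
    Tendsto (fun s : ℝ => f (vscale s X)) (𝓝[>] 0) (𝓝 0) := by
  obtain ⟨M, hM, H⟩ := hf.2.1 ‖X‖
  have h1 := (tendsto_wt_odd_slice hσ hX).const_mul M
  rw [mul_zero] at h1
  refine squeeze_zero_norm' ?_ h1
  filter_upwards [Ioc_mem_nhdsGT (zero_lt_one' ℝ)] with s hs
  exact H _ (vscale_mem_upper hs.1 hX) (norm_vscale_le hs.1.le hs.2 X)

/-- A function vanishing on the boundary is `y` times the average of its normal derivative. -/
lemma eq_ht_mul_vavg (hσ : -1 < σ) {q : Par} {f : Space n → ℝ} (hf : Cls σ 1 q f)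
    {X : Space n} (hX : X ∈ upper n)
    (h0 : Tendsto (fun s : ℝ => f (vscale s X)) (𝓝[>] 0) (𝓝 0)) :
    f X = ht X * LaneEmden.vavg 0 (LaneEmden.pd (Fin.last n) f) X := by
  have hi := (integrableOn_slice hσ (hf.pderiv (Fin.last n)).continuousOn
    ((hf.pderiv _).locBdd_rho hσ) hX 0).const_mul (ht X)
  have hd : ∀ s ∈ Ioc (0 : ℝ) 1, HasDerivAt (fun t : ℝ => f (vscale t X))
      (ht X * (s ^ 0 * LaneEmden.pd (Fin.last n) f (vscale s X))) s := fun s hs => by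
    rw [pow_zero, one_mul]
    exact hasDerivAt_slice (hf.differentiableAt (vscale_mem_upper hs.1 hX))
  have := intervalIntegral.integral_eq_sub_of_hasDerivAt_of_tendsto (zero_lt_one' ℝ)
    (fun s hs => hd s ⟨hs.1, hs.2.le⟩)
    ((intervalIntegrable_iff_integrableOn_Ioc_of_le zero_le_one).2 hi) h0
    ((hd 1 ⟨zero_lt_one, le_rfl⟩).continuousAt.tendsto.mono_left nhdsWithin_le_nhds)
  rw [intervalIntegral.integral_of_le zero_le_one, vscale_one, sub_zero,
    integral_const_mul] at this
  exact this.symm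

/-- The normal derivative of an even function vanishes on the boundary, so y⁻¹ ∂_y f is the vertical
average of ∂_yy f. The singular term of Δ_b therefore costs two orders, like the regular ones, and
keeps the parity. -/
lemma Cls.pd_last_div_ht (hσ : -1 < σ) {m : ℕ} {f : Space n → ℝ} (hf : Cls σ (m + 2) .even f) :
    Cls σ m .even (fun X => LaneEmden.pd (Fin.last n) f X / ht X) := by
  have h1 : Cls σ (m + 1) .odd (LaneEmden.pd (Fin.last n) f) := by
    simpa [Par.at_last, Par.flip] using hf.pderiv (Fin.last n)
  have h2 : Cls σ m .even (LaneEmden.pd (Fin.last n) (LaneEmden.pd (Fin.last n) f)) := by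
    simpa [Par.at_last, Par.flip] using h1.pderiv (Fin.last n)
  refine (h2.vavg hσ 0).congr fun X hX => ?_
  have hy : ht X ≠ 0 := ne_of_gt hX
  rw [eq_div_iff hy, mul_comm]
  exact (eq_ht_mul_vavg hσ (h1.of_le hσ (by omega)) hX (h1.tendsto_odd_slice hσ hX)).symm

lemma Cls.lapB (hσ : -1 < σ) (b : ℝ) {m : ℕ} {f : Space n → ℝ} (hf : Cls σ (m + 2) .even f) :
    Cls σ m .even (LaneEmden.lapB b f) := by
  have h1 : Cls σ m .even (fun X => ∑ j, LaneEmden.pd j (LaneEmden.pd j f) X) :=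
    Cls.sum _ fun j _ => by
      have := (hf.pderiv j).pderiv j
      rwa [Par.at_at] at this
  refine (h1.add ((hf.pd_last_div_ht hσ).const_mul b)).congr fun X hX => ?_
  rw [lapB_eq_sum_pd (hf.contDiffOn.of_le (by norm_cast; omega)) b hX]
  ring

/-! ### The Euler operator -/

/-- The Euler operator `X · ∇`. -/
def euler (f : Space n → ℝ) (X : Space n) : ℝ := fderiv ℝ f X X

lemma euler_eq_sum (f : Space n → ℝ) (X : Space n) : euler f X = ∑ j, X j * pd j f X :=
  fderiv_eq_sum_pd f X X

lemma euler_eqOn {f g : Space n → ℝ} (h : EqOn f g (upper n)) :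
    EqOn (euler f) (euler g) (upper n) := fun X hX => by
  rw [euler, euler, (eventuallyEq_of_eqOn h hX).fderiv_eq]

lemma Cls.euler (hσ : -1 < σ) {m : ℕ} {q : Par} {f : Space n → ℝ} (hf : Cls σ (m + 1) q f) :
    Cls σ m q (LaneEmden.euler f) := by
  have : Cls σ m q (fun X => ∑ j, X j * LaneEmden.pd j f X) := by
    refine Cls.sum _ fun j _ => ?_
    by_cases hj : j = Fin.last n
    · subst hj
      have := (hf.pderiv (Fin.last n)).ht_mul hσ
      rwa [Par.at_last, Par.flip_flip] at this
    · have := (hf.pderiv j).coord_mul hσ hj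
      rwa [Par.at_of_ne q hj] at this
  exact this.congr fun X _ => (euler_eq_sum f X).symm

lemma Cls.norm_sq_mul (hσ : -1 < σ) {m : ℕ} {q : Par} {f : Space n → ℝ} (hf : Cls σ m q f) :
    Cls σ m q (fun X => ‖X‖ ^ 2 * f X) := by
  have : Cls σ m q (fun X => ∑ j, X j * (X j * f X)) := by
    refine Cls.sum _ fun j _ => ?_
    by_cases hj : j = Fin.last n
    · subst hj
      have := (hf.ht_mul hσ).ht_mul hσ
      rwa [Par.flip_flip] at this
    · exact (hf.coord_mul hσ hj).coord_mul hσ hj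
  refine this.congr fun X _ => ?_
  simp only
  rw [EuclideanSpace.real_norm_sq_eq, Finset.sum_mul]
  exact Finset.sum_congr rfl fun j _ => by ring

end LaneEmden

end

noncomputable section

namespace LaneEmden

variable {n : ℕ} {σ : ℝ}

/-! ### Regularity of extended solutions up to the boundary -/

/-- Where y ≥ 1, a bounded set is relatively compact in the open half-space and continuity suffices.
Where y < 1, one compares with the point of height 1 on the same vertical line and integrates the
normal derivative. -/
lemma locBdd_one_of_pd_last (hσ : -1 < σ) {f : Space n → ℝ}
    (hf : DifferentiableOn ℝ f (upper n)) (hb : LocBdd (rho σ) (pd (Fin.last n) f)) :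
    LocBdd (fun _ => 1) f := fun R => by
  obtain ⟨M, hM, H⟩ := hb (|R| + 1)
  have h0 : 0 < σ + 1 := by linarith
  have hK : IsCompact ({X : Space n | 1 ≤ ht X} ∩ Metric.closedBall 0 (|R| + 1)) :=
    (isCompact_closedBall _ _).inter_left (isClosed_le continuous_const continuous_ht)
  have hKs : {X : Space n | 1 ≤ ht X} ∩ Metric.closedBall 0 (|R| + 1) ⊆ upper n :=
    fun X hX => (by
      have h1 : 1 ≤ ht X := hX.1
      change 0 < ht X
      linarith)
  obtain ⟨M₀, hM₀⟩ := hK.exists_bound_of_continuousOn (hf.continuousOn.mono hKs)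
  refine ⟨|M₀| + M * (1 + 1 / (σ + 1)) * 2, by positivity, fun X hX hR => ?_⟩
  have hR' : ‖X‖ ≤ |R| := hR.trans (le_abs_self R)
  have hpos : 0 ≤ M * (1 + 1 / (σ + 1)) * 2 := by positivity
  rw [mul_one]
  rcases le_or_gt 1 (ht X) with h1 | h1
  · have := hM₀ X ⟨h1, by simpa using hR'.trans (by linarith)⟩
    have h2 := le_abs_self M₀
    rw [Real.norm_eq_abs] at this
    linarith
  · have hy : 0 < ht X := hX
    -- The point at height 1 above X. Its norm is at most |R| + 1, which is why the bounds were
    -- taken on that larger ball.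
    set X' : Space n := vscale (ht X)⁻¹ X with hX'
    have hX'1 : ht X' = 1 := by rw [hX', ht_vscale, inv_mul_cancel₀ hy.ne']
    have hX'u : X' ∈ upper n := by change 0 < ht X'; rw [hX'1]; exact zero_lt_one
    have hback : vscale (ht X) X' = X := by
      rw [vscale_apply, hX'1, hX', vscale_apply]
      rw [smul_smul, smul_smul, mul_one, add_assoc, ← add_smul, sub_mul, inv_mul_cancel₀ hy.ne']
      simp
    have hnorm : ‖X'‖ ≤ |R| + 1 := by
      rw [hX', vscale_apply, smul_smul]
      refine (norm_add_le _ _).trans (add_le_add hR' ?_)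
      rw [norm_smul, sub_mul, inv_mul_cancel₀ hy.ne', one_mul, Real.norm_eq_abs]
      simp only [PiLp.norm_single, norm_one, mul_one]
      rw [abs_of_nonneg (by linarith)]; linarith
    have h3 := abs_sub_vscale_le hσ hf hM H hX'u hnorm (s := ht X) ⟨hy, h1.le⟩
    rw [hback, rho, hX'1, Real.one_rpow, one_mul] at h3
    have h4 := hM₀ X' ⟨hX'1.ge, by simpa using hnorm⟩
    rw [Real.norm_eq_abs] at h4
    have h5 : |f X| ≤ |f X'| + |f X' - f X| := by
      have := abs_sub_abs_le_abs_sub (f X) (f X')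
      rw [abs_sub_comm] at this; linarith
    have h6 := le_abs_self M₀
    linarith

/-- Bounds on the derivatives of order `m` give the regularity class, without parity. -/
lemma cls_any_of_iteratedFDeriv (hσ : -1 < σ) {m : ℕ} {f : Space n → ℝ}
    (hf : ContDiffOn ℝ m f (upper n))
    (hb : LocBdd (rho σ) fun X => ‖iteratedFDeriv ℝ m f X‖) : Cls σ m .any f := by
  induction m generalizing f with
  | zero =>
    refine ⟨hf.continuousOn, fun R => ?_⟩
    obtain ⟨M, hM, H⟩ := hb R
    refine ⟨M, hM, fun X hX hR => ?_⟩
    simpa using H X hX hR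
  | succ m ih =>
    have hd : ∀ j, Cls σ m .any (pd j f) := fun j => by
      refine ih (contDiffOn_pd hf j) fun R => ?_
      obtain ⟨M, hM, H⟩ := hb R
      refine ⟨M, hM, fun X hX hR => ?_⟩
      have h1 := H X hX hR
      rw [abs_norm] at h1 ⊢
      refine le_trans ?_ h1
      rw [← norm_iteratedFDeriv_fderiv]
      have hc : ContDiffAt ℝ m (fderiv ℝ f) X :=
        (hf.contDiffAt (upper_mem_nhds hX)).fderiv_right (by norm_cast)
      have h2 := (ContinuousLinearMap.apply ℝ ℝ
        (EuclideanSpace.single j (1 : ℝ) : Space n)).norm_iteratedFDeriv_comp_left hc le_rfl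
      refine h2.trans (mul_le_of_le_one_left (norm_nonneg _) ?_)
      refine ContinuousLinearMap.opNorm_le_bound _ zero_le_one fun L => ?_
      have h3 := L.le_opNorm (EuclideanSpace.single j (1 : ℝ) : Space n)
      rw [PiLp.norm_single, norm_one, mul_one] at h3
      rw [one_mul]
      exact h3
    refine ⟨hf.differentiableOn (by norm_cast), locBdd_one_of_pd_last hσ
      (hf.differentiableOn (by norm_cast)) ((hd _).locBdd_rho hσ), fun j => ?_⟩
    rw [Par.any_at]; exact hd j

lemma slice_slice (s t : ℝ) (X : Space n) : vscale s (vscale t X) = vscale (s * t) X := by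
  ext i
  by_cases hi : i = Fin.last n
  · subst hi; simp only [vscale_last]; ring
  · simp only [vscale_of_ne _ _ hi]

/-- Letting s tend to 0 in the bound for f(x, y) - f(x, sy) turns a vanishing boundary value into
the rate y (1 + y^σ). -/
lemma locBdd_odd_of_tendsto (hσ : -1 < σ) {f : Space n → ℝ}
    (hf : DifferentiableOn ℝ f (upper n)) (hb : LocBdd (rho σ) (pd (Fin.last n) f))
    (h0 : ∀ X ∈ upper n, Tendsto (fun s : ℝ => f (vscale s X)) (𝓝[>] 0) (𝓝 0)) :
    LocBdd (Par.odd.wt σ) f := fun R => by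
  obtain ⟨M, hM, H⟩ := hb R
  have h1 : 0 < σ + 1 := by linarith
  refine ⟨M * (1 + 1 / (σ + 1)), by positivity, fun X hX hR => ?_⟩
  have h2 : Tendsto (fun s : ℝ => |f X - f (vscale s X)|) (𝓝[>] 0) (𝓝 |f X - 0|) :=
    (tendsto_const_nhds.sub (h0 X hX)).abs
  rw [sub_zero] at h2
  refine le_of_tendsto h2 ?_
  filter_upwards [Ioc_mem_nhdsGT (zero_lt_one' ℝ)] with s hs
  exact abs_sub_vscale_le hσ hf hM H hX hR hs

lemma tendsto_slice_of_locBdd_odd (hσ : -1 < σ) {f : Space n → ℝ}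
    (hf : LocBdd (Par.odd.wt σ) f) {X : Space n} (hX : X ∈ upper n) :
    Tendsto (fun s : ℝ => f (vscale s X)) (𝓝[>] 0) (𝓝 0) := by
  obtain ⟨M, hM, H⟩ := hf ‖X‖
  have h1 := (tendsto_wt_odd_slice hσ hX).const_mul M
  rw [mul_zero] at h1
  refine squeeze_zero_norm' ?_ h1
  filter_upwards [Ioc_mem_nhdsGT (zero_lt_one' ℝ)] with s hs
  exact H _ (vscale_mem_upper hs.1 hX) (norm_vscale_le hs.1.le hs.2 X)

lemma pd_comp_add {f : Space n → ℝ} (v X : Space n) (j : Fin (n + 1)) :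
    pd j (fun Y => f (Y + v)) X = pd j f (X + v) := by
  rw [pd, fderiv_comp_add_right]; rfl

lemma hasDerivAt_line {f : Space n → ℝ} {X : Space n} {i : Fin (n + 1)} {h : ℝ}
    (hf : DifferentiableAt ℝ f (X + h • EuclideanSpace.single i (1 : ℝ))) :
    HasDerivAt (fun t : ℝ => f (X + t • EuclideanSpace.single i (1 : ℝ)))
      (pd i f (X + h • EuclideanSpace.single i (1 : ℝ))) h := by
  have h1 : HasDerivAt (fun t : ℝ => X + t • (EuclideanSpace.single i (1 : ℝ) : Space n))
      (EuclideanSpace.single i (1 : ℝ)) h := by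
    simpa using ((hasDerivAt_id h).smul_const (EuclideanSpace.single i (1 : ℝ) : Space n)).const_add X
  exact hf.hasFDerivAt.comp_hasDerivAt h h1

/-- Tangential derivatives of a function vanishing on the boundary vanish there. -/
lemma LocBdd.odd_pd (hσ : -1 < σ) {f : Space n → ℝ} (hf : Cls σ 2 .any f)
    (h0 : LocBdd (Par.odd.wt σ) f) {i : Fin (n + 1)} (hi : i ≠ Fin.last n) :
    LocBdd (Par.odd.wt σ) (pd i f) := fun R => by
  have hy : Cls σ 1 .any (pd (Fin.last n) f) := by
    simpa [Par.any_at] using hf.pderiv (Fin.last n)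
  obtain ⟨M, hM, H⟩ := ((hy.pderiv i).locBdd_rho hσ) (R + 1)
  have h1 : 0 < σ + 1 := by linarith
  refine ⟨M * (1 + 1 / (σ + 1)), by positivity, fun X hX hR => ?_⟩
  set e : Space n := EuclideanSpace.single i (1 : ℝ) with he
  have hht : ∀ (Y : Space n) (h : ℝ), ht (Y + h • e) = ht Y := fun Y h => by
    simp [ht, he, Ne.symm hi]
  have hup : ∀ {Y : Space n} (h : ℝ), Y ∈ upper n → Y + h • e ∈ upper n := fun h hY => by
    change 0 < ht _; rw [hht]; exact hY
  have hnorm : ∀ {Y : Space n} {h : ℝ}, ‖Y‖ ≤ R → |h| ≤ 1 → ‖Y + h • e‖ ≤ R + 1 := by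
    intro Y h hY hh
    refine (norm_add_le _ _).trans (add_le_add hY ?_)
    rw [norm_smul, he, PiLp.norm_single, norm_one, mul_one]; exact hh
  -- The difference f(· + he) - f vanishes on the boundary, and by the mean value theorem its normal
  -- derivative is O(|h| (1 + y^σ)). Hence it is O(|h| y (1 + y^σ)), uniformly in h, and dividing by
  -- h gives the claim.
  have hinc : ∀ h : ℝ, |h| ≤ 1 → |f (X + h • e) - f X| ≤
      M * (1 + 1 / (σ + 1)) * Par.odd.wt σ X * |h| := by
    intro h hh
    have hk : DifferentiableOn ℝ (fun Y => f (Y + h • e) - f Y) (upper n) := fun Y hY =>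
      (((hf.differentiableAt (hup h hY)).comp Y
        (differentiableAt_id.add_const _)).sub (hf.differentiableAt hY)).differentiableWithinAt
    have hb : ∀ Y ∈ upper n, ‖Y‖ ≤ R →
        |pd (Fin.last n) (fun Y => f (Y + h • e) - f Y) Y| ≤ (M * |h|) * rho σ Y := by
      intro Y hY hYR
      have hd : pd (Fin.last n) (fun Y => f (Y + h • e) - f Y) Y =
          pd (Fin.last n) f (Y + h • e) - pd (Fin.last n) f Y := by
        have h5 : DifferentiableAt ℝ (fun Y => f (Y + h • e)) Y :=
          (hf.differentiableAt (hup h hY)).comp Y (differentiableAt_id.add_const _)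
        rw [← pd_comp_add, pd, fderiv_fun_sub h5 (hf.differentiableAt hY)]; rfl
      rw [hd]
      have hmv := Convex.norm_image_sub_le_of_norm_hasDerivWithin_le
        (f := fun t : ℝ => pd (Fin.last n) f (Y + t • e))
        (f' := fun t => pd i (pd (Fin.last n) f) (Y + t • e)) (s := Icc (-1) 1) (x := 0) (y := h)
        (C := M * rho σ Y)
        (fun t _ => (hasDerivAt_line (hy.differentiableAt (hup t hY))).hasDerivWithinAt)
        (fun t ht' => by
          have := H (Y + t • e) (hup t hY) (hnorm hYR (abs_le.2 ht'))
          rw [rho, hht] at this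
          exact this)
        (convex_Icc _ _) (by simp) (abs_le.1 hh)
      simp only [zero_smul, add_zero, sub_zero, Real.norm_eq_abs] at hmv
      linarith
    have hlim : ∀ s ∈ Ioc (0 : ℝ) 1, vscale s (X + h • e) = vscale s X + h • e := fun s _ => by
      rw [map_add, map_smul, he, vscale_single_of_ne s hi]
    have h2 : Tendsto (fun s : ℝ => |(f (X + h • e) - f X) -
        (f (vscale s X + h • e) - f (vscale s X))|) (𝓝[>] 0) (𝓝 |f (X + h • e) - f X - (0 - 0)|) := by
      refine (tendsto_const_nhds.sub (Tendsto.sub ?_ (tendsto_slice_of_locBdd_odd hσ h0 hX))).abs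
      refine (tendsto_slice_of_locBdd_odd hσ h0 (hup h hX)).congr' ?_
      filter_upwards [Ioc_mem_nhdsGT (zero_lt_one' ℝ)] with s hs
      rw [hlim s hs]
    rw [sub_zero, sub_zero] at h2
    refine le_of_tendsto h2 ?_
    filter_upwards [Ioc_mem_nhdsGT (zero_lt_one' ℝ)] with s hs
    refine (abs_sub_vscale_le hσ hk (by positivity) hb hX hR hs).trans (le_of_eq ?_)
    simp only [Par.wt]; ring
  have hD : HasDerivAt (fun t : ℝ => f (X + t • e)) (pd i f X) 0 := by
    have := hasDerivAt_line (f := f) (X := X) (i := i) (h := 0)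
      (by simpa using hf.differentiableAt hX)
    simpa using this
  have hC : 0 ≤ M * (1 + 1 / (σ + 1)) * Par.odd.wt σ X :=
    mul_nonneg (by positivity) (Par.wt_nonneg σ .odd hX)
  refine hD.le_of_lip' hC ?_
  filter_upwards [Metric.closedBall_mem_nhds (0 : ℝ) zero_lt_one] with h hh
  have := hinc h (by simpa using hh)
  simpa using this

lemma pd_comm_of_cls {m : ℕ} (hm : 2 ≤ m) {q : Par} {f : Space n → ℝ} (hf : Cls σ m q f)
    (i j : Fin (n + 1)) : EqOn (pd i (pd j f)) (pd j (pd i f)) (upper n) := fun _ hX =>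
  pd_comm (hf.contDiffOn.of_le (by norm_cast)) i j hX

/-- Vanishing of the first and third normal derivatives gives the even class. -/
lemma cls_even_odd_of_any (hσ : -1 < σ) (m : ℕ) :
    (∀ f : Space n → ℝ, m ≤ 5 → Cls σ m .any f →
      (2 ≤ m → LocBdd (Par.odd.wt σ) (pd (Fin.last n) f)) →
      (4 ≤ m → LocBdd (Par.odd.wt σ)
        (pd (Fin.last n) (pd (Fin.last n) (pd (Fin.last n) f)))) → Cls σ m .even f) ∧
    (∀ f : Space n → ℝ, m ≤ 4 → Cls σ m .any f → (1 ≤ m → LocBdd (Par.odd.wt σ) f) →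
      (3 ≤ m → LocBdd (Par.odd.wt σ) (pd (Fin.last n) (pd (Fin.last n) f))) →
      Cls σ m .odd f) := by
  -- A normal derivative exchanges the two claims, so they are proved together. Below order five the
  -- only odd numbers of normal derivatives are one and three, which explains the restrictions m ≤ 5
  -- and m ≤ 4.
  induction m with
  | zero => exact ⟨fun f _ hf _ _ => hf, fun f _ hf _ _ => hf⟩
  | succ m ih =>
    have hp : ∀ {k : ℕ} {f : Space n → ℝ} (_ : Cls σ (k + 1) .any f) (j : Fin (n + 1)),
        Cls σ k .any (pd j f) := fun hf j => by simpa [Par.any_at] using hf.pderiv j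
    refine ⟨fun f hm hf h1 h3 => ⟨hf.1, hf.2.1, fun j => ?_⟩,
      fun f hm hf h1 h3 => ⟨hf.1, h1 (by omega), fun j => ?_⟩⟩
    · by_cases hj : j = Fin.last n
      · subst hj
        rw [Par.at_last]
        exact ih.2 _ (by omega) (hp hf _) (fun h => h1 (by omega)) (fun h => h3 (by omega))
      · rw [Par.at_of_ne _ hj]
        refine ih.1 _ (by omega) (hp hf j) (fun h => ?_) (fun h => ?_)
        · exact (LocBdd.odd_pd hσ ((hp hf (Fin.last n)).of_le hσ h) (h1 (by omega)) hj).congr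
            (pd_comm_of_cls (by omega) hf _ _)
        -- A third normal derivative of ∂_j f matters only when ∂_j f is considered at order 4, that
        -- is, f at the top order 5.
        · obtain rfl : m = 4 := by omega
          have hyy := hp (hp hf (Fin.last n)) (Fin.last n)
          refine (LocBdd.odd_pd hσ (hp hyy (Fin.last n)) (h3 (by omega)) hj).congr ?_
          intro X hX
          rw [pd_comm_of_cls (by omega) hyy _ _ hX]
          refine pd_eqOn (fun Y hY => ?_) _ hX
          rw [pd_comm_of_cls (by omega) (hp hf (Fin.last n)) _ _ hY]
          exact pd_eqOn (pd_comm_of_cls (by omega) hf _ _) _ hY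
    · by_cases hj : j = Fin.last n
      · subst hj
        rw [Par.at_last]
        exact ih.1 _ (by omega) (hp hf _) (fun h => h3 (by omega)) (fun h => by omega)
      · rw [Par.at_of_ne _ hj]
        refine ih.2 _ (by omega) (hp hf j) (fun h => ?_) (fun h => ?_)
        · exact LocBdd.odd_pd hσ (hf.of_le hσ (by omega)) (h1 (by omega)) hj
        · obtain ⟨k, rfl⟩ : ∃ k, m = k + 3 := ⟨m - 3, by omega⟩
          have hyy := hp (hp hf (Fin.last n)) (Fin.last n)
          refine (LocBdd.odd_pd hσ (hyy.of_le hσ (by omega)) (h3 (by omega)) hj).congr ?_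
          intro X hX
          rw [pd_comm_of_cls (by omega) (hp hf (Fin.last n)) _ _ hX]
          exact pd_eqOn (pd_comm_of_cls (by omega) hf _ _) _ hX

end LaneEmden

end

/-! ### Limits along vertical segments; extended solutions are even to order five -/

noncomputable section

namespace LaneEmden

variable {n : ℕ} {σ : ℝ}

/-- The trace `x` of the point `(x, y)`. -/
def base (X : Space n) : EuclideanSpace ℝ (Fin n) := WithLp.toLp 2 fun i => X i.castSucc

lemma bdry_last (x : EuclideanSpace ℝ (Fin n)) : bdry x (Fin.last n) = 0 := by
  simp [bdry]

lemma bdry_castSucc (x : EuclideanSpace ℝ (Fin n)) (i : Fin n) : bdry x i.castSucc = x i := by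
  simp [bdry]

lemma vscale_zero (X : Space n) : vscale 0 X = bdry (base X) := by
  ext i
  refine Fin.lastCases ?_ (fun i => ?_) i
  · rw [vscale_last, bdry_last, zero_mul]
  · rw [vscale_of_ne _ _ (Fin.castSucc_lt_last i).ne, bdry_castSucc]; rfl

lemma tendsto_vscale_bdry {X : Space n} (hX : X ∈ upper n) :
    Tendsto (fun s : ℝ => vscale s X) (𝓝[>] 0) (𝓝[upper n] bdry (base X)) := by
  refine tendsto_nhdsWithin_iff.2 ⟨?_, ?_⟩
  · have := (continuous_vscale_left X).tendsto 0
    rw [vscale_zero] at this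
    exact this.mono_left nhdsWithin_le_nhds
  · filter_upwards [self_mem_nhdsWithin] with s hs using vscale_mem_upper hs hX

lemma LocBdd.isBigO_slice {f w : Space n → ℝ} (hf : LocBdd w f) {X : Space n} (hX : X ∈ upper n) :
    ∃ M : ℝ, ∀ s ∈ Ioc (0 : ℝ) 1, |f (vscale s X)| ≤ M * w (vscale s X) := by
  obtain ⟨M, _, H⟩ := hf ‖X‖
  exact ⟨M, fun s hs => H _ (vscale_mem_upper hs.1 hX) (norm_vscale_le hs.1.le hs.2 X)⟩

lemma tendsto_mul_slice {f w : Space n → ℝ} (hf : LocBdd w f) {X : Space n} (hX : X ∈ upper n)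
    {a : ℝ → ℝ} (ha : Tendsto (fun s => |a s| * w (vscale s X)) (𝓝[>] 0) (𝓝 0)) :
    Tendsto (fun s => a s * f (vscale s X)) (𝓝[>] 0) (𝓝 0) := by
  obtain ⟨M, H⟩ := hf.isBigO_slice hX
  have h1 := ha.const_mul M
  rw [mul_zero] at h1
  refine squeeze_zero_norm' ?_ h1
  filter_upwards [Ioc_mem_nhdsGT (zero_lt_one' ℝ)] with s hs
  rw [norm_mul, Real.norm_eq_abs, Real.norm_eq_abs]
  calc |a s| * |f (vscale s X)| ≤ |a s| * (M * w (vscale s X)) :=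
        mul_le_mul_of_nonneg_left (H s hs) (abs_nonneg _)
    _ = _ := by ring

lemma tendsto_id_slice (X : Space n) :
    Tendsto (fun s : ℝ => s * ht X) (𝓝[>] 0) (𝓝 0) := by
  have : Tendsto (fun s : ℝ => s * ht X) (𝓝 0) (𝓝 (0 * ht X)) := tendsto_id.mul_const _
  rw [zero_mul] at this
  exact this.mono_left nhdsWithin_le_nhds

lemma tendsto_rpow_slice (X : Space n) {r : ℝ} (hr : 0 < r) :
    Tendsto (fun s : ℝ => (s * ht X) ^ r) (𝓝[>] 0) (𝓝 0) := by
  have h := (Real.continuousAt_rpow_const 0 r (Or.inr hr.le)).tendsto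
  rw [Real.zero_rpow hr.ne'] at h
  exact h.comp (tendsto_id_slice X)

/-- If `yᵇ ∂_y Δ_b f` converges on the boundary and `b ≠ 0`, then `∂_y f` vanishes there. -/
lemma tendsto_pd_last_of_lapB (hσ : -1 < σ) {b : ℝ} (hb : b ≠ 0) (hb2 : b < 2)
    {f : Space n → ℝ} (hf : Cls σ 3 .any f) {X : Space n} (hX : X ∈ upper n) {L : ℝ}
    (hL : Tendsto (fun s : ℝ => ht (vscale s X) ^ b * dy (lapB b f) (vscale s X)) (𝓝[>] 0) (𝓝 L)) :
    Tendsto (fun s : ℝ => pd (Fin.last n) f (vscale s X)) (𝓝[>] 0) (𝓝 0) := by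
  set l := Fin.last n
  have hp : ∀ {k : ℕ} {f : Space n → ℝ} (_ : Cls σ (k + 1) .any f) (j : Fin (n + 1)),
      Cls σ k .any (pd j f) := fun hf j => by simpa [Par.any_at] using hf.pderiv j
  have hS : Cls σ 1 .any (fun Y => ∑ j, pd j (pd j f) Y) := Cls.sum _ fun j _ => hp (hp hf j) j
  have hform : ∀ Y ∈ upper n, dy (lapB b f) Y = pd l (fun Y => ∑ j, pd j (pd j f) Y) Y +
      b * (pd l (pd l f) Y / ht Y - pd l f Y / ht Y ^ 2) := by
    intro Y hY
    have hy : ht Y ≠ 0 := ne_of_gt hY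
    have h1 : EqOn (lapB b f)
        (fun Y => (∑ j, pd j (pd j f) Y) + b * ((ht Y)⁻¹ * pd l f Y)) (upper n) := fun Z hZ => by
      rw [lapB_eq_sum_pd (hf.contDiffOn.of_le (by norm_cast)) b hZ]; ring
    have hinv : DifferentiableAt ℝ (fun Z : Space n => (ht Z)⁻¹) Y :=
      (differentiableAt_coord l Y).inv hy
    have hinv' : pd l (fun Z : Space n => (ht Z)⁻¹) Y = -(1 / ht Y ^ 2) := by
      have h2 : HasFDerivAt (fun Z : Space n => (ht Z)⁻¹)
          ((-(ht Y ^ 2)⁻¹) • coordL l) Y := (hasDerivAt_inv hy).comp_hasFDerivAt Y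
            (hasFDerivAt_coord l Y)
      rw [pd, h2.fderiv]
      simp [l]
    have hfl := (hp hf l).differentiableAt hY
    rw [dy_eq_pd, pd_eqOn h1 l hY, pd_add (hS.differentiableAt hY) ((hinv.fun_mul hfl).const_mul b),
      pd_const_mul _ (hinv.fun_mul hfl), pd_mul hinv hfl, hinv']
    field_simp
    ring
  -- Multiply the formula for ∂_y Δ_b f by y². The terms y² ∂_y Δf and b y ∂_yy f tend to 0, and so
  -- does the left side, being y^(2-b) times a convergent quantity with b < 2. Only -b ∂_y f is
  -- left, and b ≠ 0.
  have h1 : Tendsto (fun s : ℝ => (s * ht X) ^ 2 *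
      pd l (fun Y => ∑ j, pd j (pd j f) Y) (vscale s X)) (𝓝[>] 0) (𝓝 0) := by
    refine tendsto_mul_slice ((hp hS l).locBdd_rho hσ) hX ?_
    have h2 : Tendsto (fun s : ℝ => (s * ht X) * Par.odd.wt σ (vscale s X)) (𝓝[>] 0)
        (𝓝 (0 * 0)) := (tendsto_id_slice X).mul (tendsto_wt_odd_slice hσ hX)
    rw [zero_mul] at h2
    refine h2.congr fun s => ?_
    rw [abs_of_nonneg (sq_nonneg _)]
    simp only [Par.wt, ht_vscale]; ring
  have h2 : Tendsto (fun s : ℝ => (s * ht X) * pd l (pd l f) (vscale s X)) (𝓝[>] 0) (𝓝 0) := by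
    refine tendsto_mul_slice ((hp (hp hf l) l).locBdd_one hσ) hX ?_
    simpa using (tendsto_id_slice X).abs
  have h3 : Tendsto (fun s : ℝ => (s * ht X) ^ (2 - b) *
      (ht (vscale s X) ^ b * dy (lapB b f) (vscale s X))) (𝓝[>] 0) (𝓝 (0 * L)) :=
    (tendsto_rpow_slice X (by linarith)).mul hL
  have h4 := (((h1.add (h2.const_mul b)).sub h3).const_mul (b⁻¹))
  simp only [mul_zero, zero_mul, add_zero, sub_zero] at h4
  refine h4.congr' ?_
  filter_upwards [self_mem_nhdsWithin] with s hs
  have hs' : 0 < s * ht X := mul_pos hs hX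
  rw [hform _ (vscale_mem_upper hs hX), ht_vscale, ← mul_assoc ((s * ht X) ^ (2 - b)),
    ← Real.rpow_add hs']
  simp only [sub_add_cancel, Real.rpow_two]
  generalize s * ht X = c at hs' ⊢
  have hc := hs'.ne'
  field_simp
  ring

/-- Cauchy criterion: vertical increments below height ty are at most a constant times the odd
weight there, which tends to 0 with t. -/
lemma exists_tendsto_slice (hσ : -1 < σ) {f : Space n → ℝ} (hf : Cls σ 1 .any f)
    {X : Space n} (hX : X ∈ upper n) :
    ∃ a, Tendsto (fun s : ℝ => f (vscale s X)) (𝓝[>] 0) (𝓝 a) := by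
  obtain ⟨M, hM, H⟩ := ((hf.pderiv (Fin.last n)).locBdd_rho hσ) ‖X‖
  have h0 : 0 < σ + 1 := by linarith
  set C := M * (1 + 1 / (σ + 1)) with hC
  have hC0 : 0 ≤ C := by positivity
  refine cauchy_map_iff_exists_tendsto.1 (Metric.cauchy_iff.2 ⟨inferInstance, fun ε hε => ?_⟩)
  have h1 := (tendsto_wt_odd_slice hσ hX).const_mul C
  rw [mul_zero] at h1
  have h2 : ∀ᶠ s : ℝ in 𝓝[>] 0, C * Par.odd.wt σ (vscale s X) < ε :=
    h1.eventually (gt_mem_nhds hε)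
  refine ⟨_, image_mem_map (inter_mem h2 (Ioc_mem_nhdsGT (zero_lt_one' ℝ))), ?_⟩
  have key : ∀ s t : ℝ, 0 < s → s ≤ t → t ≤ 1 → C * Par.odd.wt σ (vscale t X) < ε →
      |f (vscale t X) - f (vscale s X)| < ε := by
    intro s t hs hst ht1 hlt
    have ht0 := hs.trans_le hst
    have h3 := abs_sub_vscale_le hσ hf.1 hM H (vscale_mem_upper ht0 hX)
      (norm_vscale_le ht0.le ht1 X) (s := s / t) ⟨by positivity, (div_le_one ht0).2 hst⟩
    rw [slice_slice, div_mul_cancel₀ _ ht0.ne'] at h3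
    exact h3.trans_lt hlt
  rintro _ ⟨s, ⟨hs1, hs2⟩, rfl⟩ _ ⟨t, ⟨ht1, ht2⟩, rfl⟩
  rw [Real.dist_eq]
  rcases le_total s t with h | h
  · rw [abs_sub_comm]; exact key s t hs2.1 h ht2.2 ht1
  · exact key t s ht2.1 h hs2.2 hs1

/-- Dominated convergence; the factor 1/2 is ∫₀¹ t dt. -/
lemma tendsto_vavg_slice (hσ : -1 < σ) {f : Space n → ℝ} (hf : Cls σ 1 .any f)
    {X : Space n} (hX : X ∈ upper n) {a : ℝ}
    (ha : Tendsto (fun s : ℝ => f (vscale s X)) (𝓝[>] 0) (𝓝 a)) :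
    Tendsto (fun s : ℝ => vavg 1 f (vscale s X)) (𝓝[>] 0) (𝓝 (a / 2)) := by
  obtain ⟨M, hM⟩ := (hf.locBdd_one hσ).isBigO_slice hX
  have hint : ∫ t in Ioc (0 : ℝ) 1, t ^ 1 * a = a / 2 := by
    rw [← intervalIntegral.integral_of_le zero_le_one, intervalIntegral.integral_mul_const,
      integral_pow]
    norm_num; ring
  rw [← hint]
  refine tendsto_integral_filter_of_dominated_convergence (fun _ => M) ?_ ?_ (by simp) ?_
  · filter_upwards [self_mem_nhdsWithin] with s hs using
      aestronglyMeasurable_slice 1 hf.continuousOn (vscale_mem_upper hs hX)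
  · filter_upwards [Ioc_mem_nhdsGT (zero_lt_one' ℝ)] with s hs
    filter_upwards [ae_restrict_mem measurableSet_Ioc] with t ht'
    rw [norm_mul, Real.norm_eq_abs, Real.norm_eq_abs, pow_one, abs_of_pos ht'.1, slice_slice]
    refine (mul_le_of_le_one_left (abs_nonneg _) ht'.2).trans ?_
    have := hM (t * s) ⟨mul_pos ht'.1 hs.1, mul_le_one₀ ht'.2 hs.1.le hs.2⟩
    simpa using this
  · filter_upwards [ae_restrict_mem measurableSet_Ioc] with t ht'
    simp only [slice_slice]
    refine Tendsto.const_mul _ (ha.comp ?_)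
    refine tendsto_nhdsWithin_iff.2 ⟨?_, ?_⟩
    · have : Tendsto (fun s : ℝ => t * s) (𝓝 0) (𝓝 (t * 0)) := tendsto_id.const_mul t
      rw [mul_zero] at this
      exact this.mono_left nhdsWithin_le_nhds
    · filter_upwards [self_mem_nhdsWithin] with s hs using mul_pos ht'.1 hs

/-- The condition y^b ∂_y u → 0 alone does not give ∂_y u → 0 when b > 0. For b ≠ 0 this is
extracted from the next condition, the convergence of y^b ∂_y Δ_b u; likewise ∂_y Δ_b u → 0 comes
from the convergence of y^b ∂_y Δ_b² u. The vanishing of ∂_yyy u then follows from that of ∂_y Δ_b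
u. -/
theorem IsExtendedSolution.cls {s p κ : ℝ} (hs₂ : 2 < s) (hs₃ : s < 3) {u : Space n → ℝ}
    (hu : IsExtendedSolution n s p κ u) : Cls (2 * s - 5) 5 .even u := by
  set σ := 2 * s - 5 with hσdef
  have hσ : -1 < σ := by linarith
  have hσ1 : σ < 1 := by linarith
  set b := 5 - 2 * s with hb
  set l := Fin.last n
  have hp : ∀ {k : ℕ} {f : Space n → ℝ} (_ : Cls σ (k + 1) .any f) (j : Fin (n + 1)),
      Cls σ k .any (pd j f) := fun hf j => by simpa [Par.any_at] using hf.pderiv j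
  have hany : Cls σ 5 .any u := by
    refine cls_any_of_iteratedFDeriv hσ (hu.contDiffOn.of_le (by norm_cast)) fun R => ?_
    obtain ⟨M, H⟩ := hu.bound R
    refine ⟨|M|, abs_nonneg M, fun X hX hR => ?_⟩
    rw [abs_norm]
    exact (H X hX hR).trans (mul_le_mul_of_nonneg_right (le_abs_self M) (rho_nonneg σ hX))
  have hslice : ∀ {g : Space n → ℝ} {c : EuclideanSpace ℝ (Fin n) → ℝ},
      (∀ x, Tendsto g (𝓝[upper n] bdry x) (𝓝 (c x))) → ∀ X ∈ upper n,
      Tendsto (fun s : ℝ => g (vscale s X)) (𝓝[>] 0) (𝓝 (c (base X))) :=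
    fun hg X hX => (hg _).comp (tendsto_vscale_bdry hX)
  -- For b = 0 the weight is 1 and the boundary condition is the desired limit itself.
  have hone : ∀ {f : Space n → ℝ}, b = 0 →
      (∀ x, Tendsto (fun X => ht X ^ b * dy f X) (𝓝[upper n] bdry x) (𝓝 0)) →
      ∀ X ∈ upper n, Tendsto (fun s : ℝ => pd l f (vscale s X)) (𝓝[>] 0) (𝓝 0) := by
    intro f hb0 hf X hX
    simpa [hb0, dy_eq_pd] using hslice hf X hX
  have huy : LocBdd (Par.odd.wt σ) (pd l u) := by
    refine locBdd_odd_of_tendsto hσ (hp hany l).1 ((hp (hp hany l) l).locBdd_rho hσ)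
      fun X hX => ?_
    by_cases hb0 : b = 0
    · exact hone hb0 hu.bdry_zero X hX
    · exact tendsto_pd_last_of_lapB hσ hb0 (by linarith) (hany.of_le hσ (by norm_num)) hX
        (hslice hu.bdry_one X hX)
  have huyy : Cls σ 3 .any (pd l (pd l u)) := hp (hp hany l) l
  -- With y⁻¹ ∂_y u replaced by the average of ∂_yy u, the function Δ_b u visibly has three orders
  -- of regularity, although u is not yet known to be even.
  have hveq : EqOn (fun X => (∑ j, pd j (pd j u) X) + b * vavg 0 (pd l (pd l u)) X)
      (lapB b u) (upper n) := fun X hX => by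
    have hy : ht X ≠ 0 := ne_of_gt hX
    rw [lapB_eq_sum_pd (hany.contDiffOn.of_le (by norm_cast)) b hX, eq_ht_mul_vavg hσ
      ((hp hany l).of_le hσ (by norm_num)) hX (tendsto_slice_of_locBdd_odd hσ huy hX)]
    field_simp
    rfl
  have hS : Cls σ 3 .any (fun X => ∑ j, pd j (pd j u) X) :=
    Cls.sum _ fun j _ => hp (hp hany j) j
  have hv : Cls σ 3 .any (lapB b u) :=
    (hS.add ((huyy.vavg hσ 0).const_mul b)).congr hveq
  have hvy : ∀ X ∈ upper n, Tendsto (fun s : ℝ => pd l (lapB b u) (vscale s X)) (𝓝[>] 0) (𝓝 0) := by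
    intro X hX
    by_cases hb0 : b = 0
    · exact hone hb0 hu.bdry_one X hX
    · exact tendsto_pd_last_of_lapB hσ hb0 (by linarith) hv hX (hslice hu.bdry_two X hX)
  -- Two tangential derivatives preserve the vanishing of ∂_y u on the boundary, and they commute
  -- with ∂_y.
  have htan : ∀ j ≠ l, LocBdd (Par.odd.wt σ) (pd l (pd j (pd j u))) := by
    intro j hj
    have h1 := LocBdd.odd_pd hσ ((hp hany l).of_le hσ (by norm_num)) huy hj
    have h2 := LocBdd.odd_pd hσ ((hp (hp hany l) j).of_le hσ (by norm_num)) h1 hj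
    refine h2.congr fun X hX => ?_
    rw [pd_comm_of_cls (by norm_num) (hp hany j) l j hX]
    exact pd_eqOn (pd_comm_of_cls (by norm_num) hany j l) _ hX
  have h3 : Cls σ 2 .any (pd l (pd l (pd l u))) := hp huyy l
  have huyyy : LocBdd (Par.odd.wt σ) (pd l (pd l (pd l u))) := by
    refine locBdd_odd_of_tendsto hσ h3.1 ((hp h3 l).locBdd_rho hσ) fun X hX => ?_
    -- Let a be the boundary value of ∂_yyy u. Passing to the limit in ∂_y Δ_b u, the tangential
    -- terms vanish and the averaged term contributes b a/2, so a (1 + b/2) = 0; since b > -2, a =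
    -- 0.
    obtain ⟨a, ha⟩ := exists_tendsto_slice hσ (h3.of_le hσ (by norm_num)) hX
    have hvy' : ∀ Y ∈ upper n, pd l (lapB b u) Y = ((∑ j ∈ Finset.univ.erase l,
        pd l (pd j (pd j u)) Y) + pd l (pd l (pd l u)) Y) + b * vavg 1 (pd l (pd l (pd l u))) Y := by
      intro Y hY
      have hd1 : ∀ j ∈ Finset.univ, DifferentiableAt ℝ (pd j (pd j u)) Y :=
        fun j _ => (hp (hp hany j) j).differentiableAt hY
      have hd2 := (huyy.vavg hσ 0).differentiableAt hY
      rw [← pd_eqOn hveq l hY, pd_add (hS.differentiableAt hY) (hd2.const_mul b),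
        pd_const_mul b hd2, pd_vavg hσ (huyy.of_le hσ (by norm_num)) 0 l hY, pd_sum _ hd1,
        Finset.sum_erase_add _ _ (Finset.mem_univ l)]
      simp [l]
    have h5 : Tendsto (fun s : ℝ => ((∑ j ∈ Finset.univ.erase l,
        pd l (pd j (pd j u)) (vscale s X)) + pd l (pd l (pd l u)) (vscale s X)) +
        b * vavg 1 (pd l (pd l (pd l u))) (vscale s X)) (𝓝[>] 0)
        (𝓝 ((∑ j ∈ Finset.univ.erase l, 0) + a + b * (a / 2))) :=
      ((tendsto_finsetSum _ fun j hj => tendsto_slice_of_locBdd_odd hσ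
        (htan j (Finset.ne_of_mem_erase hj)) hX).add ha).add
        ((tendsto_vavg_slice hσ (h3.of_le hσ (by norm_num)) hX ha).const_mul b)
    have h6 := tendsto_nhds_unique (h5.congr' (by
      filter_upwards [self_mem_nhdsWithin] with t ht'
      exact (hvy' _ (vscale_mem_upper ht' hX)).symm)) (hvy X hX)
    rw [Finset.sum_const_zero, zero_add] at h6
    have h7 : a * (1 + b / 2) = 0 := by linarith
    have h8 : a = 0 := (mul_eq_zero.1 h7).resolve_right (by linarith)
    rwa [h8] at ha
  exact (cls_even_odd_of_any hσ 5).1 u le_rfl hany (fun _ => huy) fun _ => huyyy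

end LaneEmden

end

noncomputable section

namespace LaneEmden

variable {n : ℕ} {σ b : ℝ}

/-! ### Integration over the half-space and the half-sphere -/

lemma smul_mem_upper_iff {r : ℝ} (hr : 0 < r) {X : Space n} : r • X ∈ upper n ↔ X ∈ upper n := by
  change 0 < r * X (Fin.last n) ↔ 0 < X (Fin.last n)
  exact mul_pos_iff_of_pos_left hr

lemma measurableSet_hemi : MeasurableSet (hemi n) :=
  measurable_subtype_coe measurableSet_upper

lemma ht_smul (r : ℝ) (X : Space n) : ht (r • X) = r * ht X := rfl

instance : IsFiniteMeasure (surf n) := by unfold surf; infer_instance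

lemma finrank_space : Module.finrank ℝ (Space n) - 1 = n := by simp

lemma integrable_polar {f : Space n → ℝ} (hf : Integrable f) :
    Integrable (fun q : Metric.sphere (0 : Space n) 1 × Ioi (0 : ℝ) => f (q.2.1 • (q.1 : Space n)))
      ((surf n).prod (Measure.volumeIoiPow n)) := by
  have h := (volume : Measure (Space n)).measurePreserving_homeomorphUnitSphereProd
  rw [finrank_space] at h
  rw [surf, ← h.integrable_comp_emb (Homeomorph.measurableEmbedding _)]
  have h2 : IntegrableOn f ({0}ᶜ : Set (Space n)) := hf.integrableOn
  rw [integrableOn_iff_comap_subtypeVal (by measurability)] at h2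
  refine h2.congr (.of_forall fun X => ?_)
  have hX : ‖(X : Space n)‖ ≠ 0 := norm_ne_zero_iff.2 X.2
  simp [smul_smul, hX]

lemma integral_polar {f : Space n → ℝ} (hf : Integrable f) :
    ∫ X, f X = ∫ r in Ioi (0 : ℝ), r ^ n * ∫ ω, f (r • (ω : Space n)) ∂(surf n) := by
  have h := (volume : Measure (Space n)).measurePreserving_homeomorphUnitSphereProd
  rw [finrank_space] at h
  have hp := integrable_polar hf
  calc ∫ X, f X = ∫ X : ({(0)}ᶜ : Set (Space n)), f X ∂((volume : Measure (Space n)).comap (↑)) := by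
        rw [integral_subtype_comap (measurableSet_singleton _).compl, restrict_compl_singleton]
    _ = ∫ q, f (q.2.1 • (q.1 : Space n)) ∂((surf n).prod (Measure.volumeIoiPow n)) := by
        rw [surf, ← h.integral_comp (Homeomorph.measurableEmbedding _)]
        refine integral_congr_ae (.of_forall fun X => ?_)
        have hX : ‖(X : Space n)‖ ≠ 0 := norm_ne_zero_iff.2 X.2
        simp [smul_smul, hX]
    _ = ∫ r : Ioi (0 : ℝ), ∫ ω, f (r.1 • (ω : Space n)) ∂(surf n) ∂(Measure.volumeIoiPow n) :=
        integral_prod_symm _ hp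
    _ = _ := by
        simp only [Measure.volumeIoiPow, ENNReal.ofReal]
        rw [integral_withDensity_eq_integral_smul
          ((measurable_subtype_coe.pow_const _).real_toNNReal),
          integral_subtype_comap measurableSet_Ioi
            fun a => Real.toNNReal (a ^ n) • ∫ ω, f (a • (ω : Space n)) ∂(surf n)]
        refine setIntegral_congr_fun measurableSet_Ioi fun r hr => ?_
        simp only [NNReal.smul_def, Real.coe_toNNReal _ (pow_nonneg (le_of_lt hr) n), smul_eq_mul]

lemma indicator_upper_smul (f : Space n → ℝ) {r : ℝ} (hr : 0 < r)
    (ω : Metric.sphere (0 : Space n) 1) :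
    (upper n).indicator f (r • (ω : Space n)) =
      (hemi n).indicator (fun ω : Metric.sphere (0 : Space n) 1 => f (r • (ω : Space n))) ω := by
  by_cases h : (ω : Space n) ∈ upper n
  · rw [indicator_of_mem ((smul_mem_upper_iff hr).2 h), indicator_of_mem (by exact h)]
  · rw [indicator_of_notMem (fun h' => h ((smul_mem_upper_iff hr).1 h')),
      indicator_of_notMem (by exact h)]

lemma setIntegral_upper_polar {f : Space n → ℝ} (hf : IntegrableOn f (upper n)) :
    ∫ X in upper n, f X =
      ∫ r in Ioi (0 : ℝ), r ^ n * ∫ ω in hemi n, f (r • (ω : Space n)) ∂(surf n) := by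
  rw [← integral_indicator measurableSet_upper,
    integral_polar ((integrable_indicator_iff measurableSet_upper).2 hf)]
  refine setIntegral_congr_fun measurableSet_Ioi fun r hr => ?_
  simp only [indicator_upper_smul f hr]
  rw [integral_indicator measurableSet_hemi]

/-- The half-ball lies in a box on which 1 + y^b, times indicators of the tangential sides, is a
product of functions of one variable; the vertical factor is integrable because b > -1. -/
lemma integrableOn_rho (hb : -1 < b) (R : ℝ) :
    IntegrableOn (rho b) (upper n ∩ Metric.closedBall 0 R) := by
  set g : Fin (n + 1) → ℝ → ℝ := fun i => if i = Fin.last n then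
    (Ioc 0 |R|).indicator (fun y => 1 + y ^ b) else (Icc (-|R|) |R|).indicator fun _ => 1 with hg
  have hgi : ∀ i, Integrable (g i) := by
    intro i
    by_cases hi : i = Fin.last n
    · simp only [hg, hi, if_true]
      rw [integrable_indicator_iff measurableSet_Ioc]
      have h := (intervalIntegral.intervalIntegrable_rpow' (a := 0) (b := |R|) hb)
      rw [intervalIntegrable_iff_integrableOn_Ioc_of_le (abs_nonneg R)] at h
      exact (integrableOn_const (by simp)).add h
    · simp only [hg, hi, if_false]
      rw [integrable_indicator_iff measurableSet_Icc]
      exact integrableOn_const (by simp)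
  have h1 : Integrable fun x : Fin (n + 1) → ℝ => ∏ i, g i (x i) := Integrable.fintype_prod hgi
  have h2 := (PiLp.volume_preserving_ofLp (Fin (n + 1))).integrable_comp_of_integrable h1
  refine (h2.integrableOn (s := upper n ∩ Metric.closedBall 0 R)).congr_fun ?_
    (measurableSet_upper.inter measurableSet_closedBall)
  rintro X ⟨hX, hR⟩
  have hR' : ‖X‖ ≤ |R| := (by simpa using hR : ‖X‖ ≤ R).trans (le_abs_self R)
  simp only [Function.comp]
  rw [← Finset.mul_prod_erase _ _ (Finset.mem_univ (Fin.last n)), Finset.prod_eq_one, mul_one]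
  · simp only [hg, if_true]
    rw [indicator_of_mem]
    · rfl
    · exact ⟨hX, (ht_le_norm X).trans hR'⟩
  · intro i hi
    simp only [hg, Finset.ne_of_mem_erase hi, if_false]
    rw [indicator_of_mem]
    exact abs_le.1 ((abs_coord_le X i).trans hR')

lemma integrableOn_of_locBdd {f : Space n → ℝ} (hb : -1 < b) (hc : ContinuousOn f (upper n))
    (hf : LocBdd (rho b) f) (R : ℝ) : IntegrableOn f (upper n ∩ Metric.closedBall 0 R) := by
  obtain ⟨M, hM, H⟩ := hf R
  have hm : MeasurableSet (upper n ∩ Metric.closedBall (0 : Space n) R) :=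
    measurableSet_upper.inter measurableSet_closedBall
  refine Integrable.mono' ((integrableOn_rho hb R).const_mul M)
    ((hc.mono inter_subset_left).aestronglyMeasurable hm) ?_
  filter_upwards [ae_restrict_mem hm] with X hX
  exact H X hX.1 (by simpa using hX.2)

lemma volumeIoiPow_pos (n : ℕ) : Measure.volumeIoiPow n (Iio ⟨1, mem_Ioi.2 one_pos⟩) ≠ 0 := by
  rw [Measure.volumeIoiPow_apply_Iio]
  simp only [one_pow, ne_eq, ENNReal.ofReal_eq_zero, not_le]
  positivity

/-- By Fubini in polar coordinates, integrability on the half-ball passes to almost every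
half-sphere; one radius r < 1 is picked and homogeneity of y^b transports the result to the unit
half-sphere. -/
lemma integrableOn_hemi_rho (hb : -1 < b) :
    IntegrableOn (fun ω : Metric.sphere (0 : Space n) 1 => rho b (ω : Space n)) (hemi n)
      (surf n) := by
  have hm : MeasurableSet (upper n ∩ Metric.closedBall (0 : Space n) 1) :=
    measurableSet_upper.inter measurableSet_closedBall
  have h1 := integrable_polar ((integrable_indicator_iff hm).2 (integrableOn_rho (n := n) hb 1))
  have h2 := h1.prod_left_ae
  obtain ⟨r, hr1, hr2⟩ :=
    Measure.exists_mem_of_measure_ne_zero_of_ae (volumeIoiPow_pos n) (ae_restrict_of_ae h2)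
  have hr0 : 0 < r.1 := r.2
  have hrle : r.1 ≤ 1 := le_of_lt hr1
  have h3 : IntegrableOn (fun ω : Metric.sphere (0 : Space n) 1 => rho b (r.1 • (ω : Space n)))
      (hemi n) (surf n) := by
    rw [← integrable_indicator_iff measurableSet_hemi]
    refine hr2.congr (.of_forall fun ω => ?_)
    have hmem : r.1 • (ω : Space n) ∈ Metric.closedBall (0 : Space n) 1 := by
      simp [norm_smul, abs_of_pos hr0, hrle]
    rw [← indicator_upper_smul _ hr0, inter_comm, ← indicator_indicator]
    exact indicator_of_mem hmem _
  -- Undoes the scaling: on the sphere the weight at rω minus 1 equals r^b y^b.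
  have h4 : IntegrableOn (fun ω : Metric.sphere (0 : Space n) 1 =>
      1 + (r.1 ^ b)⁻¹ * (rho b (r.1 • (ω : Space n)) - 1)) (hemi n) (surf n) :=
    (integrableOn_const (by simp)).add ((h3.sub (integrableOn_const (by simp))).const_mul _)
  refine h4.congr_fun (fun ω hω => ?_) measurableSet_hemi
  have hω' : 0 < ht (ω : Space n) := hω
  have hrb : r.1 ^ b ≠ 0 := (Real.rpow_pos_of_pos hr0 b).ne'
  simp only [rho, ht_smul]
  rw [Real.mul_rpow hr0.le hω'.le]
  field_simp
  ring

lemma norm_smul_sphere {r : ℝ} (hr : 0 ≤ r) (ω : Metric.sphere (0 : Space n) 1) :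
    ‖r • (ω : Space n)‖ = r := by
  simp [norm_smul, abs_of_nonneg hr]

lemma continuousOn_hemi {f : Space n → ℝ} (hc : ContinuousOn f (upper n)) {r : ℝ} (hr : 0 < r) :
    ContinuousOn (fun ω : Metric.sphere (0 : Space n) 1 => f (r • (ω : Space n))) (hemi n) :=
  hc.comp (by fun_prop) fun _ hω => (smul_mem_upper_iff hr).2 hω

lemma rho_smul_le {r : ℝ} (h1 : 1 / 2 ≤ r) (h2 : r ≤ 2) {X : Space n} (hX : X ∈ upper n) :
    rho b (r • X) ≤ (1 + ((1 / 2) ^ b + 2 ^ b)) * rho b X := by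
  have hr : 0 < r := by linarith
  have hy : 0 < ht X := hX
  rw [rho, ht_smul, Real.mul_rpow hr.le hy.le, rho]
  have h3 := rpow_le_of_mem_Icc (σ := b) (by norm_num : (0 : ℝ) < 1 / 2) h1 h2
  have h4 : 0 ≤ ht X ^ b := Real.rpow_nonneg hy.le b
  have h5 : (0 : ℝ) ≤ (1 / 2) ^ b := by positivity
  have h6 : (0 : ℝ) ≤ 2 ^ b := by positivity
  nlinarith [mul_le_mul_of_nonneg_right h3 h4]

/-- Uniform domination on half-spheres of radius close to one. -/
lemma LocBdd.hemi_bound {f : Space n → ℝ} (hf : LocBdd (rho b) f) :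
    ∃ M : ℝ, 0 ≤ M ∧ ∀ r : ℝ, 1 / 2 ≤ r → r ≤ 2 → ∀ X ∈ upper n, ‖X‖ ≤ 1 →
      |f (r • X)| ≤ M * rho b X := by
  obtain ⟨M, hM, H⟩ := hf 2
  refine ⟨M * (1 + ((1 / 2) ^ b + 2 ^ b)), by positivity, fun r h1 h2 X hX hX1 => ?_⟩
  have hr : 0 < r := by linarith
  have hn : ‖r • X‖ ≤ 2 := by
    rw [norm_smul, Real.norm_eq_abs, abs_of_pos hr]; nlinarith [norm_nonneg X]
  refine (H _ ((smul_mem_upper_iff hr).2 hX) hn).trans ?_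
  rw [mul_assoc]
  exact mul_le_mul_of_nonneg_left (rho_smul_le h1 h2 hX) hM

lemma integrableOn_hemi {f : Space n → ℝ} (hb : -1 < b) (hc : ContinuousOn f (upper n))
    (hf : LocBdd (rho b) f) : IntegrableOn
      (fun ω : Metric.sphere (0 : Space n) 1 => f (ω : Space n)) (hemi n) (surf n) := by
  obtain ⟨M, hM, H⟩ := hf 1
  refine Integrable.mono' ((integrableOn_hemi_rho hb).const_mul M) ?_ ?_
  · have := (continuousOn_hemi hc one_pos).aestronglyMeasurable (μ := surf n) measurableSet_hemi
    simpa using this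
  · filter_upwards [ae_restrict_mem measurableSet_hemi] with ω hω
    exact H _ hω (by simp)

lemma continuousAt_hemi_integral {f : Space n → ℝ} (hb : -1 < b) (hc : ContinuousOn f (upper n))
    (hf : LocBdd (rho b) f) {s : ℝ} (hs : s ∈ Ioo (1 / 2 : ℝ) 2) :
    ContinuousAt (fun r : ℝ => ∫ ω in hemi n, f (r • (ω : Space n)) ∂(surf n)) s := by
  obtain ⟨M, hM, H⟩ := hf.hemi_bound
  have hnhd : Icc (1 / 2 : ℝ) 2 ∈ 𝓝 s := Icc_mem_nhds hs.1 hs.2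
  have hs0 : 0 < s := by linarith [hs.1]
  refine continuousAt_of_dominated (bound := fun ω => M * rho b (ω : Space n)) ?_ ?_
    ((integrableOn_hemi_rho hb).const_mul M) ?_
  · filter_upwards [hnhd] with r hr using (continuousOn_hemi hc
      (by linarith [hr.1])).aestronglyMeasurable measurableSet_hemi
  · filter_upwards [hnhd] with r hr
    filter_upwards [ae_restrict_mem measurableSet_hemi] with ω hω using
      H r hr.1 hr.2 _ hω (by simp)
  · filter_upwards [ae_restrict_mem measurableSet_hemi] with ω hω
    have : ContinuousAt f (s • (ω : Space n)) :=
      hc.continuousAt (upper_mem_nhds ((smul_mem_upper_iff hs0).2 hω))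
    exact ContinuousAt.comp (f := fun r : ℝ => r • (ω : Space n)) this (by fun_prop)

end LaneEmden

end

noncomputable section

namespace LaneEmden

variable {n : ℕ} {σ b : ℝ}

/-! ### The divergence theorem on the half-space and on the half-ball -/

/-- The point `(x, y)`. -/
def lift (x : EuclideanSpace ℝ (Fin n)) (y : ℝ) : Space n :=
  bdry x + y • EuclideanSpace.single (Fin.last n) (1 : ℝ)

lemma lift_last (x : EuclideanSpace ℝ (Fin n)) (y : ℝ) : lift x y (Fin.last n) = y := by
  simp [lift, bdry_last]

lemma ht_lift (x : EuclideanSpace ℝ (Fin n)) (y : ℝ) : ht (lift x y) = y := lift_last x y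

lemma lift_castSucc (x : EuclideanSpace ℝ (Fin n)) (y : ℝ) (i : Fin n) :
    lift x y i.castSucc = x i := by
  simp [lift, bdry_castSucc, (Fin.castSucc_lt_last i).ne]

lemma lift_mem_upper (x : EuclideanSpace ℝ (Fin n)) {y : ℝ} (hy : 0 < y) : lift x y ∈ upper n := by
  change 0 < ht _; rwa [ht_lift]

lemma norm_sq_lift (x : EuclideanSpace ℝ (Fin n)) (y : ℝ) : ‖lift x y‖ ^ 2 = ‖x‖ ^ 2 + y ^ 2 := by
  rw [EuclideanSpace.real_norm_sq_eq, EuclideanSpace.real_norm_sq_eq, Fin.sum_univ_castSucc]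
  simp only [lift_castSucc, lift_last]

lemma norm_le_norm_lift (x : EuclideanSpace ℝ (Fin n)) (y : ℝ) : ‖x‖ ≤ ‖lift x y‖ := by
  refine (pow_le_pow_iff_left₀ (norm_nonneg _) (norm_nonneg _) two_ne_zero).1 ?_
  rw [norm_sq_lift]
  nlinarith [sq_nonneg y]

lemma continuous_bdry : Continuous (bdry : EuclideanSpace ℝ (Fin n) → Space n) := by
  refine (PiLp.continuous_toLp 2 _).comp (continuous_pi fun i => ?_)
  refine Fin.lastCases ?_ (fun i => ?_) i
  · simpa using continuous_const
  · simpa using (EuclideanSpace.proj (𝕜 := ℝ) i).continuous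

lemma continuous_lift : Continuous fun q : EuclideanSpace ℝ (Fin n) × ℝ => lift q.1 q.2 :=
  (continuous_bdry.comp continuous_fst).add (continuous_snd.smul continuous_const)

lemma pd_eq_zero_of_norm_lt {G : Space n → ℝ} {R : ℝ}
    (hs : ∀ X ∈ upper n, R ≤ ‖X‖ → G X = 0) {X : Space n} (hX : X ∈ upper n) (hR : R < ‖X‖)
    (j : Fin (n + 1)) : pd j G X = 0 := by
  have h : G =ᶠ[𝓝 X] fun _ => 0 := by
    filter_upwards [upper_mem_nhds hX, (isOpen_lt continuous_const continuous_norm).mem_nhds hR]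
      with Y hY hY' using hs Y hY (le_of_lt hY')
  rw [pd_congr_of_eventuallyEq h]
  simp [pd]

/-- The divergence theorem on the box [-R, R]^n × [ε, R]. The field vanishes where |X| ≥ R, hence on
every face but the bottom one, whose outer normal is -e_y. -/
lemma integral_divergence_slab {G : Fin (n + 1) → Space n → ℝ} {R ε : ℝ} (hε : 0 < ε) (hεR : ε < R)
    (hG : ∀ j, DifferentiableOn ℝ (G j) (upper n))
    (hs : ∀ j, ∀ X ∈ upper n, R ≤ ‖X‖ → G j X = 0)
    (hint : IntegrableOn (fun X => ∑ j, pd j (G j) X) (upper n)) :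
    ∫ X in {X : Space n | ε ≤ ht X}, ∑ j, pd j (G j) X = - ∫ x, G (Fin.last n) (lift x ε) := by
  set l := Fin.last n with hl
  set E : (Fin (n + 1) → ℝ) ≃L[ℝ] Space n := (EuclideanSpace.equiv (Fin (n + 1)) ℝ).symm with hE
  have hEi : ∀ x i, E x i = x i := fun x i => rfl
  have hEs : ∀ i, E (Pi.single i 1) = EuclideanSpace.single i (1 : ℝ) := fun i => rfl
  set a : Fin (n + 1) → ℝ := fun i => if i = l then ε else -R with ha
  have hal : a l = ε := by simp [ha]
  have hane : ∀ {i}, i ≠ l → a i = -R := fun h => by simp [ha, h]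
  have hab : a ≤ fun _ => R := fun i => by
    by_cases h : i = l
    · rw [h, hal]; exact hεR.le
    · rw [hane h]; linarith
  have hup : ∀ x ∈ Icc a (fun _ => R), E x ∈ upper n := fun x hx => by
    have h1 := hx.1 l
    rw [hal] at h1
    exact hε.trans_le h1
  have hmp := PiLp.volume_preserving_toLp (Fin (n + 1))
  have hemb : MeasurableEmbedding (E : (Fin (n + 1) → ℝ) → Space n) :=
    E.toHomeomorph.measurableEmbedding
  have hmp' : MeasurePreserving (E : (Fin (n + 1) → ℝ) → Space n) := hmp
  have hzero : ∀ (j : Fin (n + 1)) (x : Fin (n + 1) → ℝ) (i : Fin (n + 1)), E x ∈ upper n →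
      |x i| = R → G j (E x) = 0 := fun j x i hx hi =>
    hs j _ hx (by rw [← hi]; exact abs_coord_le (E x) i)
  have hout : ∀ x : Fin (n + 1) → ℝ, ε ≤ x l → x ∉ Icc a (fun _ => R) → R < ‖E x‖ := by
    intro x hx hx'
    by_contra hcon
    refine hx' ⟨fun i => ?_, fun i => ?_⟩
    · by_cases h : i = l
      · rw [h, hal]; exact hx
      · rw [hane h]
        exact (abs_le.1 ((abs_coord_le (E x) i).trans (not_lt.1 hcon))).1
    · exact (abs_le.1 ((abs_coord_le (E x) i).trans (not_lt.1 hcon))).2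
  have hdiv := integral_divergence_of_hasFDerivAt_off_countable' a (fun _ => R) hab
    (fun i x => G i (E x))
    (fun i x => (fderiv ℝ (G i) (E x)).comp (E : (Fin (n + 1) → ℝ) →L[ℝ] Space n)) ∅ countable_empty
    (fun i => (hG i).continuousOn.comp E.continuous.continuousOn hup)
    (fun x hx i => by
      have hx' : x ∈ Icc a (fun _ => R) :=
        ⟨fun i => ((hx.1 i trivial).1).le, fun i => ((hx.1 i trivial).2).le⟩
      exact ((hG i).differentiableAt (upper_mem_nhds (hup x hx'))).hasFDerivAt.comp x
        E.hasFDerivAt)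
    (by
      have h1 := (hmp'.integrableOn_comp_preimage hemb).2 hint
      refine (h1.mono_set hup).congr_fun (fun x _ => ?_) measurableSet_Icc
      simp only [Function.comp, ContinuousLinearMap.comp_apply, pd]
      rfl)
  have hlhs : ∫ x in Icc a (fun _ => R), ∑ i, (fderiv ℝ (G i) (E x)).comp
      (E : (Fin (n + 1) → ℝ) →L[ℝ] Space n) (Pi.single i 1) =
      ∫ X in {X : Space n | ε ≤ ht X}, ∑ j, pd j (G j) X := by
    rw [← hmp'.setIntegral_preimage_emb hemb]
    refine (setIntegral_eq_of_subset_of_forall_sdiff_eq_zero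
      (f := fun x => ∑ j, pd j (G j) (E x)) ?_ ?_ ?_).symm
    · exact hemb.measurable (measurableSet_le measurable_const continuous_ht.measurable)
    · intro x hx
      have h1 := hx.1 l
      rw [hal] at h1
      exact h1
    · rintro x ⟨hx1, hx2⟩
      have hx1' : ε ≤ x l := hx1
      exact Finset.sum_eq_zero fun j _ => pd_eq_zero_of_norm_lt (hs j)
        (hε.trans_le hx1') (hout x hx1' hx2) j
  rw [hlhs] at hdiv
  rw [hdiv]
  have hlast : ∀ (i : Fin (n + 1)) (c : ℝ) (x : Fin n → ℝ), i ≠ l →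
      x ∈ Icc (a ∘ i.succAbove) ((fun _ => R) ∘ i.succAbove) → E (i.insertNth c x) ∈ upper n := by
    intro i c x hi hx
    obtain ⟨k, hk⟩ := Fin.exists_succAbove_eq (x := l) (y := i) hi.symm
    have h1 := hx.1 k
    simp only [Function.comp, hk, hal] at h1
    change 0 < i.insertNth (α := fun _ => ℝ) c x l
    rw [← hk, Fin.insertNth_apply_succAbove]
    exact hε.trans_le h1
  have hR : 0 < R := hε.trans hεR
  -- A lateral face has |x_i| = R, so only the pair of faces orthogonal to e_y can contribute, and
  -- of that pair the top face has y = R.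
  rw [Finset.sum_eq_single l]
  · rw [setIntegral_eq_zero_of_forall_eq_zero, zero_sub, neg_inj]
    · have hins : ∀ x : Fin n → ℝ, E (Fin.insertNth l (a l) x) =
          lift (WithLp.toLp 2 x) ε := by
        intro x
        ext i
        refine Fin.lastCases ?_ (fun i => ?_) i
        · rw [lift_last, hEi, hal, hl]; simp
        · rw [lift_castSucc, hEi, hl, Fin.insertNth_last']; simp
      have hmn := PiLp.volume_preserving_toLp (Fin n)
      have hembn : MeasurableEmbedding (WithLp.toLp 2 : (Fin n → ℝ) → EuclideanSpace ℝ (Fin n)) :=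
        (EuclideanSpace.equiv (Fin n) ℝ).symm.toHomeomorph.measurableEmbedding
      rw [← hmn.integral_comp hembn]
      simp only [hins]
      refine setIntegral_eq_integral_of_forall_compl_eq_zero fun x hx => ?_
      refine hs l _ (lift_mem_upper _ hε) (le_trans ?_ (norm_le_norm_lift _ _))
      by_contra hcon
      refine hx ⟨fun i => ?_, fun i => ?_⟩
      · have := PiLp.norm_apply_le (WithLp.toLp 2 x : EuclideanSpace ℝ (Fin n)) i
        have h2 := (abs_le.1 (this.trans (not_le.1 hcon).le)).1
        simp only [Function.comp]
        rw [hane (by rw [hl, Fin.succAbove_last]; exact (Fin.castSucc_lt_last i).ne)]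
        exact h2
      · have := PiLp.norm_apply_le (WithLp.toLp 2 x : EuclideanSpace ℝ (Fin n)) i
        exact (abs_le.1 (this.trans (not_le.1 hcon).le)).2
    · intro x _
      refine hzero l _ l ?_ ?_
      · change 0 < Fin.insertNth (α := fun _ => ℝ) l R x l
        rw [Fin.insertNth_apply_same]; exact hR
      · rw [Fin.insertNth_apply_same, abs_of_pos hR]
  · intro i _ hi
    rw [setIntegral_eq_zero_of_forall_eq_zero, setIntegral_eq_zero_of_forall_eq_zero, sub_zero]
    · intro x hx
      refine hzero i _ i (hlast i _ x hi hx) ?_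
      rw [Fin.insertNth_apply_same, hane hi, abs_neg, abs_of_pos hR]
    · intro x hx
      refine hzero i _ i (hlast i _ x hi hx) ?_
      rw [Fin.insertNth_apply_same, abs_of_pos hR]
  · simp

/-- The half-space is exhausted by the slabs y ≥ 1/(m+1). The bottom faces converge by dominated
convergence, as the normal component is bounded and supported over a fixed ball; the other
components may blow up at the boundary. -/
theorem integral_divergence_upper {G : Fin (n + 1) → Space n → ℝ} {R : ℝ} (hR : 1 < R)
    (hG : ∀ j, DifferentiableOn ℝ (G j) (upper n))
    (hs : ∀ j, ∀ X ∈ upper n, R ≤ ‖X‖ → G j X = 0)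
    (hint : IntegrableOn (fun X => ∑ j, pd j (G j) X) (upper n)) {M : ℝ}
    (hM : ∀ X ∈ upper n, |G (Fin.last n) X| ≤ M) {g : EuclideanSpace ℝ (Fin n) → ℝ}
    (hg : ∀ x, Tendsto (fun y => G (Fin.last n) (lift x y)) (𝓝[>] 0) (𝓝 (g x))) :
    ∫ X in upper n, ∑ j, pd j (G j) X = - ∫ x, g x := by
  set e : ℕ → ℝ := fun m => 1 / ((m : ℝ) + 1) with he
  have he0 : ∀ m, 0 < e m := fun m => by positivity
  have he1 : ∀ m, e m ≤ 1 := fun m => by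
    rw [he]; simp only; rw [div_le_one (by positivity)]; linarith [Nat.cast_nonneg (α := ℝ) m]
  have het : Tendsto e atTop (𝓝 0) := tendsto_one_div_add_atTop_nhds_zero_nat
  have hunion : ⋃ m, {X : Space n | e m ≤ ht X} = upper n := by
    ext X
    simp only [mem_iUnion, mem_ofPred_eq]
    constructor
    · rintro ⟨m, hm⟩
      exact (he0 m).trans_le hm
    · intro hX
      exact ((het.eventually (gt_mem_nhds (show 0 < ht X from hX))).exists).imp fun m hm => le_of_lt hm
  have h1 : Tendsto (fun m => ∫ X in {X : Space n | e m ≤ ht X}, ∑ j, pd j (G j) X) atTop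
      (𝓝 (∫ X in upper n, ∑ j, pd j (G j) X)) := by
    have := tendsto_setIntegral_of_monotone (μ := volume)
      (s := fun m => {X : Space n | e m ≤ ht X}) (f := fun X => ∑ j, pd j (G j) X)
      (fun m => measurableSet_le measurable_const continuous_ht.measurable)
      (fun m m' h X (hX : e m ≤ ht X) => by
        refine le_trans ?_ hX
        exact one_div_le_one_div_of_le (by positivity) (by
          have : (m : ℝ) ≤ m' := by exact_mod_cast h
          linarith))
      (by rw [hunion]; exact hint)
    rwa [hunion] at this
  have h2 : Tendsto (fun m => ∫ x, G (Fin.last n) (lift x (e m))) atTop (𝓝 (∫ x, g x)) := by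
    refine tendsto_integral_of_dominated_convergence
      ((Metric.closedBall (0 : EuclideanSpace ℝ (Fin n)) R).indicator fun _ => M) ?_ ?_ ?_ ?_
    · intro m
      refine Continuous.aestronglyMeasurable ?_
      exact (hG _).continuousOn.comp_continuous
        (continuous_lift.comp (by fun_prop : Continuous fun x => (x, e m)))
        fun x => lift_mem_upper x (he0 m)
    · rw [integrable_indicator_iff measurableSet_closedBall]
      exact integrableOn_const measure_closedBall_lt_top.ne
    · intro m
      refine .of_forall fun x => ?_
      by_cases hx : x ∈ Metric.closedBall (0 : EuclideanSpace ℝ (Fin n)) R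
      · rw [indicator_of_mem hx]
        exact hM _ (lift_mem_upper x (he0 m))
      · rw [indicator_of_notMem hx, hs _ _ (lift_mem_upper x (he0 m)), norm_zero]
        refine le_trans ?_ (norm_le_norm_lift _ _)
        simp only [Metric.mem_closedBall, dist_zero_right, not_le] at hx
        exact hx.le
    · refine .of_forall fun x => (hg x).comp ?_
      exact tendsto_nhdsWithin_iff.2 ⟨het, .of_forall fun m => he0 m⟩
  have h3 : ∀ m, ∫ X in {X : Space n | e m ≤ ht X}, ∑ j, pd j (G j) X =
      - ∫ x, G (Fin.last n) (lift x (e m)) := fun m =>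
    integral_divergence_slab (he0 m) ((he1 m).trans_lt hR) hG hs hint
  simp only [h3] at h1
  exact tendsto_nhds_unique h1 h2.neg

end LaneEmden

end

/-! ### Radial cut-offs and the divergence theorem on the half-ball -/

noncomputable section

namespace LaneEmden

variable {n : ℕ} {σ b : ℝ}

lemma deriv_smoothTransition_nonneg (x : ℝ) : 0 ≤ deriv Real.smoothTransition x :=
  Real.smoothTransition.monotone.deriv_nonneg

lemma deriv_smoothTransition_of_nonpos {x : ℝ} (hx : x ≤ 0) : deriv Real.smoothTransition x = 0 :=
  IsLocalMin.deriv_eq_zero (.of_forall fun y => by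
    rw [Real.smoothTransition.zero_of_nonpos hx]; exact Real.smoothTransition.nonneg y)

lemma deriv_smoothTransition_of_one_le {x : ℝ} (hx : 1 ≤ x) : deriv Real.smoothTransition x = 0 :=
  IsLocalMax.deriv_eq_zero (.of_forall fun y => by
    rw [Real.smoothTransition.one_of_one_le hx]; exact Real.smoothTransition.le_one y)

lemma continuous_deriv_smoothTransition : Continuous (deriv Real.smoothTransition) :=
  (Real.smoothTransition.contDiff (n := 1)).continuous_deriv le_rfl

lemma hasDerivAt_smoothTransition (x : ℝ) :
    HasDerivAt Real.smoothTransition (deriv Real.smoothTransition x) x :=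
  ((Real.smoothTransition.contDiff (n := 1)).differentiable one_ne_zero x).hasDerivAt

/-- Cut-off functions of `τ = ‖X‖ ^ 2` increasing to the indicator of `τ < 1`. -/
def cutoff (m : ℕ) (τ : ℝ) : ℝ := Real.smoothTransition ((m + 4) * (1 - τ))

lemma cutoff_nonneg (m : ℕ) (τ : ℝ) : 0 ≤ cutoff m τ := Real.smoothTransition.nonneg _

lemma cutoff_le_one (m : ℕ) (τ : ℝ) : cutoff m τ ≤ 1 := Real.smoothTransition.le_one _

lemma cutoff_of_one_le (m : ℕ) {τ : ℝ} (h : 1 ≤ τ) : cutoff m τ = 0 :=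
  Real.smoothTransition.zero_of_nonpos
    (mul_nonpos_of_nonneg_of_nonpos (by positivity) (by linarith))

lemma continuous_cutoff (m : ℕ) : Continuous (cutoff m) :=
  Real.smoothTransition.continuous.comp (by fun_prop)

lemma tendsto_cutoff {τ : ℝ} (h : τ < 1) : Tendsto (fun m => cutoff m τ) atTop (𝓝 1) := by
  have h1 : Tendsto (fun m : ℕ => ((m : ℝ) + 4) * (1 - τ)) atTop atTop :=
    (tendsto_atTop_add_const_right _ _ tendsto_natCast_atTop_atTop).atTop_mul_const
      (sub_pos.2 h)
  refine tendsto_const_nhds.congr' ?_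
  filter_upwards [h1.eventually_ge_atTop 1] with m hm using
    (Real.smoothTransition.one_of_one_le hm).symm

/-- The derivative of `cutoff`, with the opposite sign. -/
def cutoffDeriv (m : ℕ) (τ : ℝ) : ℝ := (m + 4) * deriv Real.smoothTransition ((m + 4) * (1 - τ))

lemma hasDerivAt_cutoff (m : ℕ) (τ : ℝ) : HasDerivAt (cutoff m) (-cutoffDeriv m τ) τ := by
  have h1 : HasDerivAt (fun τ : ℝ => ((m : ℝ) + 4) * (1 - τ)) (-((m : ℝ) + 4)) τ := by
    simpa using ((hasDerivAt_id τ).const_sub 1).const_mul ((m : ℝ) + 4)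
  convert! (hasDerivAt_smoothTransition _).comp τ h1 using 1
  rw [cutoffDeriv]; ring

lemma continuous_cutoffDeriv (m : ℕ) : Continuous (cutoffDeriv m) :=
  continuous_const.mul (continuous_deriv_smoothTransition.comp (by fun_prop))

lemma cutoffDeriv_nonneg (m : ℕ) (τ : ℝ) : 0 ≤ cutoffDeriv m τ :=
  mul_nonneg (by positivity) (deriv_smoothTransition_nonneg _)

lemma cutoffDeriv_of_one_le (m : ℕ) {τ : ℝ} (h : 1 ≤ τ) : cutoffDeriv m τ = 0 := by
  rw [cutoffDeriv, deriv_smoothTransition_of_nonpos, mul_zero]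
  exact mul_nonpos_of_nonneg_of_nonpos (by positivity) (by linarith)

lemma cutoffDeriv_of_le (m : ℕ) {τ : ℝ} (h : 1 ≤ ((m : ℝ) + 4) * (1 - τ)) :
    cutoffDeriv m τ = 0 := by
  rw [cutoffDeriv, deriv_smoothTransition_of_one_le h, mul_zero]

/-- The kernel 2r `cutoffDeriv m (r ^ 2)` is minus the r-derivative of `cutoff m (r ^ 2)`. It is
nonnegative, has mass one on [3/4, 1] and concentrates at r = 1. The summand 4 in m + 4 makes the
cut-off equal to 1 at r = 3/4 already for m = 0. -/
lemma tendsto_integral_cutoffDeriv {h : ℝ → ℝ} (hc : ContinuousOn h (Icc (3 / 4) 1)) :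
    Tendsto (fun m => ∫ r in Icc (3 / 4 : ℝ) 1, 2 * r * cutoffDeriv m (r ^ 2) * h r) atTop
      (𝓝 (h 1)) := by
  have hcont : ∀ m, Continuous fun r : ℝ => 2 * r * cutoffDeriv m (r ^ 2) := fun m =>
    (by fun_prop : Continuous fun r : ℝ => 2 * r).mul
      ((continuous_cutoffDeriv m).comp (by fun_prop))
  refine tendsto_setIntegral_peak_smul_of_integrableOn_of_tendsto (x₀ := (1 : ℝ))
    (φ := fun m r => 2 * r * cutoffDeriv m (r ^ 2)) (g := h) measurableSet_Icc measurableSet_Icc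
    subset_rfl self_mem_nhdsWithin (by simp) ?_ ?_ ?_ ?_ (hc.integrableOn_Icc) ?_
  · refine .of_forall fun m r hr => mul_nonneg (by linarith [hr.1]) (cutoffDeriv_nonneg _ _)
  · intro u hu h1u
    obtain ⟨ε, hε, hεu⟩ := Metric.isOpen_iff.1 hu 1 h1u
    refine Metric.tendstoUniformlyOn_iff.2 fun δ hδ => ?_
    have h1 : Tendsto (fun m : ℕ => ((m : ℝ) + 4) * ε) atTop atTop :=
      (tendsto_atTop_add_const_right _ _ tendsto_natCast_atTop_atTop).atTop_mul_const hε
    filter_upwards [h1.eventually_ge_atTop 1] with m hm r hr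
    have hr1 : r ≤ 1 - ε := by
      by_contra hcon
      refine hr.2 (hεu ?_)
      rw [Metric.mem_ball, Real.dist_eq, abs_lt]
      constructor <;> linarith [hr.1.2]
    have : cutoffDeriv m (r ^ 2) = 0 := cutoffDeriv_of_le m <| hm.trans <|
      mul_le_mul_of_nonneg_left (by nlinarith [hr.1.1]) (by positivity)
    simp [this, hδ]
  · refine tendsto_const_nhds.congr fun m => ?_
    have hder : ∀ r : ℝ, HasDerivAt (fun r => -cutoff m (r ^ 2)) (2 * r * cutoffDeriv m (r ^ 2)) r :=
      fun r => by
        have h2 : HasDerivAt (fun r : ℝ => r ^ 2) (2 * r) r := by simpa using hasDerivAt_pow 2 r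
        convert! ((hasDerivAt_cutoff m (r ^ 2)).comp r h2).neg using 1
        ring
    rw [integral_Icc_eq_integral_Ioc, ← intervalIntegral.integral_of_le (by norm_num),
      intervalIntegral.integral_eq_sub_of_hasDerivAt (fun r _ => hder r)
        ((hcont m).intervalIntegrable _ _)]
    have h3 : cutoff m ((3 / 4) ^ 2) = 1 := Real.smoothTransition.one_of_one_le (by
      nlinarith [Nat.cast_nonneg (α := ℝ) m])
    rw [h3, cutoff_of_one_le m (by norm_num)]
    norm_num
  · exact .of_forall fun m => (hcont m).aestronglyMeasurable
  · exact hc 1 ⟨by norm_num, le_rfl⟩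

lemma hasFDerivAt_cutoff_norm_sq (m : ℕ) (X : Space n) :
    HasFDerivAt (fun X : Space n => cutoff m (‖X‖ ^ 2))
      ((-cutoffDeriv m (‖X‖ ^ 2)) • (2 • innerSL ℝ X)) X :=
  (hasDerivAt_cutoff m _).comp_hasFDerivAt X (hasStrictFDerivAt_norm_sq X).hasFDerivAt

lemma pd_cutoff_norm_sq (m : ℕ) (X : Space n) (j : Fin (n + 1)) :
    pd j (fun X : Space n => cutoff m (‖X‖ ^ 2)) X = -(2 * cutoffDeriv m (‖X‖ ^ 2) * X j) := by
  rw [pd, (hasFDerivAt_cutoff_norm_sq m X).fderiv]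
  simp [EuclideanSpace.inner_single_right]
  ring

lemma integrableOn_upper_of_eq_zero {f : Space n → ℝ} (hb : -1 < b)
    (hc : ContinuousOn f (upper n)) (hf : LocBdd (rho b) f)
    (h0 : ∀ X ∈ upper n, 1 < ‖X‖ → f X = 0) : IntegrableOn f (upper n) :=
  (integrableOn_of_locBdd hb hc hf 1).of_forall_sdiff_eq_zero measurableSet_upper
    fun X hX => h0 X hX.1 (by
      by_contra hcon
      exact hX.2 ⟨hX.1, by simpa using hcon⟩)

lemma locBdd_of_continuous {f : Space n → ℝ} (hf : Continuous f) : LocBdd (fun _ => 1) f := by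
  intro R
  obtain ⟨M, hM⟩ := (isCompact_closedBall (0 : Space n) R).exists_bound_of_continuousOn
    hf.continuousOn
  exact ⟨|M|, abs_nonneg M, fun X _ hX => by
    simpa using (hM X (by simpa using hX)).trans (le_abs_self M)⟩

lemma integrableOn_cutoffDeriv_mul {Φ : Space n → ℝ} (hb : -1 < b)
    (hΦc : ContinuousOn Φ (upper n)) (hΦb : LocBdd (rho b) Φ) (m : ℕ) :
    IntegrableOn (fun X => 2 * cutoffDeriv m (‖X‖ ^ 2) * Φ X) (upper n) := by
  have hc : Continuous fun X : Space n => 2 * cutoffDeriv m (‖X‖ ^ 2) :=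
    continuous_const.mul ((continuous_cutoffDeriv m).comp (by fun_prop))
  refine integrableOn_upper_of_eq_zero hb (hc.continuousOn.mul hΦc)
    ((locBdd_of_continuous hc).one_mul' hΦb) fun X _ h => ?_
  rw [cutoffDeriv_of_one_le m (by nlinarith), mul_zero, zero_mul]

lemma tendsto_integral_cutoffDeriv_norm_sq {Φ : Space n → ℝ} (hb : -1 < b)
    (hΦc : ContinuousOn Φ (upper n)) (hΦb : LocBdd (rho b) Φ) :
    Tendsto (fun m => ∫ X in upper n, 2 * cutoffDeriv m (‖X‖ ^ 2) * Φ X) atTop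
      (𝓝 (∫ ω in hemi n, Φ (ω : Space n) ∂(surf n))) := by
  set J : ℝ → ℝ := fun r => ∫ ω in hemi n, Φ (r • (ω : Space n)) ∂(surf n) with hJ
  have hJc : ContinuousOn J (Icc (3 / 4) 1) := fun r hr =>
    (continuousAt_hemi_integral hb hΦc hΦb
      ⟨by linarith [hr.1], by linarith [hr.2]⟩).continuousWithinAt
  -- The kernel integrated over the half-space has no factor r, hence the r⁻¹; it is harmless, being
  -- 1 at r = 1. The power r^n is the polar Jacobian.
  have h1 := tendsto_integral_cutoffDeriv (h := fun r => r ^ n * r⁻¹ * J r)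
    (((continuous_pow n).continuousOn.mul (continuousOn_inv₀.mono fun r hr => by
      have : 3 / 4 ≤ r := hr.1
      simp only [mem_compl_iff, mem_singleton_iff]; linarith)).mul hJc)
  have hJ1 : (1 : ℝ) ^ n * 1⁻¹ * J 1 = ∫ ω in hemi n, Φ (ω : Space n) ∂(surf n) := by
    simp [hJ]
  rw [hJ1] at h1
  refine h1.congr fun m => ?_
  rw [setIntegral_upper_polar (integrableOn_cutoffDeriv_mul hb hΦc hΦb m)]
  have hpt : ∀ r ∈ Ioi (0 : ℝ), r ^ n * ∫ ω in hemi n, (2 * cutoffDeriv m (‖r • (ω : Space n)‖ ^ 2) *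
      Φ (r • (ω : Space n))) ∂(surf n) = 2 * r * cutoffDeriv m (r ^ 2) * (r ^ n * r⁻¹ * J r) := by
    intro r hr
    have hr' : 0 < r := hr
    simp only [norm_smul_sphere hr'.le]
    rw [integral_const_mul]
    field_simp
    rfl
  rw [setIntegral_congr_fun measurableSet_Ioi hpt]
  refine (setIntegral_eq_of_subset_of_forall_sdiff_eq_zero measurableSet_Ioi
    (fun r hr => lt_of_lt_of_le (by norm_num) hr.1) fun r hr => ?_).symm
  have hr0 : 0 < r := hr.1
  have : cutoffDeriv m (r ^ 2) = 0 := by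
    by_cases h : 1 ≤ r
    · exact cutoffDeriv_of_one_le m (by nlinarith)
    · refine cutoffDeriv_of_le m ?_
      have h3 : r < 3 / 4 := by
        by_contra hcon
        exact hr.2 ⟨not_lt.1 hcon, (not_le.1 h).le⟩
      have h4 : r ^ 2 ≤ 9 / 16 := by nlinarith
      nlinarith [Nat.cast_nonneg (α := ℝ) m]
  rw [this]; ring

/-- The divergence theorem on the upper half-ball. -/
theorem integral_divergence_halfBall (hb : -1 < b) {F : Fin (n + 1) → Space n → ℝ}
    {D Φ : Space n → ℝ} (hF : ∀ j, DifferentiableOn ℝ (F j) (upper n))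
    (hD : EqOn (fun X => ∑ j, pd j (F j) X) D (upper n)) (hDc : ContinuousOn D (upper n))
    (hDb : LocBdd (rho b) D) (hΦ : EqOn (fun X => ∑ j, X j * F j X) Φ (upper n))
    (hΦc : ContinuousOn Φ (upper n)) (hΦb : LocBdd (rho b) Φ)
    (hl : LocBdd (fun _ => 1) (F (Fin.last n))) {g : EuclideanSpace ℝ (Fin n) → ℝ}
    (hgc : Continuous g)
    (hg : ∀ x, Tendsto (fun y => F (Fin.last n) (lift x y)) (𝓝[>] 0) (𝓝 (g x))) :
    ∫ X in upper n ∩ Metric.ball 0 1, D X =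
      (∫ ω in hemi n, Φ (ω : Space n) ∂(surf n)) - ∫ x in Metric.ball 0 1, g x := by
  set ζ : ℕ → Space n → ℝ := fun m X => cutoff m (‖X‖ ^ 2) with hζ
  have hζc : ∀ m, Continuous (ζ m) := fun m => (continuous_cutoff m).comp (by fun_prop)
  have hζ0 : ∀ m X, 1 ≤ ‖X‖ → ζ m X = 0 := fun m X hX =>
    cutoff_of_one_le m (by nlinarith)
  have hζd : ∀ m X, DifferentiableAt ℝ (ζ m) X := fun m X =>
    (hasFDerivAt_cutoff_norm_sq m X).differentiableAt
  set ψ : ℕ → Space n → ℝ := fun m X => 2 * cutoffDeriv m (‖X‖ ^ 2) with hψ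
  have hψc : ∀ m, Continuous (ψ m) := fun m =>
    continuous_const.mul ((continuous_cutoffDeriv m).comp (by fun_prop))
  have hψ0 : ∀ m X, 1 ≤ ‖X‖ → ψ m X = 0 := fun m X hX => by
    rw [hψ]; simp only; rw [cutoffDeriv_of_one_le m (by nlinarith), mul_zero]
  -- The gradient of the cut-off is -ψX, so the product rule yields the radial component Φ against
  -- ψ, whose limit is the surface integral.
  have hdiv : ∀ m, ∀ X ∈ upper n, ∑ j, pd j (fun X => ζ m X * F j X) X =
      ζ m X * D X - ψ m X * Φ X := by
    intro m X hX
    rw [← hD hX, ← hΦ hX]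
    simp only
    rw [Finset.mul_sum, Finset.mul_sum, ← Finset.sum_sub_distrib]
    refine Finset.sum_congr rfl fun j _ => ?_
    rw [pd_mul (hζd m X) ((hF j).differentiableAt (upper_mem_nhds hX)), pd_cutoff_norm_sq]
    ring
  have hi1 : ∀ m, IntegrableOn (fun X => ζ m X * D X) (upper n) := fun m =>
    integrableOn_upper_of_eq_zero hb ((hζc m).continuousOn.mul hDc)
      ((locBdd_of_continuous (hζc m)).one_mul' hDb) fun X _ h => by rw [hζ0 m X h.le, zero_mul]
  have hi2 : ∀ m, IntegrableOn (fun X => ψ m X * Φ X) (upper n) := fun m =>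
    integrableOn_upper_of_eq_zero hb ((hψc m).continuousOn.mul hΦc)
      ((locBdd_of_continuous (hψc m)).one_mul' hΦb) fun X _ h => by rw [hψ0 m X h.le, zero_mul]
  have key : ∀ m, (∫ X in upper n, ζ m X * D X) - ∫ X in upper n, ψ m X * Φ X =
      - ∫ x, cutoff m (‖x‖ ^ 2) * g x := by
    intro m
    rw [← integral_sub (hi1 m) (hi2 m)]
    obtain ⟨M, hM0, hM⟩ := hl 1
    rw [← integral_divergence_upper (G := fun j X => ζ m X * F j X) (R := 2) (M := M) (by norm_num)
      (fun j X hX => ((hζd m X).differentiableWithinAt).mul (hF j X hX))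
      (fun j X _ hX => by rw [hζ0 m X (by linarith), zero_mul]) ?_ ?_ ?_]
    · exact setIntegral_congr_fun measurableSet_upper fun X hX => (hdiv m X hX).symm
    · exact ((hi1 m).sub (hi2 m)).congr_fun (fun X hX => (hdiv m X hX).symm) measurableSet_upper
    · intro X hX
      by_cases h : 1 ≤ ‖X‖
      · rw [hζ0 m X h, zero_mul, abs_zero]; exact hM0
      · rw [abs_mul, abs_of_nonneg (cutoff_nonneg _ _)]
        have := hM X hX (not_le.1 h).le
        rw [mul_one] at this
        exact (mul_le_of_le_one_left (abs_nonneg _) (cutoff_le_one _ _)).trans this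
    · intro x
      refine Tendsto.mul ?_ (hg x)
      have h1 : Tendsto (fun y : ℝ => ‖lift x y‖ ^ 2) (𝓝[>] 0) (𝓝 (‖x‖ ^ 2)) := by
        simp only [norm_sq_lift]
        have : Tendsto (fun y : ℝ => ‖x‖ ^ 2 + y ^ 2) (𝓝 0) (𝓝 (‖x‖ ^ 2 + 0 ^ 2)) :=
          (by fun_prop : Continuous fun y : ℝ => ‖x‖ ^ 2 + y ^ 2).tendsto 0
        simpa using this.mono_left nhdsWithin_le_nhds
      exact ((continuous_cutoff m).tendsto _).comp h1
  have lim1 : Tendsto (fun m => ∫ X in upper n, ζ m X * D X) atTop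
      (𝓝 (∫ X in upper n ∩ Metric.ball 0 1, D X)) := by
    rw [← setIntegral_indicator Metric.isOpen_ball.measurableSet]
    refine tendsto_integral_of_dominated_convergence
      ((Metric.closedBall (0 : Space n) 1).indicator fun X => ‖D X‖)
      (fun m => (hi1 m).aestronglyMeasurable) ?_ ?_ ?_
    · rw [integrable_indicator_iff measurableSet_closedBall, IntegrableOn,
        Measure.restrict_restrict measurableSet_closedBall, inter_comm]
      exact (integrableOn_of_locBdd hb hDc hDb 1).norm
    · refine fun m => .of_forall fun X => ?_
      by_cases h : X ∈ Metric.closedBall (0 : Space n) 1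
      · rw [indicator_of_mem h, norm_mul, Real.norm_eq_abs, abs_of_nonneg (cutoff_nonneg _ _)]
        exact mul_le_of_le_one_left (norm_nonneg _) (cutoff_le_one _ _)
      · rw [indicator_of_notMem h, hζ0 m X (by simpa using (not_le.1 (by simpa using h)).le)]
        simp
    · refine .of_forall fun X => ?_
      by_cases h : X ∈ Metric.ball (0 : Space n) 1
      · rw [indicator_of_mem h]
        have h' : ‖X‖ < 1 := by simpa using h
        have := (tendsto_cutoff (τ := ‖X‖ ^ 2) (by nlinarith [norm_nonneg X])).mul_const (D X)
        simpa using this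
      · rw [indicator_of_notMem h]
        have h' : 1 ≤ ‖X‖ := by simpa using h
        simp [hζ0 _ X h']
  have lim3 : Tendsto (fun m => ∫ x : EuclideanSpace ℝ (Fin n), cutoff m (‖x‖ ^ 2) * g x) atTop
      (𝓝 (∫ x in Metric.ball 0 1, g x)) := by
    rw [← integral_indicator Metric.isOpen_ball.measurableSet]
    have hz : ∀ m (x : EuclideanSpace ℝ (Fin n)), 1 ≤ ‖x‖ → cutoff m (‖x‖ ^ 2) = 0 := fun m x hx =>
      cutoff_of_one_le m (by nlinarith)
    refine tendsto_integral_of_dominated_convergence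
      ((Metric.closedBall (0 : EuclideanSpace ℝ (Fin n)) 1).indicator fun X => ‖g X‖)
      (fun m => (((continuous_cutoff m).comp (by fun_prop)).mul hgc).aestronglyMeasurable) ?_ ?_ ?_
    · rw [integrable_indicator_iff measurableSet_closedBall]
      exact hgc.norm.continuousOn.integrableOn_compact (isCompact_closedBall _ _)
    · refine fun m => .of_forall fun X => ?_
      by_cases h : X ∈ Metric.closedBall (0 : EuclideanSpace ℝ (Fin n)) 1
      · rw [indicator_of_mem h, norm_mul, Real.norm_eq_abs, abs_of_nonneg (cutoff_nonneg _ _)]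
        exact mul_le_of_le_one_left (norm_nonneg _) (cutoff_le_one _ _)
      · rw [indicator_of_notMem h, hz m X (by simpa using (not_le.1 (by simpa using h)).le)]
        simp
    · refine .of_forall fun X => ?_
      by_cases h : X ∈ Metric.ball (0 : EuclideanSpace ℝ (Fin n)) 1
      · rw [indicator_of_mem h]
        have h' : ‖X‖ < 1 := by simpa using h
        have := (tendsto_cutoff (τ := ‖X‖ ^ 2) (by nlinarith [norm_nonneg X])).mul_const (g X)
        simpa using this
      · rw [indicator_of_notMem h]
        have h' : 1 ≤ ‖X‖ := by simpa using h
        simp [hz _ X h']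
  have lim2 := tendsto_integral_cutoffDeriv_norm_sq hb hΦc hΦb
  have h := (lim1.sub lim2).congr key
  have := tendsto_nhds_unique h lim3.neg
  linarith

end LaneEmden

end

noncomputable section

namespace LaneEmden

variable {n : ℕ} {σ b : ℝ}

/-! ### Differential operators on smooth functions of the half-space -/

/-- `f` is of class `C^m` on the half-space. -/
def Sm (m : ℕ) (f : Space n → ℝ) : Prop := ContDiffOn ℝ m f (upper n)

variable {m : ℕ} {f g : Space n → ℝ}

lemma Sm.diff (hf : Sm (m + 1) f) {X : Space n} (hX : X ∈ upper n) : DifferentiableAt ℝ f X :=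
  (ContDiffOn.differentiableOn hf (by norm_cast)).differentiableAt (upper_mem_nhds hX)

lemma Sm.of_le (hf : Sm m f) {k : ℕ} (h : k ≤ m) : Sm k f :=
  ContDiffOn.of_le hf (by exact_mod_cast h)

lemma Sm.two (hf : Sm (m + 2) f) : ContDiffOn ℝ 2 f (upper n) :=
  ContDiffOn.of_le hf (by norm_cast; omega)

lemma Sm.congr (hf : Sm m f) (h : EqOn f g (upper n)) : Sm m g :=
  ContDiffOn.congr hf fun _ hX => (h hX).symm

lemma Sm.add (hf : Sm m f) (hg : Sm m g) : Sm m fun X => f X + g X := ContDiffOn.add hf hg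

lemma Sm.sub (hf : Sm m f) (hg : Sm m g) : Sm m fun X => f X - g X := ContDiffOn.sub hf hg

lemma Sm.mul (hf : Sm m f) (hg : Sm m g) : Sm m fun X => f X * g X := ContDiffOn.mul hf hg

lemma Sm.const_mul (hf : Sm m f) (c : ℝ) : Sm m fun X => c * f X := contDiffOn_const.mul hf

lemma Sm.sum {ι : Type*} (s : Finset ι) {f : ι → Space n → ℝ} (hf : ∀ i ∈ s, Sm m (f i)) :
    Sm m fun X => ∑ i ∈ s, f i X := ContDiffOn.sum hf

lemma Sm.pderiv (hf : Sm (m + 1) f) (j : Fin (n + 1)) : Sm m (pd j f) := contDiffOn_pd hf j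

lemma sm_coord (i : Fin (n + 1)) : Sm m fun X : Space n => X i := (coordL i).contDiff.contDiffOn

lemma sm_norm_sq : Sm m fun X : Space n => ‖X‖ ^ 2 := (contDiff_norm_sq ℝ).contDiffOn

lemma sm_ht_rpow (b : ℝ) : Sm m fun X : Space n => ht X ^ b :=
  (coordL (Fin.last n)).contDiff.contDiffOn.rpow_const_of_ne fun _ hX => ne_of_gt hX

lemma sm_inv_ht : Sm m fun X : Space n => (ht X)⁻¹ :=
  (coordL (Fin.last n)).contDiff.contDiffOn.inv fun _ hX => ne_of_gt hX

lemma Sm.euler (hf : Sm (m + 1) f) : Sm m (LaneEmden.euler f) :=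
  (Sm.sum Finset.univ fun j _ => (sm_coord j).mul (hf.pderiv j)).congr
    fun X _ => (euler_eq_sum f X).symm

lemma Sm.lapB (hf : Sm (m + 2) f) (b : ℝ) : Sm m (LaneEmden.lapB b f) :=
  ((Sm.sum Finset.univ fun j _ => (hf.pderiv j).pderiv j).add
    ((sm_inv_ht.mul ((hf.of_le (by omega)).pderiv (Fin.last n))).const_mul b)).congr
    fun X hX => by rw [lapB_eq_sum_pd hf.two b hX]; simp only [div_eq_mul_inv, mul_assoc]

lemma euler_add {X : Space n} (hf : DifferentiableAt ℝ f X) (hg : DifferentiableAt ℝ g X) :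
    euler (fun Y => f Y + g Y) X = euler f X + euler g X := by
  simp only [euler, fderiv_fun_add hf hg, add_apply]

lemma euler_const_mul {X : Space n} (c : ℝ) (hf : DifferentiableAt ℝ f X) :
    euler (fun Y => c * f Y) X = c * euler f X := by
  simp only [euler, fderiv_const_mul hf, smul_apply, smul_eq_mul]

lemma euler_mul {X : Space n} (hf : DifferentiableAt ℝ f X) (hg : DifferentiableAt ℝ g X) :
    euler (fun Y => f Y * g Y) X = euler f X * g X + f X * euler g X := by
  simp only [euler, fderiv_fun_mul hf hg, add_apply, smul_apply, smul_eq_mul]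
  ring

lemma euler_sum {ι : Type*} (s : Finset ι) {f : ι → Space n → ℝ} {X : Space n}
    (hf : ∀ i ∈ s, DifferentiableAt ℝ (f i) X) :
    euler (fun Y => ∑ i ∈ s, f i Y) X = ∑ i ∈ s, euler (f i) X := by
  simp only [euler, fderiv_fun_sum hf, sum_apply]

lemma euler_norm_sq (X : Space n) : euler (fun Y : Space n => ‖Y‖ ^ 2) X = 2 * ‖X‖ ^ 2 := by
  rw [euler, (hasStrictFDerivAt_norm_sq X).hasFDerivAt.fderiv]
  simp

lemma euler_inv_ht {X : Space n} (hX : X ∈ upper n) :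
    euler (fun Y : Space n => (ht Y)⁻¹) X = -(ht X)⁻¹ := by
  have hy : ht X ≠ 0 := ne_of_gt hX
  have h : HasFDerivAt (fun Y : Space n => (ht Y)⁻¹) _ X :=
    (hasDerivAt_inv hy).comp_hasFDerivAt X (hasFDerivAt_coord (Fin.last n) X)
  rw [euler, h.fderiv]
  simp only [smul_apply, coordL_apply, smul_eq_mul]
  change -(ht X ^ 2)⁻¹ * ht X = _
  field_simp

lemma pd_norm_sq (j : Fin (n + 1)) (X : Space n) :
    pd j (fun Y : Space n => ‖Y‖ ^ 2) X = 2 * X j := by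
  rw [pd, (hasStrictFDerivAt_norm_sq X).hasFDerivAt.fderiv]
  simp [EuclideanSpace.inner_single_right]

lemma pd_ht_rpow (b : ℝ) (j : Fin (n + 1)) {X : Space n} (hX : X ∈ upper n) :
    pd j (fun Y : Space n => ht Y ^ b) X =
      if Fin.last n = j then ht X ^ b * (b / ht X) else 0 := by
  have hy : ht X ≠ 0 := ne_of_gt hX
  have h : HasFDerivAt (fun Y : Space n => ht Y ^ b) _ X :=
    (Real.hasDerivAt_rpow_const (p := b) (Or.inl hy)).comp_hasFDerivAt X
      (hasFDerivAt_coord (Fin.last n) X)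
  have h2 := pd_coord (Fin.last n) j X
  rw [pd, (hasFDerivAt_coord (Fin.last n) X).fderiv] at h2
  rw [pd, h.fderiv, smul_apply, h2]
  split_ifs
  · have hy' : 0 < ht X := hX
    change b * ht X ^ (b - 1) * 1 = _
    rw [Real.rpow_sub_one hy]
    ring
  · simp

lemma pd_euler (hf : Sm (m + 2) f) (j : Fin (n + 1)) {X : Space n} (hX : X ∈ upper n) :
    pd j (euler f) X = pd j f X + euler (pd j f) X := by
  have h1 : euler f = fun Y => ∑ i, Y i * pd i f Y := funext fun Y => euler_eq_sum f Y
  rw [h1, pd_sum _ (fun i _ => (differentiableAt_coord i X).fun_mul ((hf.pderiv i).diff hX)),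
    euler_eq_sum]
  have h2 : ∀ i, pd j (fun Y => Y i * pd i f Y) X =
      X i * pd i (pd j f) X + (if i = j then pd j f X else 0) := fun i => by
    rw [pd_mul (differentiableAt_coord i X) ((hf.pderiv i).diff hX), pd_coord,
      pd_comm hf.two j i hX]
    split_ifs with h
    · rw [h, one_mul]
    · rw [zero_mul]
  simp only [h2, Finset.sum_add_distrib, Finset.sum_ite_eq', Finset.mem_univ, if_true]
  ring

/-- Δ_b is homogeneous of degree -2, so its commutator with the Euler operator is 2Δ_b; for the term
y⁻¹ ∂_y this uses E(y⁻¹) = -y⁻¹. -/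
lemma lapB_euler (b : ℝ) (hf : Sm (m + 3) f) {X : Space n} (hX : X ∈ upper n) :
    lapB b (euler f) X = euler (lapB b f) X + 2 * lapB b f X := by
  have h2 : EqOn (fun X => ∑ j, pd j (pd j f) X + b * ((ht X)⁻¹ * pd (Fin.last n) f X))
      (lapB b f) (upper n) := fun X hX => by
    rw [lapB_eq_sum_pd (hf.of_le (by omega : 2 ≤ m + 3)).two b hX]
    simp only [div_eq_mul_inv, mul_assoc]
  have hd : ∀ j, DifferentiableAt ℝ (pd j (pd j f)) X := fun j =>
    ((hf.pderiv j).pderiv j).diff hX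
  have hl : DifferentiableAt ℝ (pd (Fin.last n) f) X := (hf.pderiv _).diff hX
  have hi : DifferentiableAt ℝ (fun Y : Space n => (ht Y)⁻¹) X := (sm_inv_ht (m := 1)).diff hX
  rw [← euler_eqOn h2 hX, ← h2 hX, euler_add (DifferentiableAt.fun_sum fun j _ => hd j)
    ((hi.fun_mul hl).const_mul b), euler_sum _ fun j _ => hd j, euler_const_mul b (hi.fun_mul hl),
    euler_mul hi hl, euler_inv_ht hX]
  rw [lapB_eq_sum_pd (Sm.euler (m := m + 2) hf).two b hX]
  have h3 : ∀ j, pd j (pd j (euler f)) X = 2 * pd j (pd j f) X + euler (pd j (pd j f)) X :=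
    fun j => by
      have h4 : EqOn (pd j (euler f)) (fun X => pd j f X + euler (pd j f) X) (upper n) :=
        fun Y hY => pd_euler (m := m + 1) hf j hY
      rw [pd_eqOn h4 j hX, pd_add ((hf.pderiv j).diff hX) (((hf.pderiv j).euler).diff hX),
        pd_euler (m := m) (hf.pderiv j) j hX]
      ring
  simp only [h3, Finset.sum_add_distrib, ← Finset.mul_sum, pd_euler (m := m + 1) hf _ hX]
  ring

lemma euler_norm_sq_mul {X : Space n} (hf : DifferentiableAt ℝ f X) :
    euler (fun Y => ‖Y‖ ^ 2 * f Y) X = ‖X‖ ^ 2 * (euler f X + 2 * f X) := by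
  rw [euler_mul (hasStrictFDerivAt_norm_sq X).hasFDerivAt.differentiableAt hf, euler_norm_sq]
  ring

/-- The weighted spherical Laplacian as an operator on the half-space, commuting with the Euler
operator. -/
def SL (b : ℝ) (f : Space n → ℝ) (X : Space n) : ℝ :=
  ‖X‖ ^ 2 * lapB b f X - euler (euler f) X - (n + b - 1) * euler f X

/-- The spherical carré du champ as an operator on the half-space. -/
def Gam (f g : Space n → ℝ) (X : Space n) : ℝ :=
  ‖X‖ ^ 2 * (∑ j, pd j f X * pd j g X) - euler f X * euler g X

lemma Sm.SL (hf : Sm (m + 2) f) (b : ℝ) : Sm m (LaneEmden.SL b f) :=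
  ((sm_norm_sq.mul (hf.lapB b)).sub (Sm.euler (m := m) (Sm.euler hf))).sub
    ((Sm.euler (m := m) (hf.of_le (by omega))).const_mul _)

lemma Sm.Gam (hf : Sm (m + 1) f) (hg : Sm (m + 1) g) : Sm m (LaneEmden.Gam f g) :=
  (sm_norm_sq.mul (Sm.sum _ fun j _ => (hf.pderiv j).mul (hg.pderiv j))).sub
    (hf.euler.mul hg.euler)

lemma Gam_comm (f g : Space n → ℝ) : Gam f g = Gam g f := by
  funext X; simp only [Gam, mul_comm]

lemma SL_eqOn (b : ℝ) (h : EqOn f g (upper n)) : EqOn (SL b f) (SL b g) (upper n) := fun X hX => by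
  rw [SL, SL, lapB_eqOn h b hX, euler_eqOn (euler_eqOn h) hX, euler_eqOn h hX]

lemma Gam_eqOn {f' g' : Space n → ℝ} (h : EqOn f f' (upper n)) (h' : EqOn g g' (upper n)) :
    EqOn (Gam f g) (Gam f' g') (upper n) := fun X hX => by
  simp only [Gam, euler_eqOn h hX, euler_eqOn h' hX, pd_eqOn h _ hX, pd_eqOn h' _ hX]

lemma lapB_add (b : ℝ) (hf : Sm (m + 2) f) (hg : Sm (m + 2) g) {X : Space n} (hX : X ∈ upper n) :
    lapB b (fun Y => f Y + g Y) X = lapB b f X + lapB b g X := by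
  have hj : ∀ j, EqOn (pd j fun Y => f Y + g Y) (fun Y => pd j f Y + pd j g Y) (upper n) :=
    fun j Y hY => pd_add (hf.diff hY) (hg.diff hY) j
  rw [lapB_eq_sum_pd hf.two b hX, lapB_eq_sum_pd hg.two b hX,
    lapB_eq_sum_pd (Sm.add hf hg).two b hX, hj _ hX]
  simp only [fun j => pd_eqOn (hj j) j hX,
    fun j => pd_add ((hf.pderiv j).diff hX) ((hg.pderiv j).diff hX) j, Finset.sum_add_distrib]
  ring

lemma lapB_const_mul (b c : ℝ) (hf : Sm (m + 2) f) {X : Space n} (hX : X ∈ upper n) :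
    lapB b (fun Y => c * f Y) X = c * lapB b f X := by
  have hj : ∀ j, EqOn (pd j fun Y => c * f Y) (fun Y => c * pd j f Y) (upper n) :=
    fun j Y hY => pd_const_mul c (hf.diff hY) j
  rw [lapB_eq_sum_pd hf.two b hX, lapB_eq_sum_pd (Sm.const_mul hf c).two b hX, hj _ hX]
  simp only [fun j => pd_eqOn (hj j) j hX,
    fun j => pd_const_mul c ((hf.pderiv j).diff hX) j, ← Finset.mul_sum]
  ring

lemma SL_add (b : ℝ) (hf : Sm (m + 2) f) (hg : Sm (m + 2) g) {X : Space n} (hX : X ∈ upper n) :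
    SL b (fun Y => f Y + g Y) X = SL b f X + SL b g X := by
  have h : EqOn (euler fun Y => f Y + g Y) (fun Y => euler f Y + euler g Y) (upper n) :=
    fun Y hY => euler_add (hf.diff hY) (hg.diff hY)
  rw [SL, SL, SL, lapB_add b hf hg hX, euler_eqOn h hX, h hX,
    euler_add (hf.euler.diff hX) (hg.euler.diff hX)]
  ring

lemma SL_const_mul (b c : ℝ) (hf : Sm (m + 2) f) {X : Space n} (hX : X ∈ upper n) :
    SL b (fun Y => c * f Y) X = c * SL b f X := by
  have h : EqOn (euler fun Y => c * f Y) (fun Y => c * euler f Y) (upper n) :=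
    fun Y hY => euler_const_mul c (hf.diff hY)
  rw [SL, SL, lapB_const_mul b c hf hX, euler_eqOn h hX, h hX,
    euler_const_mul c (hf.euler.diff hX)]
  ring

/-- Multiplying Δ_b by |X|² makes it homogeneous of degree 0, so the factor 2 of `lapB_euler` is
absorbed and the operator commutes with dilations. -/
lemma SL_euler (b : ℝ) (hf : Sm (m + 3) f) {X : Space n} (hX : X ∈ upper n) :
    SL b (euler f) X = euler (SL b f) X := by
  have h1 : DifferentiableAt ℝ (lapB b f) X := (Sm.lapB (m := m + 1) hf b).diff hX
  have h2 : DifferentiableAt ℝ (euler f) X := (Sm.euler (m := m + 2) hf).diff hX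
  have h3 : DifferentiableAt ℝ (euler (euler f)) X :=
    (Sm.euler (m := m + 1) (Sm.euler (m := m + 2) hf)).diff hX
  have h4 : DifferentiableAt ℝ (fun Y => ‖Y‖ ^ 2 * lapB b f Y) X :=
    (hasStrictFDerivAt_norm_sq X).hasFDerivAt.differentiableAt.mul h1
  have h5 : euler (SL b f) X = euler (fun Y => ‖Y‖ ^ 2 * lapB b f Y + ((-1) * euler (euler f) Y +
      (-(n + b - 1)) * euler f Y)) X := by
    congr 1; funext Y; simp only [SL]; ring
  rw [h5, euler_add h4 ((h3.const_mul _).fun_add (h2.const_mul _)),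
    euler_add (h3.const_mul _) (h2.const_mul _), euler_const_mul _ h3, euler_const_mul _ h2,
    euler_norm_sq_mul h1, SL, lapB_euler b hf hX]
  ring

/-- The form is bilinear and homogeneous of degree 0, so E acts on it as a derivation. -/
lemma euler_Gam (hf : Sm (m + 2) f) (hg : Sm (m + 2) g) {X : Space n} (hX : X ∈ upper n) :
    euler (Gam f g) X = Gam (euler f) g X + Gam f (euler g) X := by
  have hd : ∀ j, DifferentiableAt ℝ (fun Y => pd j f Y * pd j g Y) X := fun j =>
    ((hf.pderiv j).diff hX).mul ((hg.pderiv j).diff hX)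
  have hs : DifferentiableAt ℝ (fun Y => ∑ j, pd j f Y * pd j g Y) X :=
    DifferentiableAt.fun_sum fun j _ => hd j
  have hef := hf.euler.diff hX
  have heg := hg.euler.diff hX
  have h5 : euler (Gam f g) X = euler (fun Y => ‖Y‖ ^ 2 * (∑ j, pd j f Y * pd j g Y) +
      (-1) * (euler f Y * euler g Y)) X := by
    congr 1; funext Y; simp only [Gam]; ring
  rw [h5, euler_add ((hasStrictFDerivAt_norm_sq X).hasFDerivAt.differentiableAt.fun_mul hs)
    ((hef.fun_mul heg).const_mul _), euler_norm_sq_mul hs, euler_const_mul _ (hef.fun_mul heg),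
    euler_mul hef heg, euler_sum _ fun j _ => hd j, Gam, Gam]
  simp only [fun j => euler_mul ((hf.pderiv j).diff hX) ((hg.pderiv j).diff hX),
    pd_euler hf _ hX, pd_euler hg _ hX, add_mul, mul_add, Finset.sum_add_distrib]
  ring

end LaneEmden

end

noncomputable section

namespace LaneEmden

variable {n : ℕ} {b : ℝ} {m : ℕ} {f g : Space n → ℝ}

/-! ### Functions on the half-sphere -/

lemma differentiable_cutoffDeriv (m : ℕ) : Differentiable ℝ (cutoffDeriv m) := by
  have h : Differentiable ℝ (deriv Real.smoothTransition) :=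
    ((Real.smoothTransition.contDiff (n := 2)).iterate_deriv' 1 1).differentiable one_ne_zero
  exact (differentiable_const _).mul (h.comp (by fun_prop))

/-- The divergence theorem on the half-sphere: a tangential vector field without normal component
at the boundary. -/
theorem integral_divergence_hemi (hb : -1 < b) {F : Fin (n + 1) → Space n → ℝ}
    {D : Space n → ℝ} (hF : ∀ j, DifferentiableOn ℝ (F j) (upper n))
    (hD : EqOn (fun X => ∑ j, pd j (F j) X) D (upper n)) (hDc : ContinuousOn D (upper n))
    (hDb : LocBdd (rho b) D) (hT : ∀ X ∈ upper n, ∑ j, X j * F j X = 0)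
    (hl : LocBdd (fun _ => 1) (F (Fin.last n)))
    (hg : ∀ x, Tendsto (fun y => F (Fin.last n) (lift x y)) (𝓝[>] 0) (𝓝 0)) :
    ∫ ω in hemi n, D (ω : Space n) ∂(surf n) = 0 := by
  have hlim := tendsto_integral_cutoffDeriv_norm_sq hb hDc hDb
  refine tendsto_nhds_unique hlim (tendsto_const_nhds.congr fun m => ?_)
  -- The kernel is radial and F tangential, so ∇ψ·F = 0 and the divergence of ψF is ψD. Its integral
  -- vanishes for every m, while in the limit it becomes the integral of D over the half-sphere.
  set ψ : Space n → ℝ := fun X => 2 * cutoffDeriv m (‖X‖ ^ 2) with hψ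
  have hψc : Continuous ψ :=
    continuous_const.mul ((continuous_cutoffDeriv m).comp (by fun_prop))
  have hψ0 : ∀ X, 1 ≤ ‖X‖ → ψ X = 0 := fun X hX => by
    rw [hψ]; simp only; rw [cutoffDeriv_of_one_le m (by nlinarith), mul_zero]
  have hψd : ∀ X, HasFDerivAt ψ
      ((2 * deriv (cutoffDeriv m) (‖X‖ ^ 2)) • (2 • innerSL ℝ X)) X := fun X => by
    have := (((differentiable_cutoffDeriv m _).hasDerivAt).comp_hasFDerivAt X
      (hasStrictFDerivAt_norm_sq X).hasFDerivAt).const_mul 2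
    rwa [smul_smul] at this
  have hψp : ∀ j X, pd j ψ X = 4 * deriv (cutoffDeriv m) (‖X‖ ^ 2) * X j := fun j X => by
    rw [pd, (hψd X).fderiv]
    simp [EuclideanSpace.inner_single_right]
    ring
  have hdiv : ∀ X ∈ upper n, ∑ j, pd j (fun X => ψ X * F j X) X = ψ X * D X := by
    intro X hX
    have h1 : ∀ j, pd j (fun X => ψ X * F j X) X =
        ψ X * pd j (F j) X + 4 * deriv (cutoffDeriv m) (‖X‖ ^ 2) * (X j * F j X) := fun j => by
      rw [pd_mul (hψd X).differentiableAt ((hF j).differentiableAt (upper_mem_nhds hX)), hψp]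
      ring
    simp only [h1, Finset.sum_add_distrib, ← Finset.mul_sum]
    rw [hT X hX, mul_zero, add_zero, ← hD hX]
  have hi := integrableOn_cutoffDeriv_mul hb hDc hDb m
  obtain ⟨M, hM0, hM⟩ := (locBdd_of_continuous hψc).mul hl 1
  have h := integral_divergence_upper (G := fun j X => ψ X * F j X) (R := 2) (M := M) (by norm_num)
      (fun j X hX => ((hψd X).differentiableAt.differentiableWithinAt).mul (hF j X hX))
      (fun j X _ hX => by rw [hψ0 X (by linarith), zero_mul])
      (hi.congr_fun (fun X hX => (hdiv X hX).symm) measurableSet_upper)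
      (fun X hX => by
        by_cases h : 1 ≤ ‖X‖
        · rw [hψ0 X h, zero_mul, abs_zero]; exact hM0
        · simpa using hM X hX (not_le.1 h).le) (g := fun _ => 0)
      (fun x => by
        have h1 : Tendsto (fun y : ℝ => lift x y) (𝓝[>] 0) (𝓝 (lift x 0)) :=
          ((continuous_lift.comp (by fun_prop : Continuous fun y : ℝ => (x, y))).tendsto
            0).mono_left nhdsWithin_le_nhds
        simpa using ((hψc.tendsto _).comp h1).mul (hg x))
  rw [setIntegral_congr_fun measurableSet_upper hdiv] at h
  simpa using h.symm

/-- Functions which, with the weight `y ^ b`, have integral zero over the half-sphere. -/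
def Null (b : ℝ) (f : Space n → ℝ) : Prop :=
  IntegrableOn (fun ω : Metric.sphere (0 : Space n) 1 => ht (ω : Space n) ^ b * f ω) (hemi n)
    (surf n) ∧
  ∫ ω in hemi n, ht (ω : Space n) ^ b * f (ω : Space n) ∂(surf n) = 0

lemma Null.add (hf : Null b f) (hg : Null b g) : Null b fun X => f X + g X := by
  simp only [Null, mul_add]
  exact ⟨hf.1.add hg.1, by rw [integral_add hf.1 hg.1, hf.2, hg.2, add_zero]⟩

lemma Null.const_mul (hf : Null b f) (c : ℝ) : Null b fun X => c * f X := by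
  simp only [Null, mul_left_comm _ c]
  exact ⟨hf.1.const_mul c, by rw [integral_const_mul, hf.2, mul_zero]⟩

/-- Because y^b (1 + y^(-b)) = 1 + y^b. This is the reason for working with σ = -b: the weight turns
the worst admissible growth into an integrable one when b > -1. -/
lemma LocBdd.ht_rpow_mul (h : LocBdd (rho (-b)) f) : LocBdd (rho b) fun X => ht X ^ b * f X := by
  intro R
  obtain ⟨M, hM, H⟩ := h R
  refine ⟨M, hM, fun X hX hR => ?_⟩
  have hy : 0 < ht X := hX
  have hp := Real.rpow_pos_of_pos hy b
  rw [abs_mul, abs_of_pos hp]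
  refine (mul_le_mul_of_nonneg_left (H X hX hR) hp.le).trans (le_of_eq ?_)
  rw [rho, rho, Real.rpow_neg hy.le]
  field_simp
  ring

/-- Weighted odd functions are O(y^(b+1) + y), so they tend to 0 at the boundary when b > -1: the
normal fluxes built from normal derivatives of even functions leave no boundary term. -/
lemma LocBdd.ht_rpow_mul_odd (h : LocBdd (Par.odd.wt (-b)) f) :
    LocBdd (fun X => ht X ^ (b + 1) + ht X) fun X => ht X ^ b * f X := by
  intro R
  obtain ⟨M, hM, H⟩ := h R
  refine ⟨M, hM, fun X hX hR => ?_⟩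
  have hy : 0 < ht X := hX
  have hp := Real.rpow_pos_of_pos hy b
  rw [abs_mul, abs_of_pos hp]
  refine (mul_le_mul_of_nonneg_left (H X hX hR) hp.le).trans (le_of_eq ?_)
  simp only [Par.wt]
  rw [rho, Real.rpow_neg hy.le, Real.rpow_add_one hy.ne']
  field_simp

lemma locBdd_odd_ht : LocBdd (Par.odd.wt (-b)) (ht : Space n → ℝ) := fun _ =>
  ⟨1, zero_le_one, fun X hX _ => by
    have hy : 0 < ht X := hX
    rw [abs_of_pos hy, one_mul]
    exact le_mul_of_one_le_right hy.le (one_le_rho _ hX)⟩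

lemma locBdd_one_of_odd_weight (hb : -1 < b) {f : Space n → ℝ}
    (h : LocBdd (fun X => ht X ^ (b + 1) + ht X) f) : LocBdd (fun _ => 1) f := by
  refine h.trans fun R => ⟨|R| ^ (b + 1) + |R|, by positivity, fun X hX hR => ?_⟩
  have hy : 0 < ht X := hX
  have h1 : ht X ≤ |R| := (ht_le_norm X).trans (hR.trans (le_abs_self R))
  rw [abs_of_nonneg (by positivity), mul_one]
  exact add_le_add (Real.rpow_le_rpow hy.le h1 (by linarith)) h1

lemma tendsto_lift_of_odd_weight (hb : -1 < b) {f : Space n → ℝ}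
    (h : LocBdd (fun X => ht X ^ (b + 1) + ht X) f) (x : EuclideanSpace ℝ (Fin n)) :
    Tendsto (fun y => f (lift x y)) (𝓝[>] 0) (𝓝 0) := by
  obtain ⟨M, hM, H⟩ := h (‖x‖ + 1)
  have h0 : 0 < b + 1 := by linarith
  have h1 : Tendsto (fun y : ℝ => M * (y ^ (b + 1) + y)) (𝓝 0) (𝓝 (M * (0 ^ (b + 1) + 0))) :=
    (((Real.continuousAt_rpow_const 0 (b + 1) (Or.inr h0.le)).tendsto).add tendsto_id).const_mul M
  rw [Real.zero_rpow h0.ne', add_zero, mul_zero] at h1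
  refine squeeze_zero_norm' ?_ (h1.mono_left nhdsWithin_le_nhds)
  filter_upwards [Ioc_mem_nhdsGT (zero_lt_one' ℝ)] with y hy
  have := H (lift x y) (lift_mem_upper x hy.1) (by
    refine (pow_le_pow_iff_left₀ (norm_nonneg _) (by positivity) two_ne_zero).1 ?_
    rw [norm_sq_lift]
    nlinarith [norm_nonneg x, hy.1, hy.2])
  simp only [ht_lift] at this
  exact this

lemma Cls.SL {σ : ℝ} (hσ : -1 < σ) (b : ℝ) (hf : Cls σ (m + 2) .even f) :
    Cls σ m .even (LaneEmden.SL b f) := by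
  refine (((hf.lapB hσ b).norm_sq_mul hσ).add ((Cls.const_mul ((hf.euler hσ).euler hσ) (-1)).add
    (((hf.euler hσ).of_succ hσ).const_mul (-(n + b - 1))))).congr fun X _ => ?_
  simp only [LaneEmden.SL]
  ring

lemma Cls.sm {σ : ℝ} {q : Par} (hf : Cls σ m q f) : Sm m f := hf.contDiffOn

/-- Derivatives of f may grow like 1 + y^σ, but those of g are bounded, so each product keeps the
gauge to the first power. -/
lemma locBdd_Gam {σ : ℝ} (hσ : -1 < σ) (hf : Cls σ 1 .any f) (hg : Cls σ 2 .even g) :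
    LocBdd (rho σ) (Gam f g) := by
  have hr : ∀ X ∈ upper n, 0 ≤ rho σ X := fun X hX => rho_nonneg σ hX
  have h1 : LocBdd (rho σ) fun X => ∑ j, pd j f X * pd j g X := by
    refine LocBdd.sum _ hr fun j _ => ?_
    have := (hf.pderiv j).2
    have h2 := (hg.pderiv j).locBdd_one hσ
    simpa only [mul_comm] using h2.one_mul' this
  have h3 : LocBdd (rho σ) fun X => euler f X * euler g X := by
    have := (hf.euler hσ).2
    have h2 := (hg.euler hσ).locBdd_one hσ
    simpa only [mul_comm] using h2.one_mul' this
  refine (((locBdd_of_continuous (by fun_prop : Continuous fun X : Space n => ‖X‖ ^ 2)).one_mul'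
    h1).add ((locBdd_const (-1)).one_mul' h3)).congr fun X _ => ?_
  simp only [Gam]
  ring

/-- Integration by parts on the half-sphere. -/
theorem null_green (hb : -1 < b) (hb1 : b < 1) (hf : Cls (-b) 1 .any f)
    (hg : Cls (-b) 2 .even g) : Null b fun X => f X * SL b g X + Gam f g X := by
  have hσ : -1 < -b := by linarith
  have hfs : Sm 1 f := hf.sm
  have hgs : Sm 2 g := hg.sm
  -- |X|² times the tangential part of ∇g: X·K = 0 and div K + (b/y) K_y = SL g, so y^b f K has
  -- divergence y^b (f SL g + Gam f g).
  set K : Fin (n + 1) → Space n → ℝ := fun j X => ‖X‖ ^ 2 * pd j g X - X j * euler g X with hK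
  have hKs : ∀ j, Sm 1 (K j) := fun j =>
    (sm_norm_sq.mul (hgs.pderiv j)).sub ((sm_coord j).mul hgs.euler)
  have hKd : ∀ j, ∀ X ∈ upper n, pd j (K j) X = ‖X‖ ^ 2 * pd j (pd j g) X + 2 * (X j * pd j g X)
      - euler g X - X j * pd j (euler g) X := by
    intro j X hX
    have hn : DifferentiableAt ℝ (fun X : Space n => ‖X‖ ^ 2) X :=
      (hasStrictFDerivAt_norm_sq X).hasFDerivAt.differentiableAt
    have hp : DifferentiableAt ℝ (pd j g) X := (hgs.pderiv j).diff hX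
    have he : DifferentiableAt ℝ (euler g) X := hgs.euler.diff hX
    have h1 : K j = fun X => ‖X‖ ^ 2 * pd j g X + (-1) * (X j * euler g X) := by
      funext X; simp only [hK]; ring
    rw [h1, pd_add (hn.fun_mul hp) (((differentiableAt_coord j X).fun_mul he).const_mul _),
      pd_mul hn hp, pd_const_mul _ ((differentiableAt_coord j X).fun_mul he),
      pd_mul (differentiableAt_coord j X) he, pd_norm_sq, pd_coord]
    simp only [if_true]
    ring
  have hc : Sm 0 fun X => f X * SL b g X + Gam f g X :=
    ((hfs.of_le (by omega)).mul (hgs.SL b)).add (hfs.Gam (hgs.of_le (by omega)))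
  have hlb : LocBdd (rho (-b)) fun X => f X * SL b g X + Gam f g X :=
    ((hf.locBdd_one hσ).one_mul' (hg.SL hσ b).2).add (locBdd_Gam hσ hf hg)
  have hDc : ContinuousOn (fun X => ht X ^ b * (f X * SL b g X + Gam f g X)) (upper n) :=
    ((sm_ht_rpow b).mul hc).continuousOn
  -- Both summands of K_y, |X|² ∂_y g and -y E g, have the size of an odd function, so the weighted
  -- normal component vanishes on {y = 0}.
  have hlw : LocBdd (fun X => ht X ^ (b + 1) + ht X)
      fun X => ht X ^ b * (f X * K (Fin.last n) X) := by
    refine LocBdd.ht_rpow_mul_odd ((hf.locBdd_one hσ).one_mul' ?_)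
    have h1 : LocBdd (Par.odd.wt (-b)) (pd (Fin.last n) g) := by
      have := (hg.pderiv (Fin.last n)).2.1
      rwa [Par.at_last] at this
    refine (((locBdd_of_continuous (by fun_prop : Continuous fun X : Space n => ‖X‖ ^ 2)).one_mul'
      h1).add (((locBdd_const (-1)).one_mul' ((hg.euler hσ).locBdd_one hσ)).one_mul'
        locBdd_odd_ht |>.congr (g := fun X => (-1) * (ht X * euler g X)) fun X _ => ?_)).congr
      fun X _ => ?_
    · ring
    · simp only [hK]; rw [ht]; ring
  refine ⟨integrableOn_hemi hb hDc hlb.ht_rpow_mul, ?_⟩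
  refine integral_divergence_hemi hb (F := fun j X => ht X ^ b * (f X * K j X))
    (D := fun X => ht X ^ b * (f X * SL b g X + Gam f g X))
    (fun j => (((sm_ht_rpow b).mul (hfs.mul (hKs j))).differentiableOn (by norm_num))) ?_
    hDc hlb.ht_rpow_mul ?_ (locBdd_one_of_odd_weight hb hlw) (tendsto_lift_of_odd_weight hb hlw)
  · intro X hX
    have hy : ht X ≠ 0 := ne_of_gt hX
    have h1 : ∀ j, pd j (fun X => ht X ^ b * (f X * K j X)) X =
        ht X ^ b * (f X * pd j (K j) X + pd j f X * K j X) +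
        (if Fin.last n = j then ht X ^ b * (b / ht X) * (f X * K j X) else 0) := fun j => by
      rw [pd_mul (Sm.diff (m := 0) (sm_ht_rpow b) hX) ((hfs.diff hX).fun_mul ((hKs j).diff hX)),
        pd_mul (hfs.diff hX) ((hKs j).diff hX), pd_ht_rpow b j hX]
      split_ifs <;> ring
    simp only [h1, Finset.sum_add_distrib, Finset.sum_ite_eq, Finset.mem_univ, if_true,
      ← Finset.mul_sum, hKd _ X hX, Finset.sum_sub_distrib]
    have h2 : ∑ j, pd j f X * K j X = Gam f g X := by
      simp only [hK, Gam, mul_sub, Finset.sum_sub_distrib, Finset.mul_sum]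
      rw [euler_eq_sum f, Finset.sum_mul]
      congr 1 <;> refine Finset.sum_congr rfl fun j _ => ?_ <;> ring
    have h3 : K (Fin.last n) X = ‖X‖ ^ 2 * pd (Fin.last n) g X - ht X * euler g X := rfl
    rw [h2, h3, ← euler_eq_sum g, ← euler_eq_sum (euler g), SL, lapB_eq_sum_pd hgs b hX]
    simp only [Finset.sum_const, Finset.card_univ, Fintype.card_fin, nsmul_eq_mul]
    push_cast
    field_simp
    ring
  · intro X hX
    have : ∀ j, X j * (ht X ^ b * (f X * K j X)) =
        ht X ^ b * f X * (‖X‖ ^ 2 * (X j * pd j g X) - X j ^ 2 * euler g X) := fun j => by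
      simp only [hK]; ring
    simp only [this, ← Finset.mul_sum, Finset.sum_sub_distrib, ← Finset.sum_mul]
    rw [← euler_eq_sum g, ← EuclideanSpace.real_norm_sq_eq]
    ring

end LaneEmden

end

noncomputable section

namespace LaneEmden

variable {n : ℕ} {b : ℝ} {m : ℕ} {f g : Space n → ℝ}

/-! ### The spherical gradient and Laplacian -/

lemma gradient_coord (f : Space n → ℝ) (X : Space n) (j : Fin (n + 1)) :
    gradient f X j = pd j f X := by
  have h : ⟪gradient f X, EuclideanSpace.single j (1 : ℝ)⟫_ℝ =
      fderiv ℝ f X (EuclideanSpace.single j 1) := by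
    rw [gradient, InnerProductSpace.toDual_symm_apply]
  rw [pd, ← h, EuclideanSpace.inner_single_right]
  simp

lemma inner_gradient (f g : Space n → ℝ) (X : Space n) :
    ⟪gradient f X, gradient g X⟫_ℝ = ∑ j, pd j f X * pd j g X := by
  simp only [PiLp.inner_apply, gradient_coord]
  simp [mul_comm]

lemma norm_sq_gradient (f : Space n → ℝ) (X : Space n) :
    ‖gradient f X‖ ^ 2 = ∑ j, pd j f X ^ 2 := by
  rw [← real_inner_self_eq_norm_sq, inner_gradient]
  simp only [sq]

lemma norm_pos_of_mem_upper {X : Space n} (hX : X ∈ upper n) : 0 < ‖X‖ :=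
  lt_of_lt_of_le (show 0 < ht X from hX) (ht_le_norm X)

lemma hasFDerivAt_inv_norm {X : Space n} (hX : X ≠ 0) :
    HasFDerivAt (fun Y : Space n => ‖Y‖⁻¹) (-(‖X‖⁻¹ ^ 3) • innerSL ℝ X) X := by
  have h0 : ‖X‖ ≠ 0 := norm_ne_zero_iff.2 hX
  have hs : ∀ Y : Space n, √(‖Y‖ ^ 2) = ‖Y‖ := fun Y => Real.sqrt_sq (norm_nonneg Y)
  have h1 := (((Real.hasDerivAt_sqrt (pow_ne_zero 2 h0)).inv (by rw [hs]; exact h0)).comp_hasFDerivAt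
    X (hasStrictFDerivAt_norm_sq X).hasFDerivAt)
  have h2 : (fun Y : Space n => ‖Y‖⁻¹) = (fun Y : Space n => (√(‖Y‖ ^ 2))⁻¹) := by
    funext Y; rw [hs]
  rw [h2]
  convert! h1 using 1
  rw [hs]
  ext v
  simp only [smul_apply, innerSL_apply_apply, smul_eq_mul, nsmul_eq_mul, Nat.cast_ofNat]
  field_simp

lemma pd_inv_norm {X : Space n} (hX : X ≠ 0) (j : Fin (n + 1)) :
    pd j (fun Y : Space n => ‖Y‖⁻¹) X = -(‖X‖⁻¹ ^ 3 * X j) := by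
  rw [pd, (hasFDerivAt_inv_norm hX).fderiv]
  simp [EuclideanSpace.inner_single_right]

lemma radial_mem_upper {X : Space n} (hX : X ∈ upper n) : ‖X‖⁻¹ • X ∈ upper n :=
  (smul_mem_upper_iff (inv_pos.2 (norm_pos_of_mem_upper hX))).2 hX

lemma hasFDerivAt_radial {X : Space n} (hX : X ≠ 0) :
    HasFDerivAt (fun Y : Space n => ‖Y‖⁻¹ • Y)
      (‖X‖⁻¹ • ContinuousLinearMap.id ℝ (Space n) +
        (-(‖X‖⁻¹ ^ 3) • innerSL ℝ X).smulRight X) X :=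
  (hasFDerivAt_inv_norm hX).smul (hasFDerivAt_id X)

lemma Sm.homExt (hf : Sm m f) : Sm m (LaneEmden.homExt f) := by
  refine ContDiffOn.comp hf (t := upper n) (g := f) (f := fun X : Space n => ‖X‖⁻¹ • X) ?_
    fun X hX => radial_mem_upper hX
  intro X hX
  have h0 : X ≠ 0 := norm_pos_iff.1 (norm_pos_of_mem_upper hX)
  exact (((contDiffAt_norm ℝ h0).inv (norm_ne_zero_iff.2 h0)).smul contDiffAt_id).contDiffWithinAt

lemma pd_homExt (hf : Sm (m + 1) f) (j : Fin (n + 1)) {X : Space n} (hX : X ∈ upper n) :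
    pd j (homExt f) X = ‖X‖⁻¹ * homExt (pd j f) X -
      ‖X‖⁻¹ ^ 2 * (X j * homExt (euler f) X) := by
  have hn := norm_pos_of_mem_upper hX
  have h0 : X ≠ 0 := norm_pos_iff.1 hn
  have h1 := (HasFDerivAt.comp (g := f) (f := fun Y : Space n => ‖Y‖⁻¹ • Y) X
    (hf.diff (radial_mem_upper hX)).hasFDerivAt (hasFDerivAt_radial h0)).fderiv
  have h2 : pd j (homExt f) X = fderiv ℝ (f ∘ fun Y : Space n => ‖Y‖⁻¹ • Y) X
      (EuclideanSpace.single j 1) := rfl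
  rw [h2, h1]
  simp only [ContinuousLinearMap.comp_apply, add_apply, smul_apply,
    ContinuousLinearMap.smulRight_apply, innerSL_apply_apply, EuclideanSpace.inner_single_right,
    map_add, map_smul, homExt, pd, euler, smul_eq_mul, ContinuousLinearMap.id_apply]
  simp
  ring

lemma homExt_of_norm_eq_one (f : Space n → ℝ) {X : Space n} (h1 : ‖X‖ = 1) : homExt f X = f X := by
  simp [homExt, h1]

lemma pd_homExt_of_norm_eq_one (hf : Sm (m + 1) f) (j : Fin (n + 1)) {X : Space n}
    (hX : X ∈ upper n) (h1 : ‖X‖ = 1) : pd j (homExt f) X = pd j f X - X j * euler f X := by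
  rw [pd_homExt hf j hX, homExt_of_norm_eq_one _ h1, homExt_of_norm_eq_one _ h1, h1]
  ring

lemma sum_sq_coord (X : Space n) : ∑ j, X j ^ 2 = ‖X‖ ^ 2 :=
  (EuclideanSpace.real_norm_sq_eq X).symm

/-- On the unit sphere the gradient of the degree-zero extension is ∇f - (Ef) X; the inner product
of two such vectors is computed with X·∇f = Ef and |X| = 1. -/
theorem inner_sphGrad (hf : Sm (m + 1) f) (hg : Sm (m + 1) g) {X : Space n}
    (hX : X ∈ upper n) (h1 : ‖X‖ = 1) : ⟪sphGrad f X, sphGrad g X⟫_ℝ = Gam f g X := by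
  rw [sphGrad, sphGrad, inner_gradient]
  simp only [pd_homExt_of_norm_eq_one hf _ hX h1, pd_homExt_of_norm_eq_one hg _ hX h1, Gam]
  have h2 : ∀ j, (pd j f X - X j * euler f X) * (pd j g X - X j * euler g X) =
      pd j f X * pd j g X - (X j * pd j f X) * euler g X - euler f X * (X j * pd j g X) +
        X j ^ 2 * (euler f X * euler g X) := fun j => by ring
  simp only [h2, Finset.sum_add_distrib, Finset.sum_sub_distrib, ← Finset.sum_mul,
    ← Finset.mul_sum, ← euler_eq_sum, sum_sq_coord, h1]
  ring

/-- Links the spherical Laplacian of the statement with the operator used in the computations. The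
degree-zero extension has no radial derivative, so on the unit sphere its Δ_b is the angular part of
Δ_b f. -/
theorem sphLap_eq_SL (hf : Sm (m + 2) f) (b : ℝ) {X : Space n}
    (hX : X ∈ upper n) (h1 : ‖X‖ = 1) : sphLap b f X = SL b f X := by
  have hy : ht X ≠ 0 := ne_of_gt hX
  have h0 : X ≠ 0 := norm_pos_iff.1 (norm_pos_of_mem_upper hX)
  rw [sphLap, lapB_eq_sum_pd hf.homExt.two b hX, SL, lapB_eq_sum_pd hf.two b hX,
    pd_homExt_of_norm_eq_one (m := m + 1) hf _ hX h1]
  have hN : DifferentiableAt ℝ (fun Y : Space n => ‖Y‖⁻¹) X :=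
    (hasFDerivAt_inv_norm h0).differentiableAt
  have hN2 : DifferentiableAt ℝ (fun Y : Space n => ‖Y‖⁻¹ ^ 2) X := hN.pow 2
  have hN2p : ∀ j, pd j (fun Y : Space n => ‖Y‖⁻¹ ^ 2) X = -2 * X j := fun j => by
    have : (fun Y : Space n => ‖Y‖⁻¹ ^ 2) = fun Y : Space n => ‖Y‖⁻¹ * ‖Y‖⁻¹ := by
      funext Y; ring
    rw [this, pd_mul hN hN, pd_inv_norm h0, h1]
    ring
  have he : DifferentiableAt ℝ (homExt (euler f)) X := (Sm.homExt (m := m + 1) hf.euler).diff hX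
  have h2 : ∀ j, pd j (pd j (homExt f)) X = pd j (pd j f) X - euler f X -
      X j * pd j f X - X j * euler (pd j f) X - X j * pd j (euler f) X +
        2 * (X j ^ 2 * euler f X) + X j ^ 2 * euler (euler f) X := by
    intro j
    have h3 : EqOn (pd j (homExt f)) (fun Y => ‖Y‖⁻¹ * homExt (pd j f) Y +
        (-1) * (‖Y‖⁻¹ ^ 2 * (Y j * homExt (euler f) Y))) (upper n) := fun Y hY => by
      rw [pd_homExt (m := m + 1) hf j hY]; ring
    have hp : DifferentiableAt ℝ (homExt (pd j f)) X := (Sm.homExt (hf.pderiv j)).diff hX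
    have hx := differentiableAt_coord j X
    rw [pd_eqOn h3 j hX, pd_add (hN.fun_mul hp) ((hN2.fun_mul (hx.fun_mul he)).const_mul _),
      pd_mul hN hp, pd_const_mul _ (hN2.fun_mul (hx.fun_mul he)), pd_mul hN2 (hx.fun_mul he),
      pd_mul hx he, hN2p, pd_inv_norm h0, pd_coord, homExt_of_norm_eq_one _ h1,
      homExt_of_norm_eq_one _ h1, pd_homExt_of_norm_eq_one (hf.pderiv j) j hX h1,
      pd_homExt_of_norm_eq_one (m := m) hf.euler j hX h1, h1]
    simp only [if_true]
    ring
  have h4 : ∀ j, euler (pd j f) X = pd j (euler f) X - pd j f X := fun j => by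
    rw [pd_euler hf j hX]; ring
  simp only [h2, h4, mul_sub, Finset.sum_add_distrib, Finset.sum_sub_distrib,
    ← Finset.sum_mul, ← Finset.mul_sum, ← euler_eq_sum, sum_sq_coord, h1, Finset.sum_const,
    Finset.card_univ, Fintype.card_fin, nsmul_eq_mul]
  have h5 : X (Fin.last n) = ht X := rfl
  rw [h5]
  push_cast
  field_simp
  ring

end LaneEmden

end

noncomputable section

namespace LaneEmden

variable {n : ℕ} {b σ : ℝ} {m : ℕ} {f g : Space n → ℝ}

/-! ### Powers of the shifted Euler operator -/

/-- The iterates of `X · ∇ + k`. -/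
def eulerPow (k : ℝ) (f : Space n → ℝ) : ℕ → Space n → ℝ
  | 0 => f
  | j + 1 => fun X => euler (eulerPow k f j) X + k * eulerPow k f j X

lemma eulerPow_add (k : ℝ) (f : Space n → ℝ) (i j : ℕ) :
    eulerPow k (eulerPow k f j) i = eulerPow k f (j + i) := by
  induction i with
  | zero => rfl
  | succ i ih => simp only [eulerPow, ih]; rfl

lemma Sm.eulerPow (k : ℝ) {j : ℕ} (hf : Sm (m + j) f) : Sm m (LaneEmden.eulerPow k f j) := by
  induction j generalizing m with
  | zero => exact hf
  | succ j ih =>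
    have h : Sm (m + 1) (LaneEmden.eulerPow k f j) := ih (by rwa [add_assoc, add_comm 1 j])
    exact h.euler.add ((h.of_le (by omega)).const_mul k)

lemma Cls.eulerPow (hσ : -1 < σ) (k : ℝ) {q : Par} {j : ℕ} (hf : Cls σ (m + j) q f) :
    Cls σ m q (LaneEmden.eulerPow k f j) := by
  induction j generalizing m with
  | zero => exact hf
  | succ j ih =>
    have h : Cls σ (m + 1) q (LaneEmden.eulerPow k f j) := ih (by rwa [add_assoc, add_comm 1 j])
    exact (h.euler hσ).add ((h.of_succ hσ).const_mul k)

/-- Each passage of E + k through Δ_b raises the shift by 2, by `lapB_euler`. -/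
lemma lapB_eulerPow (b k : ℝ) (j : ℕ) (hf : Sm (j + 2) f) :
    EqOn (lapB b (eulerPow k f j)) (eulerPow (k + 2) (lapB b f) j) (upper n) := by
  induction j with
  | zero => exact fun _ _ => rfl
  | succ j ih =>
    intro X hX
    have hg : Sm 3 (eulerPow k f j) := Sm.eulerPow k (by rwa [add_comm 3 j])
    have h1 := ih (hf.of_le (by omega))
    have h2 : Sm 2 (euler (eulerPow k f j)) := Sm.euler hg
    change lapB b (fun X => euler (eulerPow k f j) X + k * eulerPow k f j X) X = _
    rw [lapB_add (m := 0) b h2 (Sm.const_mul (hg.of_le (by omega)) k) hX,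
      lapB_const_mul (m := 1) b k hg hX, lapB_euler (m := 0) b hg hX, euler_eqOn h1 hX, h1 hX]
    simp only [eulerPow]
    ring

/-- The polar decomposition r²Δ_b = SL + E² + (n + b - 1) E, rewritten in powers of E + k. It is the
source of α = n + b - 1 - 2k and β = k (n + b - 1 - k). -/
lemma norm_sq_mul_lapB (b k : ℝ) (hf : Sm 2 f) {X : Space n} (hX : X ∈ upper n) :
    ‖X‖ ^ 2 * lapB b f X = SL b f X + eulerPow k f 2 X +
      ((n + b - 1) - 2 * k) * eulerPow k f 1 X - k * ((n + b - 1) - k) * f X := by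
  have h : euler (eulerPow k f 1) X = euler (euler f) X + k * euler f X := by
    change euler (fun X => euler f X + k * f X) X = _
    rw [euler_add (hf.euler.diff hX) ((hf.diff hX).const_mul k),
      euler_const_mul k (hf.diff hX)]
  rw [SL]
  simp only [eulerPow] at h ⊢
  rw [h]
  ring

/-- The function `F'` is `(X · ∇ + c) F`. -/
def ShiftedEuler (c : ℝ) (F F' : Space n → ℝ) : Prop :=
  DifferentiableOn ℝ F (upper n) ∧ ∀ X ∈ upper n, euler F X + c * F X = F' X

lemma ShiftedEuler.diff {c : ℝ} {F F' : Space n → ℝ} (h : ShiftedEuler c F F') {X : Space n}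
    (hX : X ∈ upper n) : DifferentiableAt ℝ F X := h.1.differentiableAt (upper_mem_nhds hX)

lemma ShiftedEuler.add {c : ℝ} {F F' G G' : Space n → ℝ} (hF : ShiftedEuler c F F')
    (hG : ShiftedEuler c G G') :
    ShiftedEuler c (fun X => F X + G X) (fun X => F' X + G' X) :=
  ⟨hF.1.add hG.1, fun X hX => by
    simp only
    rw [euler_add (hF.diff hX) (hG.diff hX), ← hF.2 X hX, ← hG.2 X hX]; ring⟩

lemma ShiftedEuler.const_mul {c : ℝ} {F F' : Space n → ℝ} (hF : ShiftedEuler c F F') (a : ℝ) :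
    ShiftedEuler c (fun X => a * F X) (fun X => a * F' X) :=
  ⟨hF.1.const_mul a, fun X hX => by
    simp only
    rw [euler_const_mul a (hF.diff hX), ← hF.2 X hX]; ring⟩

lemma ShiftedEuler.mul {c d : ℝ} {F F' G G' : Space n → ℝ} (hF : ShiftedEuler c F F')
    (hG : ShiftedEuler d G G') :
    ShiftedEuler (c + d) (fun X => F X * G X) (fun X => F' X * G X + F X * G' X) :=
  ⟨hF.1.mul hG.1, fun X hX => by
    simp only
    rw [euler_mul (hF.diff hX) (hG.diff hX), ← hF.2 X hX, ← hG.2 X hX]; ring⟩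

lemma shiftedEuler_eulerPow (k : ℝ) (j : ℕ) (hf : Sm (j + 1) f) :
    ShiftedEuler k (eulerPow k f j) (eulerPow k f (j + 1)) :=
  ⟨(Sm.eulerPow (m := 1) k (by rwa [add_comm 1 j])).differentiableOn (by norm_num),
    fun _ _ => rfl⟩

lemma SL_shift (b k : ℝ) (hf : Sm (m + 3) f) :
    EqOn (SL b fun X => euler f X + k * f X) (fun X => euler (SL b f) X + k * SL b f X)
      (upper n) := fun X hX => by
  rw [SL_add (m := m) b (Sm.euler (m := m + 2) hf) (Sm.const_mul (hf.of_le (by omega)) k) hX,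
    SL_const_mul (m := m) b k (hf.of_le (by omega)) hX, SL_euler b hf hX]

lemma shiftedEuler_SL (b k : ℝ) (j : ℕ) (hf : Sm (j + 3) f) :
    ShiftedEuler k (SL b (eulerPow k f j)) (SL b (eulerPow k f (j + 1))) := by
  have h : Sm 3 (eulerPow k f j) := Sm.eulerPow k (by rwa [add_comm 3 j])
  refine ⟨(Sm.SL (m := 1) h b).differentiableOn (by norm_num), fun X hX => ?_⟩
  exact (SL_shift (m := 0) b k h hX).symm

lemma Gam_add_left {h : Space n → ℝ} {X : Space n} (hf : DifferentiableAt ℝ f X)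
    (hg : DifferentiableAt ℝ g X) :
    Gam (fun Y => f Y + g Y) h X = Gam f h X + Gam g h X := by
  simp only [Gam, pd_add hf hg, euler_add hf hg, add_mul, Finset.sum_add_distrib]
  ring

lemma Gam_const_mul_left {h : Space n → ℝ} {X : Space n} (c : ℝ) (hf : DifferentiableAt ℝ f X) :
    Gam (fun Y => c * f Y) h X = c * Gam f h X := by
  simp only [Gam, pd_const_mul c hf, euler_const_mul c hf, mul_assoc, ← Finset.mul_sum]
  ring

lemma shiftedEuler_Gam (k : ℝ) (i j : ℕ) (hi : Sm (i + 2) f) (hj : Sm (j + 2) g) :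
    ShiftedEuler (k + k) (Gam (eulerPow k f i) (eulerPow k g j))
      (fun X => Gam (eulerPow k f (i + 1)) (eulerPow k g j) X +
        Gam (eulerPow k f i) (eulerPow k g (j + 1)) X) := by
  have hi' : Sm 2 (eulerPow k f i) := Sm.eulerPow k (by rwa [add_comm 2 i])
  have hj' : Sm 2 (eulerPow k g j) := Sm.eulerPow k (by rwa [add_comm 2 j])
  refine ⟨(Sm.Gam (m := 1) hi' hj').differentiableOn (by norm_num), fun X hX => ?_⟩
  have e1 : Gam (eulerPow k f (i + 1)) (eulerPow k g j) X =
      Gam (euler (eulerPow k f i)) (eulerPow k g j) X +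
        k * Gam (eulerPow k f i) (eulerPow k g j) X := by
    change Gam (fun Y => euler (eulerPow k f i) Y + k * eulerPow k f i Y) _ X = _
    rw [Gam_add_left (hi'.euler.diff hX) ((hi'.diff hX).const_mul k),
      Gam_const_mul_left k (hi'.diff hX)]
  have e2 : Gam (eulerPow k f i) (eulerPow k g (j + 1)) X =
      Gam (eulerPow k f i) (euler (eulerPow k g j)) X +
        k * Gam (eulerPow k f i) (eulerPow k g j) X := by
    rw [Gam_comm, Gam_comm _ (euler _), Gam_comm (eulerPow k f i)]
    change Gam (fun Y => euler (eulerPow k g j) Y + k * eulerPow k g j Y) _ X = _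
    rw [Gam_add_left (hj'.euler.diff hX) ((hj'.diff hX).const_mul k),
      Gam_const_mul_left k (hj'.diff hX)]
  simp only
  rw [euler_Gam (m := 0) hi' hj' hX, e1, e2]
  ring

/-- Cauchy-Schwarz for X and ∇f. -/
lemma Gam_self_nonneg (f : Space n → ℝ) (X : Space n) : 0 ≤ Gam f f X := by
  have h := Finset.sum_mul_sq_le_sq_mul_sq Finset.univ (fun j => X j) (fun j => pd j f X)
  rw [← euler_eq_sum, sum_sq_coord] at h
  simp only [Gam]
  simp only [← sq]
  linarith

lemma Cls.Gam_any (hσ : -1 < σ) (hf : Cls σ 2 .any f) (hg : Cls σ 2 .any g) :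
    Cls σ 1 .any (Gam f g) := by
  have h1 : Cls σ 1 .any (fun X => ∑ j, pd j f X * pd j g X) := Cls.sum _ fun j _ => by
    have h1 := hf.pderiv j
    have h2 := hg.pderiv j
    rw [Par.any_at] at h1 h2
    exact h1.mul_any h2
  refine ((h1.norm_sq_mul hσ).add
    (((hf.euler hσ).mul_any (hg.euler hσ)).const_mul (-1))).congr fun X _ => ?_
  simp only [Gam]
  ring

/-! ### The boundary form -/

/-- The form integrated over the half-sphere in the energy, without the weight. -/
def bdryForm (b k α β : ℝ) (u : Space n → ℝ) (X : Space n) : ℝ :=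
  let p := eulerPow k u
  -- Replacing k by k + 2, as Δ_b u requires, changes α into α - 4 and β into this β₁; below, γ = β
  -- + β₁. The factor k/2 + 1 of the last square makes its derivative cancel the term -(k + 2) V_1
  -- V_0 of the flux.
  let β₁ := β + 2 * α - 4
  let γ := 2 * β + 2 * α - 4
  (-1) * (p 1 X * p 4 X) + (2 * (p 2 X * p 3 X) + ((8 - 2 * α) * (p 1 X * p 3 X) +
  ((α - 6) * (p 2 X * p 2 X) + ((4 * β + 14 * α - 20 - α ^ 2) * (p 1 X * p 2 X) +
  ((α * β - 2 * β - 2 * β₁ + 2 * α ^ 2 - 8 * α) * (p 1 X * p 1 X) +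
  (β₁ * β * (p 0 X * p 1 X) + (2 * β₁ * β * (p 0 X * p 0 X) +
  (4 * Gam (p 1) (p 2) X + ((α - 4) * Gam (p 1) (p 1) X + (γ * Gam (p 0) (p 1) X +
  (2 * γ * Gam (p 0) (p 0) X +
  (1 * (SL b (p 0) X * SL b (p 1) X) + (2 * (SL b (p 0) X * SL b (p 0) X) +
  (k / 2 + 1) * ((‖X‖ ^ 2 * lapB b u X) * (‖X‖ ^ 2 * lapB b u X)))))))))))))))

/-- `(X · ∇ + 2 k)` applied to `bdryForm`. -/
def bdryForm' (b k α β : ℝ) (u : Space n → ℝ) (X : Space n) : ℝ :=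
  let p := eulerPow k u
  let β₁ := β + 2 * α - 4
  let γ := 2 * β + 2 * α - 4
  (-1) * (p 2 X * p 4 X + p 1 X * p 5 X) + (2 * (p 3 X * p 3 X + p 2 X * p 4 X) +
  ((8 - 2 * α) * (p 2 X * p 3 X + p 1 X * p 4 X) +
  ((α - 6) * (p 3 X * p 2 X + p 2 X * p 3 X) +
  ((4 * β + 14 * α - 20 - α ^ 2) * (p 2 X * p 2 X + p 1 X * p 3 X) +
  ((α * β - 2 * β - 2 * β₁ + 2 * α ^ 2 - 8 * α) * (p 2 X * p 1 X + p 1 X * p 2 X) +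
  (β₁ * β * (p 1 X * p 1 X + p 0 X * p 2 X) +
  (2 * β₁ * β * (p 1 X * p 0 X + p 0 X * p 1 X) +
  (4 * (Gam (p 2) (p 2) X + Gam (p 1) (p 3) X) +
  ((α - 4) * (Gam (p 2) (p 1) X + Gam (p 1) (p 2) X) +
  (γ * (Gam (p 1) (p 1) X + Gam (p 0) (p 2) X) +
  (2 * γ * (Gam (p 1) (p 0) X + Gam (p 0) (p 1) X) +
  (1 * (SL b (p 1) X * SL b (p 1) X + SL b (p 0) X * SL b (p 2) X) +
  (2 * (SL b (p 1) X * SL b (p 0) X + SL b (p 0) X * SL b (p 1) X) +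
  (k / 2 + 1) * ((‖X‖ ^ 2 * eulerPow (k + 2) (lapB b u) 1 X) * (‖X‖ ^ 2 * lapB b u X) +
    (‖X‖ ^ 2 * lapB b u X) * (‖X‖ ^ 2 * eulerPow (k + 2) (lapB b u) 1 X)))))))))))))))

lemma shiftedEuler_bdryForm (b k α β : ℝ) {u : Space n → ℝ} (hu : Sm 6 u) :
    ShiftedEuler (k + k) (bdryForm b k α β u) (bdryForm' b k α β u) := by
  have hp : ∀ j, j ≤ 4 → ShiftedEuler k (eulerPow k u j) (eulerPow k u (j + 1)) := fun j hj =>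
    shiftedEuler_eulerPow k j (hu.of_le (by omega))
  have hG : ∀ i j, i ≤ 4 → j ≤ 4 → ShiftedEuler (k + k) (Gam (eulerPow k u i) (eulerPow k u j))
      (fun X => Gam (eulerPow k u (i + 1)) (eulerPow k u j) X +
        Gam (eulerPow k u i) (eulerPow k u (j + 1)) X) := fun i j hi hj =>
    shiftedEuler_Gam k i j (hu.of_le (by omega)) (hu.of_le (by omega))
  have hS : ∀ j, j ≤ 3 → ShiftedEuler k (SL b (eulerPow k u j)) (SL b (eulerPow k u (j + 1))) :=
    fun j hj => shiftedEuler_SL b k j (hu.of_le (by omega))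
  have hc : ShiftedEuler k (fun X => ‖X‖ ^ 2 * lapB b u X)
      (fun X => ‖X‖ ^ 2 * eulerPow (k + 2) (lapB b u) 1 X) := by
    have h4 : Sm 4 (lapB b u) := hu.lapB b
    refine ⟨(Sm.mul (m := 1) sm_norm_sq (h4.of_le (by omega))).differentiableOn (by norm_num),
      fun X hX => ?_⟩
    rw [euler_norm_sq_mul (h4.diff hX)]
    simp only [eulerPow]
    ring
  exact (((hp 1 (by omega)).mul (hp 4 (by omega))).const_mul _).add <|
    (((hp 2 (by omega)).mul (hp 3 (by omega))).const_mul _).add <|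
    (((hp 1 (by omega)).mul (hp 3 (by omega))).const_mul _).add <|
    (((hp 2 (by omega)).mul (hp 2 (by omega))).const_mul _).add <|
    (((hp 1 (by omega)).mul (hp 2 (by omega))).const_mul _).add <|
    (((hp 1 (by omega)).mul (hp 1 (by omega))).const_mul _).add <|
    (((hp 0 (by omega)).mul (hp 1 (by omega))).const_mul _).add <|
    (((hp 0 (by omega)).mul (hp 0 (by omega))).const_mul _).add <|
    ((hG 1 2 (by omega) (by omega)).const_mul _).add <|
    ((hG 1 1 (by omega) (by omega)).const_mul _).add <|
    ((hG 0 1 (by omega) (by omega)).const_mul _).add <|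
    ((hG 0 0 (by omega) (by omega)).const_mul _).add <|
    (((hS 0 (by omega)).mul (hS 1 (by omega))).const_mul _).add <|
    (((hS 0 (by omega)).mul (hS 0 (by omega))).const_mul _).add <|
    (hc.mul hc).const_mul _

/-- Every factor uses at most four derivatives of u, so with u of order five all of them are of
order one and products are allowed. -/
lemma cls_bdryForm (hσ : -1 < σ) (b k α β : ℝ) {u : Space n → ℝ} (hu : Cls σ 5 .even u) :
    Cls σ 1 .any (bdryForm b k α β u) := by
  have hp : ∀ j, j ≤ 4 → Cls σ 1 .any (eulerPow k u j) := fun j hj =>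
    (Cls.eulerPow hσ k (hu.of_le hσ (by omega))).to_any hσ
  have hG : ∀ i j, i ≤ 3 → j ≤ 3 → Cls σ 1 .any (Gam (eulerPow k u i) (eulerPow k u j)) :=
    fun i j hi hj => Cls.Gam_any hσ
      ((Cls.eulerPow hσ k (hu.of_le hσ (by omega))).to_any hσ)
      ((Cls.eulerPow hσ k (hu.of_le hσ (by omega))).to_any hσ)
  have hS : ∀ j, j ≤ 2 → Cls σ 1 .any (SL b (eulerPow k u j)) := fun j hj =>
    ((Cls.eulerPow (m := 3) hσ k (hu.of_le hσ (by omega))).SL hσ b).to_any hσ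
  have hc : Cls σ 1 .any (fun X => ‖X‖ ^ 2 * lapB b u X) :=
    (((Cls.lapB (m := 1) hσ b (hu.of_le hσ (by omega))).norm_sq_mul hσ)).to_any hσ
  exact (((hp 1 (by omega)).mul_any (hp 4 (by omega))).const_mul _).add <|
    (((hp 2 (by omega)).mul_any (hp 3 (by omega))).const_mul _).add <|
    (((hp 1 (by omega)).mul_any (hp 3 (by omega))).const_mul _).add <|
    (((hp 2 (by omega)).mul_any (hp 2 (by omega))).const_mul _).add <|
    (((hp 1 (by omega)).mul_any (hp 2 (by omega))).const_mul _).add <|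
    (((hp 1 (by omega)).mul_any (hp 1 (by omega))).const_mul _).add <|
    (((hp 0 (by omega)).mul_any (hp 1 (by omega))).const_mul _).add <|
    (((hp 0 (by omega)).mul_any (hp 0 (by omega))).const_mul _).add <|
    ((hG 1 2 (by omega) (by omega)).const_mul _).add <|
    ((hG 1 1 (by omega) (by omega)).const_mul _).add <|
    ((hG 0 1 (by omega) (by omega)).const_mul _).add <|
    ((hG 0 0 (by omega) (by omega)).const_mul _).add <|
    (((hS 0 (by omega)).mul_any (hS 1 (by omega))).const_mul _).add <|
    (((hS 0 (by omega)).mul_any (hS 0 (by omega))).const_mul _).add <|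
    (hc.mul_any hc).const_mul _

end LaneEmden

end

/-! ### Reduction of the derivative of the energy to a quadratic form -/

noncomputable section

namespace LaneEmden

variable {n : ℕ} {b σ : ℝ} {m : ℕ} {f g : Space n → ℝ}

/-- The outward flux on the sphere of the vector field whose divergence is the derivative of the
bulk density. -/
def flux (b k : ℝ) (u : Space n → ℝ) (X : Space n) : ℝ :=
  let p := eulerPow k u
  let V := eulerPow (k + 2) (lapB b u)
  let W := eulerPow (k + 4) (lapB b (lapB b u))
  V 1 X * (V 1 X - (k + 2) * V 0 X) - W 0 X * (p 2 X - k * p 1 X) +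
    p 1 X * (W 1 X - (k + 4) * W 0 X)

/-- The quadratic form to which the derivative of the energy reduces after integration by parts. -/
def targetForm (b k α β : ℝ) (u : Space n → ℝ) (X : Space n) : ℝ :=
  let p := eulerPow k u
  3 * (p 3 X * p 3 X) + ((6 * β + 20 * α - 24 - α ^ 2) * (p 2 X * p 2 X) +
  ((3 * β ^ 2 + 12 * (α - 2) * β + 8 * α * (α - 2)) * (p 1 X * p 1 X) +
  (6 * Gam (p 2) (p 2) X + ((6 * β + 12 * (α - 2)) * Gam (p 1) (p 1) X +
  3 * (SL b (p 1) X * SL b (p 1) X)))))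

lemma lapB_eulerPow_of_norm_eq_one (b k : ℝ) {j : ℕ} (hf : Sm (j + 2) f) {X : Space n}
    (hX : X ∈ upper n) (h1 : ‖X‖ = 1) :
    eulerPow (k + 2) (lapB b f) j X = SL b (eulerPow k f j) X + eulerPow k f (j + 2) X +
      ((n + b - 1) - 2 * k) * eulerPow k f (j + 1) X -
        k * ((n + b - 1) - k) * eulerPow k f j X := by
  have h := norm_sq_mul_lapB b k (Sm.eulerPow (m := 2) k (by rwa [add_comm 2 j])) hX
  rw [lapB_eulerPow b k j hf hX, eulerPow_add, eulerPow_add, h1, one_pow, one_mul] at h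
  exact h

/-- The terms which vanish by integration by parts. -/
def greenForm (b k α β : ℝ) (u : Space n → ℝ) (X : Space n) : ℝ :=
  let p := eulerPow k u
  let V := eulerPow (k + 2) (lapB b u)
  let β₁ := β + 2 * α - 4
  let gr : (Space n → ℝ) → (Space n → ℝ) → ℝ := fun f g => f X * SL b g X + Gam f g X
  (-1) * gr (p 2) (V 0) + (1 * gr (V 0) (p 2) + (1 * gr (p 1) (V 1) + ((-1) * gr (V 1) (p 1) +
  ((-4) * gr (p 1) (V 0) + (4 * gr (V 0) (p 1) + (3 * gr (p 3) (p 1) + (2 * α * gr (p 2) (p 1) +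
  ((-3 * β - β₁ - 8 * α + 16) * gr (p 1) (p 1) + ((-2) * gr (p 2) (p 2) + ((-8) * gr (p 1) (p 2) +
  (β * gr (p 0) (p 2) + (4 * β * gr (p 0) (p 1) + (β₁ * gr (p 2) (p 0) + (1 * gr (p 1) (p 3) +
  4 * β₁ * gr (p 1) (p 0)))))))))))))))

/-- The algebraic heart of the proof. On the unit sphere V_j = SL p_j + p_(j+2) + α p_(j+1) - β p_j,
and W_j is obtained from the V_j in the same way with α - 4 and β + 2α - 4. After this substitution
both sides are polynomials in the same quantities. The Green terms come partly in pairs of opposite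
sign, which move SL from V_j back to the p_i while their gradient terms cancel by symmetry of `Gam`.
-/
lemma flux_add_bdryForm' (b k : ℝ) {u : Space n → ℝ} (hu : Sm 6 u) {X : Space n}
    (hX : X ∈ upper n) (h1 : ‖X‖ = 1) {α β : ℝ} (hα : α = (n + b - 1) - 2 * k)
    (hβ : β = k * ((n + b - 1) - k)) :
    flux b k u X + bdryForm' b k α β u X = targetForm b k α β u X + greenForm b k α β u X := by
  have hv : Sm 4 (lapB b u) := hu.lapB b
  have hV : ∀ j, j ≤ 3 → eulerPow (k + 2) (lapB b u) j X = SL b (eulerPow k u j) X +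
      eulerPow k u (j + 2) X + α * eulerPow k u (j + 1) X - β * eulerPow k u j X := fun j hj => by
    rw [lapB_eulerPow_of_norm_eq_one b k (hu.of_le (by omega)) hX h1, hα, hβ]
  have hW : ∀ j, j ≤ 1 → eulerPow (k + 4) (lapB b (lapB b u)) j X =
      SL b (eulerPow (k + 2) (lapB b u) j) X + eulerPow (k + 2) (lapB b u) (j + 2) X +
      (α - 4) * eulerPow (k + 2) (lapB b u) (j + 1) X -
      (β + 2 * α - 4) * eulerPow (k + 2) (lapB b u) j X := fun j hj => by
    have := lapB_eulerPow_of_norm_eq_one b (k + 2) (hv.of_le (by omega : j + 2 ≤ 4)) hX h1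
    rw [add_assoc k 2 2] at this
    norm_num at this
    rw [this, hα, hβ]
    ring
  have hV0 := hV 0 (by omega)
  have hV0' : lapB b u X = _ := hV0
  have hV1 := hV 1 (by omega)
  have hV2 := hV 2 (by omega)
  have hV3 := hV 3 (by omega)
  have hW0 := hW 0 (by omega)
  have hW1 := hW 1 (by omega)
  simp only [flux, bdryForm', targetForm, greenForm, h1]
  norm_num at hV0 hV0' hV1 hV2 hV3 hW0 hW1
  -- The symmetry rewrites bring every `Gam` to one ordering of its arguments, so that equal terms
  -- are recognised.
  rw [hW0, hW1, hV0', hV0, hV1, hV2, hV3, Gam_comm (eulerPow k u 3) (eulerPow k u 1),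
    Gam_comm (eulerPow k u 2) (eulerPow k u 1), Gam_comm (eulerPow k u 1) (eulerPow k u 0),
    Gam_comm (eulerPow k u 2) (eulerPow k u 0),
    Gam_comm (eulerPow (k + 2) (lapB b u) 0) (eulerPow k u 2),
    Gam_comm (eulerPow (k + 2) (lapB b u) 0) (eulerPow k u 1),
    Gam_comm (eulerPow (k + 2) (lapB b u) 1) (eulerPow k u 1)]
  ring

/-- Green's identity needs order one on the left and order two on the right; from u of order five
this allows p_j with j ≤ 4 and j ≤ 3 respectively, and V_j with j ≤ 1. -/
lemma null_greenForm (hb : -1 < b) (hb1 : b < 1) (k α β : ℝ) {u : Space n → ℝ}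
    (hu : Cls (-b) 5 .even u) : Null b (greenForm b k α β u) := by
  have hσ : -1 < -b := by linarith
  have hp1 : ∀ j, j ≤ 4 → Cls (-b) 1 .any (eulerPow k u j) := fun j hj =>
    (Cls.eulerPow hσ k (hu.of_le hσ (by omega))).to_any hσ
  have hp2 : ∀ j, j ≤ 3 → Cls (-b) 2 .even (eulerPow k u j) := fun j hj =>
    Cls.eulerPow hσ k (hu.of_le hσ (by omega))
  have hv : Cls (-b) 3 .even (lapB b u) := hu.lapB hσ b
  have hV2 : ∀ j, j ≤ 1 → Cls (-b) 2 .even (eulerPow (k + 2) (lapB b u) j) := fun j hj =>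
    Cls.eulerPow hσ (k + 2) (hv.of_le hσ (by omega))
  have hV1 : ∀ j, j ≤ 1 → Cls (-b) 1 .any (eulerPow (k + 2) (lapB b u) j) := fun j hj =>
    ((hV2 j hj).of_succ hσ).to_any hσ
  have hpp : ∀ (c : ℝ) (i j : ℕ), i ≤ 4 → j ≤ 3 → Null b fun X => c *
      (eulerPow k u i X * SL b (eulerPow k u j) X + Gam (eulerPow k u i) (eulerPow k u j) X) :=
    fun c i j hi hj => (null_green hb hb1 (hp1 i hi) (hp2 j hj)).const_mul c
  have hpV : ∀ (c : ℝ) (i j : ℕ), i ≤ 4 → j ≤ 1 → Null b fun X => c *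
      (eulerPow k u i X * SL b (eulerPow (k + 2) (lapB b u) j) X +
        Gam (eulerPow k u i) (eulerPow (k + 2) (lapB b u) j) X) :=
    fun c i j hi hj => (null_green hb hb1 (hp1 i hi) (hV2 j hj)).const_mul c
  have hVp : ∀ (c : ℝ) (i j : ℕ), i ≤ 1 → j ≤ 3 → Null b fun X => c *
      (eulerPow (k + 2) (lapB b u) i X * SL b (eulerPow k u j) X +
        Gam (eulerPow (k + 2) (lapB b u) i) (eulerPow k u j) X) :=
    fun c i j hi hj => (null_green hb hb1 (hV1 i hi) (hp2 j hj)).const_mul c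
  exact (hpV _ 2 0 (by omega) (by omega)).add <| (hVp _ 0 2 (by omega) (by omega)).add <|
    (hpV _ 1 1 (by omega) (by omega)).add <| (hVp _ 1 1 (by omega) (by omega)).add <|
    (hpV _ 1 0 (by omega) (by omega)).add <| (hVp _ 0 1 (by omega) (by omega)).add <|
    (hpp _ 3 1 (by omega) (by omega)).add <| (hpp _ 2 1 (by omega) (by omega)).add <|
    (hpp _ 1 1 (by omega) (by omega)).add <| (hpp _ 2 2 (by omega) (by omega)).add <|
    (hpp _ 1 2 (by omega) (by omega)).add <| (hpp _ 0 2 (by omega) (by omega)).add <|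
    (hpp _ 0 1 (by omega) (by omega)).add <| (hpp _ 2 0 (by omega) (by omega)).add <|
    (hpp _ 1 3 (by omega) (by omega)).add <| hpp _ 1 0 (by omega) (by omega)

lemma integrable_weight_mul_hemi (hb : -1 < b) (hc : ContinuousOn f (upper n))
    (hf : LocBdd (rho (-b)) f) : IntegrableOn
      (fun ω : Metric.sphere (0 : Space n) 1 => ht (ω : Space n) ^ b * f (ω : Space n)) (hemi n)
      (surf n) :=
  integrableOn_hemi hb (ContinuousOn.mul (ContDiffOn.continuousOn (sm_ht_rpow (m := 0) b)) hc)
    hf.ht_rpow_mul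

lemma cls_targetForm (hσ : -1 < σ) (b k α β : ℝ) {u : Space n → ℝ} (hu : Cls σ 5 .even u) :
    Cls σ 1 .any (targetForm b k α β u) := by
  have hp : ∀ j, j ≤ 4 → Cls σ 1 .any (eulerPow k u j) := fun j hj =>
    (Cls.eulerPow hσ k (hu.of_le hσ (by omega))).to_any hσ
  have hG : ∀ j, j ≤ 3 → Cls σ 1 .any (Gam (eulerPow k u j) (eulerPow k u j)) :=
    fun j hj => Cls.Gam_any hσ
      ((Cls.eulerPow hσ k (hu.of_le hσ (by omega))).to_any hσ)
      ((Cls.eulerPow hσ k (hu.of_le hσ (by omega))).to_any hσ)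
  have hS : Cls σ 1 .any (SL b (eulerPow k u 1)) :=
    ((Cls.eulerPow (m := 3) hσ k (hu.of_le hσ (by omega))).SL hσ b).to_any hσ
  exact (((hp 3 (by omega)).mul_any (hp 3 (by omega))).const_mul _).add <|
    (((hp 2 (by omega)).mul_any (hp 2 (by omega))).const_mul _).add <|
    (((hp 1 (by omega)).mul_any (hp 1 (by omega))).const_mul _).add <|
    ((hG 2 (by omega)).const_mul _).add <|
    ((hG 1 (by omega)).const_mul _).add <| (hS.mul_any hS).const_mul _

/-- The Green terms integrate to zero, and in what remains every term other than the one in p_1² is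
nonnegative under the sign conditions and is dropped. -/
lemma le_integral_flux_add (hb : -1 < b) (hb1 : b < 1) (k : ℝ) {u : Space n → ℝ} (hs : Sm 6 u)
    (hu : Cls (-b) 5 .even u) {α β : ℝ} (hα : α = (n + b - 1) - 2 * k)
    (hβ : β = k * ((n + b - 1) - k)) (hα2 : 2 ≤ α) (hβ0 : 0 ≤ β)
    (hA : 0 ≤ 6 * β + 20 * α - 24 - α ^ 2) :
    (3 * β ^ 2 + 12 * (α - 2) * β + 8 * α * (α - 2)) *
        ∫ ω in hemi n, ht (ω : Space n) ^ b * (eulerPow k u 1 ω * eulerPow k u 1 ω) ∂(surf n) ≤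
      ∫ ω in hemi n, ht (ω : Space n) ^ b * (flux b k u ω + bdryForm' b k α β u ω) ∂(surf n) := by
  have hσ : -1 < -b := by linarith
  have hN := null_greenForm hb hb1 k α β hu
  have hT := cls_targetForm hσ b k α β hu
  have hTi := integrable_weight_mul_hemi hb hT.continuousOn (hT.locBdd_rho hσ)
  have hp : Cls (-b) 1 .any (eulerPow k u 1) :=
    (Cls.eulerPow hσ k (hu.of_le hσ (by omega))).to_any hσ
  have hpp := hp.mul_any hp
  have hpi := integrable_weight_mul_hemi hb hpp.continuousOn (hpp.locBdd_rho hσ)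
  have h1 : ∫ ω in hemi n, ht (ω : Space n) ^ b * (flux b k u ω + bdryForm' b k α β u ω) ∂(surf n) =
      ∫ ω in hemi n, ht (ω : Space n) ^ b * targetForm b k α β u ω ∂(surf n) := by
    rw [← add_zero (∫ ω in hemi n, ht (ω : Space n) ^ b * targetForm b k α β u ω ∂(surf n)),
      ← hN.2, ← integral_add hTi hN.1]
    refine setIntegral_congr_fun measurableSet_hemi fun ω hω => ?_
    rw [flux_add_bdryForm' b k hs hω (by simp) hα hβ]
    ring
  rw [h1, ← integral_const_mul]
  refine setIntegral_mono_on (hpi.const_mul _) hTi measurableSet_hemi fun ω hω => ?_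
  have hy : 0 ≤ ht (ω : Space n) ^ b := Real.rpow_nonneg (le_of_lt hω) b
  rw [mul_left_comm]
  refine mul_le_mul_of_nonneg_left ?_ hy
  simp only [targetForm]
  have e1 := Gam_self_nonneg (eulerPow k u 1) (ω : Space n)
  have e2 := Gam_self_nonneg (eulerPow k u 2) (ω : Space n)
  have e3 := mul_nonneg hA (mul_self_nonneg (eulerPow k u 2 (ω : Space n)))
  have e4 := mul_nonneg (by linarith : (0 : ℝ) ≤ 6 * β + 12 * (α - 2)) e1
  nlinarith [mul_self_nonneg (eulerPow k u 3 (ω : Space n)),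
    mul_self_nonneg (SL b (eulerPow k u 1) (ω : Space n))]

end LaneEmden

end

noncomputable section

namespace LaneEmden

variable {n : ℕ} {b σ : ℝ} {m : ℕ} {f g : Space n → ℝ}

/-! ### Differentiation of weighted integrals with respect to dilations -/

lemma aestronglyMeasurable_comp_of_continuousOn {Ω : Type*} [MeasurableSpace Ω] {μ : Measure Ω}
    {π : Ω → Space n} (hπ : Measurable π) (hμ : ∀ᵐ ω ∂μ, π ω ∈ upper n)
    (hf : ContinuousOn f (upper n)) : AEStronglyMeasurable (fun ω => f (π ω)) μ := by
  classical
  have h1 : Measurable ((upper n).piecewise f fun _ => 0) :=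
    hf.measurable_piecewise continuousOn_const measurableSet_upper
  refine (h1.comp hπ).aestronglyMeasurable.congr ?_
  filter_upwards [hμ] with ω hω
  exact piecewise_eq_of_mem _ _ _ hω

lemma hasDerivAt_comp_smul {X : Space n} {t : ℝ} (ht : t ≠ 0)
    (hf : DifferentiableAt ℝ f (t • X)) :
    HasDerivAt (fun s : ℝ => f (s • X)) (t⁻¹ * euler f (t • X)) t := by
  have h := hf.hasFDerivAt.comp_hasDerivAt t ((hasDerivAt_id t).smul_const X)
  convert! h using 1
  simp only [euler, one_smul, map_smul, smul_eq_mul]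
  field_simp

/-- Derivative at `t = 1` of `∫ y ^ b t ^ c f (t X)`. -/
theorem hasDerivAt_weighted_integral {Ω : Type*} [MeasurableSpace Ω] {μ : Measure Ω}
    {π : Ω → Space n} (hπ : Measurable π) (hμ : ∀ᵐ ω ∂μ, π ω ∈ upper n ∧ ‖π ω‖ ≤ 1)
    (hσ : -1 < -b) (hi : Integrable (fun ω => rho b (π ω)) μ) (c : ℝ)
    (hf : Cls (-b) 1 .any f) :
    Integrable (fun ω => ht (π ω) ^ b * (euler f (π ω) + c * f (π ω))) μ ∧
    HasDerivAt (fun t : ℝ => ∫ ω, ht (π ω) ^ b * (t ^ c * f (t • π ω)) ∂μ)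
      (∫ ω, ht (π ω) ^ b * (euler f (π ω) + c * f (π ω)) ∂μ) 1 := by
  have hμ' : ∀ᵐ ω ∂μ, π ω ∈ upper n := hμ.mono fun _ h => h.1
  set g : Space n → ℝ := fun X => euler f X + c * f X with hg
  have hgc : Cls (-b) 0 .any g := (hf.euler hσ).add ((hf.of_succ hσ).const_mul c)
  obtain ⟨M, hM0, hM⟩ := (hf.locBdd_rho hσ).hemi_bound
  obtain ⟨M', hM0', hM'⟩ := hgc.2.hemi_bound
  -- Bounds t^(c-1) for t in [1/2, 2], whatever the sign of c - 1.
  set K : ℝ := (1 / 2) ^ (c - 1) + 2 ^ (c - 1) with hK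
  have hK0 : 0 ≤ K := by positivity
  have hcont : ∀ {h : Space n → ℝ}, ContinuousOn h (upper n) → ∀ {t : ℝ}, 0 < t →
      AEStronglyMeasurable (fun ω => ht (π ω) ^ b * (h (t • π ω))) μ := fun {h} hh {t} ht0 =>
    aestronglyMeasurable_comp_of_continuousOn (f := fun X => ht X ^ b * h (t • X)) hπ hμ'
      ((ContDiffOn.continuousOn (sm_ht_rpow (m := 0) b)).mul
        (hh.comp (by fun_prop) fun X hX => (smul_mem_upper_iff ht0).2 hX))
  have hrho : ∀ X ∈ upper n, ht X ^ b * rho (-b) X = rho b X := fun X hX => by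
    have hy : 0 < ht X := hX
    have := Real.rpow_pos_of_pos hy b
    rw [rho, rho, Real.rpow_neg hy.le]
    field_simp
    ring
  have h12 : Ioo (1 / 2 : ℝ) 2 ∈ 𝓝 (1 : ℝ) := Ioo_mem_nhds (by norm_num) (by norm_num)
  have key := hasDerivAt_integral_of_dominated_loc_of_deriv_le (μ := μ) (𝕜 := ℝ)
    (F := fun t ω => ht (π ω) ^ b * (t ^ c * f (t • π ω)))
    (F' := fun t ω => ht (π ω) ^ b * (t ^ (c - 1) * g (t • π ω)))
    (bound := fun ω => K * M' * rho b (π ω)) (x₀ := (1 : ℝ)) (s := Ioo (1 / 2) 2) h12 ?_ ?_ ?_ ?_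
    (hi.const_mul _) ?_
  · simpa [hg] using key
  · filter_upwards [h12] with t ht0
    have : 0 < t := by linarith [ht0.1]
    simp only [mul_left_comm _ (t ^ c)]
    exact (hcont hf.continuousOn this).const_mul _
  · simp only [Real.one_rpow, one_mul]
    refine Integrable.mono' (hi.const_mul M) (hcont hf.continuousOn one_pos) ?_
    filter_upwards [hμ] with ω hω
    have hp := Real.rpow_nonneg (le_of_lt hω.1) b
    rw [Real.norm_eq_abs, abs_mul, abs_of_nonneg hp, ← hrho _ hω.1, mul_left_comm]
    exact mul_le_mul_of_nonneg_left (hM 1 (by norm_num) (by norm_num) _ hω.1 hω.2) hp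
  · simp only [Real.one_rpow, one_mul]
    exact hcont hgc.1 one_pos
  · filter_upwards [hμ] with ω hω t ht0
    have ht1 : 0 < t := by linarith [ht0.1]
    have hp := Real.rpow_nonneg (le_of_lt hω.1) b
    have h1 := hM' t ht0.1.le ht0.2.le _ hω.1 hω.2
    have h2 : t ^ (c - 1) ≤ K := rpow_le_of_mem_Icc (by norm_num) ht0.1.le ht0.2.le
    have h3 := Real.rpow_nonneg ht1.le (c - 1)
    rw [Real.norm_eq_abs, abs_mul, abs_mul, abs_of_nonneg hp, abs_of_nonneg h3, ← hrho _ hω.1]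
    calc _ ≤ ht (π ω) ^ b * (K * (M' * rho (-b) (π ω))) :=
          mul_le_mul_of_nonneg_left (mul_le_mul h2 h1 (abs_nonneg _) hK0) hp
      _ = _ := by ring
  · filter_upwards [hμ] with ω hω t ht0
    have ht1 : 0 < t := by linarith [ht0.1]
    have h1 := hasDerivAt_comp_smul ht1.ne'
      (hf.differentiableAt ((smul_mem_upper_iff ht1).2 hω.1))
    convert! ((Real.hasDerivAt_rpow_const (p := c) (Or.inl ht1.ne')).mul h1).const_mul
      (ht (π ω) ^ b) using 1
    rw [hg, Real.rpow_sub_one ht1.ne']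
    simp only
    field_simp
    ring

/-! ### Boundary values -/

/-- The limit of `f (x, y)` as `y → 0`. -/
def bdryVal (f : Space n → ℝ) (x : EuclideanSpace ℝ (Fin n)) : ℝ :=
  limUnder (𝓝[>] 0) fun y => f (lift x y)

lemma vscale_lift (s : ℝ) (x : EuclideanSpace ℝ (Fin n)) (y : ℝ) :
    vscale s (lift x y) = lift x (s * y) := by
  ext i
  refine Fin.lastCases ?_ (fun i => ?_) i
  · rw [vscale_last, lift_last, lift_last]
  · rw [vscale_of_ne _ _ (Fin.castSucc_lt_last i).ne, lift_castSucc, lift_castSucc]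

lemma Cls.tendsto_bdryVal (hσ : -1 < σ) (hf : Cls σ 1 .any f) (x : EuclideanSpace ℝ (Fin n)) :
    Tendsto (fun y => f (lift x y)) (𝓝[>] 0) (𝓝 (bdryVal f x)) := by
  obtain ⟨a, ha⟩ := exists_tendsto_slice hσ hf (lift_mem_upper x one_pos)
  simp only [vscale_lift, mul_one] at ha
  exact tendsto_nhds_limUnder ⟨a, ha⟩

/-- A quantitative form of the existence of the trace, uniform on bounded sets, got by letting s → 0
in `abs_sub_vscale_le`. -/
lemma Cls.abs_sub_bdryVal_le (hσ : -1 < σ) (hf : Cls σ 1 .any f) (R : ℝ) :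
    ∃ M : ℝ, 0 ≤ M ∧ ∀ x : EuclideanSpace ℝ (Fin n), ∀ y : ℝ, 0 < y → ‖lift x y‖ ≤ R →
      |f (lift x y) - bdryVal f x| ≤ M * (y + y ^ (σ + 1)) := by
  obtain ⟨M, hM, H⟩ := (hf.2.2 (Fin.last n)).2 R
  have h0 : 0 < σ + 1 := by linarith
  refine ⟨M * (1 + 1 / (σ + 1)), by positivity, fun x y hy hR => ?_⟩
  have hX := lift_mem_upper x hy
  have h1 : Tendsto (fun s : ℝ => s * y) (𝓝[>] 0) (𝓝[>] 0) := by
    refine tendsto_nhdsWithin_iff.2 ⟨?_, ?_⟩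
    · have : Tendsto (fun s : ℝ => s * y) (𝓝 0) (𝓝 (0 * y)) := tendsto_id.mul_const y
      rw [zero_mul] at this
      exact this.mono_left nhdsWithin_le_nhds
    · filter_upwards [self_mem_nhdsWithin] with s hs using mul_pos hs hy
  have h2 : Tendsto (fun s : ℝ => |f (lift x y) - f (vscale s (lift x y))|) (𝓝[>] 0)
      (𝓝 |f (lift x y) - bdryVal f x|) := by
    simp only [vscale_lift]
    exact (tendsto_const_nhds.sub ((hf.tendsto_bdryVal hσ x).comp h1)).abs
  have h3 : y + y ^ (σ + 1) = ht (lift x y) * rho σ (lift x y) := by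
    rw [rho, ht_lift, Real.rpow_add_one hy.ne']; ring
  rw [h3]
  refine le_of_tendsto h2 ?_
  filter_upwards [Ioc_mem_nhdsGT (zero_lt_one' ℝ)] with s hs
  exact abs_sub_vscale_le hσ hf.1 hM H hX hR hs

lemma norm_lift_le (x : EuclideanSpace ℝ (Fin n)) {y : ℝ} (hy : 0 ≤ y) :
    ‖lift x y‖ ≤ ‖x‖ + y := by
  refine (pow_le_pow_iff_left₀ (norm_nonneg _) (by positivity) two_ne_zero).1 ?_
  rw [norm_sq_lift]
  nlinarith [norm_nonneg x]

lemma tendsto_add_rpow_zero (hσ : -1 < σ) (M : ℝ) :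
    Tendsto (fun y : ℝ => M * (y + y ^ (σ + 1))) (𝓝[>] 0) (𝓝 0) := by
  have h0 : 0 < σ + 1 := by linarith
  have h1 : Tendsto (fun y : ℝ => M * (y + y ^ (σ + 1))) (𝓝 0) (𝓝 (M * (0 + 0 ^ (σ + 1)))) :=
    (tendsto_id.add ((Real.continuousAt_rpow_const 0 (σ + 1) (Or.inr h0.le)).tendsto)).const_mul M
  rw [Real.zero_rpow h0.ne', add_zero, mul_zero] at h1
  exact h1.mono_left nhdsWithin_le_nhds

lemma Cls.tendstoUniformlyOn_bdryVal (hσ : -1 < σ) (hf : Cls σ 1 .any f) (R : ℝ) :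
    TendstoUniformlyOn (fun y x => f (lift x y)) (bdryVal f) (𝓝[>] 0) (Metric.ball 0 R) := by
  obtain ⟨M, hM, H⟩ := hf.abs_sub_bdryVal_le hσ (R + 1)
  refine Metric.tendstoUniformlyOn_iff.2 fun ε hε => ?_
  filter_upwards [Ioc_mem_nhdsGT (zero_lt_one' ℝ),
    (tendsto_add_rpow_zero hσ M).eventually (gt_mem_nhds hε)] with y hy h x hx
  rw [dist_comm, Real.dist_eq]
  refine (H x y hy.1 ((norm_lift_le x hy.1.le).trans ?_)).trans_lt h
  have : ‖x‖ < R := by simpa using hx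
  linarith [hy.2]

/-- The trace is a locally uniform limit of the continuous functions x ↦ f(x, y). -/
lemma Cls.continuous_bdryVal (hσ : -1 < σ) (hf : Cls σ 1 .any f) : Continuous (bdryVal f) := by
  refine continuous_iff_continuousAt.2 fun x => ?_
  have hU := hf.tendstoUniformlyOn_bdryVal hσ (‖x‖ + 1)
  have hc : ContinuousOn (bdryVal f) (Metric.ball 0 (‖x‖ + 1)) := by
    refine hU.continuousOn (Eventually.frequently ?_)
    filter_upwards [self_mem_nhdsWithin] with y hy
    exact (hf.continuousOn.comp_continuous
      (continuous_lift.comp (by fun_prop : Continuous fun x => (x, y)))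
      fun x => lift_mem_upper x hy).continuousOn
  exact hc.continuousAt (Metric.isOpen_ball.mem_nhds (by simp))

lemma bdryVal_eq {f : Space n → ℝ} (hc : ContinuousOn f {X | 0 ≤ ht X})
    (x : EuclideanSpace ℝ (Fin n)) : bdryVal f x = f (bdry x) := by
  refine Tendsto.limUnder_eq ?_
  have h1 : Tendsto (fun y : ℝ => lift x y) (𝓝[>] 0) (𝓝[{X | 0 ≤ ht X}] bdry x) := by
    refine tendsto_nhdsWithin_iff.2 ⟨?_, ?_⟩
    · have h : Tendsto (fun y : ℝ => lift x y) (𝓝 0) (𝓝 (lift x 0)) :=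
        (continuous_lift.comp (by fun_prop : Continuous fun y : ℝ => (x, y))).tendsto 0
      rw [show lift x 0 = bdry x by simp [lift]] at h
      exact h.mono_left nhdsWithin_le_nhds
    · filter_upwards [self_mem_nhdsWithin] with y hy
      rw [ht_lift]
      exact le_of_lt hy
  exact (hc (bdry x) (by change 0 ≤ ht _; rw [ht, bdry_last])).tendsto.comp h1

lemma smul_lift (t : ℝ) (x : EuclideanSpace ℝ (Fin n)) (y : ℝ) :
    t • lift x y = lift (t • x) (t * y) := by
  ext i
  refine Fin.lastCases ?_ (fun i => ?_) i
  · simp [lift_last]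
  · simp [lift_castSucc]

/-- The derivatives of s ↦ f(s(x, y)) are s⁻¹ Ef(s(x, y)); Ef is still of order one, so they
converge uniformly in s as y → 0 and the limit may be differentiated. -/
lemma Cls.hasDerivAt_bdryVal (hσ : -1 < σ) (hf : Cls σ 2 .any f) (x : EuclideanSpace ℝ (Fin n))
    {t : ℝ} (ht0 : 0 < t) :
    HasDerivAt (fun s : ℝ => bdryVal f (s • x)) (t⁻¹ * bdryVal (LaneEmden.euler f) (t • x)) t := by
  have he : Cls σ 1 .any (LaneEmden.euler f) := hf.euler hσ
  have hf1 : Cls σ 1 .any f := hf.of_succ hσ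
  -- This radius contains s(x, y) for all s < 2t and y ≤ 1.
  obtain ⟨M, hM, H⟩ := he.abs_sub_bdryVal_le hσ (2 * t * (‖x‖ + 1))
  have hty : ∀ {s : ℝ}, 0 < s → Tendsto (fun y : ℝ => s * y) (𝓝[>] 0) (𝓝[>] 0) := fun {s} hs => by
    refine tendsto_nhdsWithin_iff.2 ⟨?_, ?_⟩
    · have : Tendsto (fun y : ℝ => s * y) (𝓝 0) (𝓝 (s * 0)) := tendsto_id.const_mul s
      rw [mul_zero] at this
      exact this.mono_left nhdsWithin_le_nhds
    · filter_upwards [self_mem_nhdsWithin] with y hy using mul_pos hs hy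
  refine hasDerivAt_of_tendstoUniformlyOn (l := 𝓝[>] (0 : ℝ)) (s := Ioo (t / 2) (2 * t)) isOpen_Ioo
    (f := fun y s => f (s • lift x y)) (g' := fun s => s⁻¹ * bdryVal (LaneEmden.euler f) (s • x))
    (f' := fun y s => s⁻¹ * LaneEmden.euler f (s • lift x y)) ?_ ?_ ?_
    ⟨by linarith, by linarith⟩
  · refine Metric.tendstoUniformlyOn_iff.2 fun ε hε => ?_
    have h2t : Tendsto (fun y : ℝ => (t / 2)⁻¹ * (M * (2 * t * y + (2 * t * y) ^ (σ + 1)))) (𝓝[>] 0)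
        (𝓝 ((t / 2)⁻¹ * 0)) :=
      ((tendsto_add_rpow_zero hσ M).comp (hty (by linarith : 0 < 2 * t))).const_mul _
    rw [mul_zero] at h2t
    filter_upwards [Ioc_mem_nhdsGT (zero_lt_one' ℝ), h2t.eventually (gt_mem_nhds hε)]
      with y hy h s hs
    have hs0 : 0 < s := by linarith [hs.1]
    refine lt_of_le_of_lt ?_ h
    rw [dist_comm, Real.dist_eq, ← mul_sub, abs_mul, abs_of_pos (inv_pos.2 hs0), smul_lift]
    have h1 := H (s • x) (s * y) (mul_pos hs0 hy.1) (by
      refine (norm_lift_le _ (mul_pos hs0 hy.1).le).trans ?_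
      rw [norm_smul, Real.norm_eq_abs, abs_of_pos hs0, ← mul_add]
      exact mul_le_mul hs.2.le (by linarith [hy.2]) (by have := hy.1; positivity) (by linarith))
    refine mul_le_mul (inv_anti₀ (by linarith) hs.1.le) (h1.trans ?_) (abs_nonneg _)
      (by positivity)
    have hsy : s * y ≤ 2 * t * y := mul_le_mul_of_nonneg_right hs.2.le hy.1.le
    exact mul_le_mul_of_nonneg_left (add_le_add hsy
      (Real.rpow_le_rpow (mul_pos hs0 hy.1).le hsy (by linarith))) hM
  · filter_upwards [self_mem_nhdsWithin] with y hy s hs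
    have hs0 : 0 < s := by linarith [hs.1]
    exact hasDerivAt_comp_smul hs0.ne'
      (hf.differentiableAt ((smul_mem_upper_iff hs0).2 (lift_mem_upper x hy)))
  · intro s hs
    have hs0 : 0 < s := by linarith [hs.1]
    simp only [smul_lift]
    exact (hf1.tendsto_bdryVal hσ (s • x)).comp (hty hs0)

end LaneEmden

end

noncomputable section

namespace LaneEmden

variable {n : ℕ} {b k p κ : ℝ} {u : Space n → ℝ}

/-! ### The derivative of the energy at scale one -/

/-- Solutions of the extended problem which are regular up to the boundary. -/
structure RegularSolution (b p κ : ℝ) (u : Space n → ℝ) : Prop where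
  cls : Cls (-b) 5 .even u
  sm : Sm 6 u
  cont : ContinuousOn u {X | 0 ≤ ht X}
  eqn : ∀ X ∈ upper n, lapB b (lapB b (lapB b u)) X = 0
  bdry : ∀ x : EuclideanSpace ℝ (Fin n),
    Tendsto (fun X => ht X ^ b * pd (Fin.last n) (lapB b (lapB b u)) X) (𝓝[upper n] bdry x)
      (𝓝 (-κ * (|u (LaneEmden.bdry x)| ^ (p - 1) * u (LaneEmden.bdry x))))

lemma bdry_base {X : Space n} (hX : ht X = 0) : bdry (base X) = X := by
  ext i
  refine Fin.lastCases ?_ (fun i => ?_) i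
  · rw [bdry_last]; exact hX.symm
  · rw [bdry_castSucc]; rfl

/-- A function with a finite limit at each point of the closed half-space is locally bounded there;
compactness of closed half-balls makes the bound uniform. -/
lemma locBdd_of_tendsto_bdry {G : Space n → ℝ} (hG : ContinuousOn G (upper n))
    (h : ∀ x, ∃ L, Tendsto G (𝓝[upper n] bdry x) (𝓝 L)) : LocBdd (fun _ => 1) G := by
  intro R
  have hK : IsCompact (Metric.closedBall (0 : Space n) R ∩ {X | 0 ≤ ht X}) :=
    (isCompact_closedBall _ _).inter_right (isClosed_le continuous_const continuous_ht)
  have key : ∃ M : ℝ, 0 ≤ M ∧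
      ∀ Y ∈ Metric.closedBall (0 : Space n) R ∩ {X | 0 ≤ ht X}, Y ∈ upper n → |G Y| ≤ M := by
    refine hK.induction_on (p := fun s => ∃ M : ℝ, 0 ≤ M ∧ ∀ Y ∈ s, Y ∈ upper n → |G Y| ≤ M)
      ⟨0, le_rfl, by simp⟩ ?_ ?_ ?_
    · rintro s t hst ⟨M, hM, H⟩
      exact ⟨M, hM, fun Y hY => H Y (hst hY)⟩
    · rintro s t ⟨M, hM, H⟩ ⟨M', hM', H'⟩
      refine ⟨M + M', by linarith, fun Y hY hu => ?_⟩
      rcases hY with hY | hY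
      · linarith [H Y hY hu]
      · linarith [H' Y hY hu]
    · rintro X ⟨-, hX⟩
      have hlim : ∃ L, Tendsto G (𝓝[upper n] X) (𝓝 L) := by
        rcases (show 0 ≤ ht X from hX).eq_or_lt with h0 | h0
        · obtain ⟨L, hL⟩ := h (base X)
          rw [bdry_base h0.symm] at hL
          exact ⟨L, hL⟩
        · exact ⟨G X, hG X h0⟩
      obtain ⟨L, hL⟩ := hlim
      have h1 : ∀ᶠ Y in 𝓝[upper n] X, |G Y| ≤ |L| + 1 :=
        hL.abs.eventually_le_const (by linarith)
      obtain ⟨t, ht1, ht2⟩ := (eventually_nhdsWithin_iff.1 h1).exists_mem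
      exact ⟨t, mem_nhdsWithin_of_mem_nhds ht1, |L| + 1, by positivity, fun Y hY hu => ht2 Y hY hu⟩
  obtain ⟨M, hM, H⟩ := key
  exact ⟨M, hM, fun X hX hR => by
    rw [mul_one]
    exact H X ⟨by simpa using hR, (le_of_lt (show 0 < ht X from hX) : 0 ≤ ht X)⟩ hX⟩

lemma tendsto_lift_bdry (x : EuclideanSpace ℝ (Fin n)) :
    Tendsto (fun y : ℝ => lift x y) (𝓝[>] 0) (𝓝[upper n] bdry x) := by
  refine tendsto_nhdsWithin_iff.2 ⟨?_, ?_⟩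
  · have h : Tendsto (fun y : ℝ => lift x y) (𝓝 0) (𝓝 (lift x 0)) :=
      (continuous_lift.comp (by fun_prop : Continuous fun y : ℝ => (x, y))).tendsto 0
    rw [show lift x 0 = bdry x by simp [lift]] at h
    exact h.mono_left nhdsWithin_le_nhds
  · filter_upwards [self_mem_nhdsWithin] with y hy using lift_mem_upper x hy

lemma RegularSolution.continuous_trace (hu : RegularSolution b p κ u) :
    Continuous fun x => u (LaneEmden.bdry x) :=
  hu.cont.comp_continuous continuous_bdry fun x => by
    change 0 ≤ ht _
    rw [ht, bdry_last]

/-- The divergence theorem for the derivative of the bulk term. -/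
theorem RegularSolution.integral_bulk (hu : RegularSolution b p κ u) (hb : -1 < b) (hb1 : b < 1)
    (hp : 1 < p) (k : ℝ) :
    ∫ X in upper n ∩ Metric.ball 0 1, ht X ^ b *
        (∑ j, pd j (eulerPow (k + 2) (lapB b u) 1) X * pd j (lapB b u) X) =
      (∫ ω in hemi n, ht (ω : Space n) ^ b * flux b k u (ω : Space n) ∂(surf n)) -
      ∫ x in Metric.ball 0 1, bdryVal (eulerPow k u 1) x *
        (-κ * (|u (LaneEmden.bdry x)| ^ (p - 1) * u (LaneEmden.bdry x))) := by
  have hσ : -1 < -b := by linarith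
  have huc := hu.cls
  set q := eulerPow k u 1 with hq
  set v := lapB b u with hv
  set w := lapB b v with hw
  set V := eulerPow (k + 2) v 1 with hV
  have hvc : Cls (-b) 3 .even v := huc.lapB hσ b
  have hwc : Cls (-b) 1 .even w := hvc.lapB hσ b
  have hqc : Cls (-b) 4 .even q := Cls.eulerPow (m := 4) (j := 1) hσ k huc
  have hVc : Cls (-b) 2 .even V := Cls.eulerPow (m := 2) (j := 1) hσ (k + 2) hvc
  have hvs : Sm 4 v := hu.sm.lapB b
  have hws : Sm 2 w := hvs.lapB b
  have hqs : Sm 5 q := Sm.eulerPow (m := 5) (j := 1) k hu.sm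
  have hVs : Sm 3 V := Sm.eulerPow (m := 3) (j := 1) (k + 2) hvs
  have hlq : EqOn (lapB b q) V (upper n) := lapB_eulerPow b k 1 (hu.sm.of_le (by omega))
  have hodd : ∀ {f : Space n → ℝ} {m : ℕ}, Cls (-b) (m + 2) .even f →
      LocBdd (Par.odd.wt (-b)) (pd (Fin.last n) f) := fun hf => by
    have := (hf.pderiv (Fin.last n)).2.1
    rwa [Par.at_last] at this
  have hb1v := (hVc.locBdd_one hσ).one_mul' (hodd (m := 1) hvc)
  have hb2 := (locBdd_const (-1)).one_mul' ((hwc.locBdd_one hσ).one_mul' (hodd (m := 2) hqc))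
  have hb12 := (hb1v.add hb2).ht_rpow_mul_odd
  -- For w the regularity class only yields y^b ∂_y w = O(1 + y^b), which is unbounded when b < 0;
  -- the boundary condition supplies the bound.
  have hb3 : LocBdd (fun _ => 1) fun X => ht X ^ b * pd (Fin.last n) w X :=
    locBdd_of_tendsto_bdry (((sm_ht_rpow (m := 1) b).mul (hws.pderiv _)).continuousOn)
      fun x => ⟨_, hu.bdry x⟩
  have hDs : Sm 0 fun X => ht X ^ b * ∑ j, pd j V X * pd j v X :=
    (sm_ht_rpow b).mul (Sm.sum _ fun j _ =>
      ((hVs.pderiv j).of_le (by omega)).mul ((hvs.pderiv j).of_le (by omega)))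
  have hDb : LocBdd (rho b) fun X => ht X ^ b * ∑ j, pd j V X * pd j v X :=
    LocBdd.ht_rpow_mul <| LocBdd.sum _ (fun X hX => rho_nonneg _ hX) fun j _ =>
      ((hVc.pderiv j).locBdd_one hσ).one_mul' ((hvc.pderiv j).locBdd_rho hσ)
  have hfl : ∀ X, flux b k u X = V X * euler v X + ((-1) * (w X * euler q X) + q X * euler w X) := by
    intro X
    simp only [flux, hV, hq, hw, hv, eulerPow]
    ring
  have hΦb : LocBdd (rho b) fun X => ht X ^ b * flux b k u X := by
    refine LocBdd.ht_rpow_mul ?_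
    refine (((hVc.locBdd_one hσ).one_mul' ((hvc.euler hσ).locBdd_rho hσ)).add
      (((locBdd_const (-1)).one_mul' ((hwc.locBdd_one hσ).one_mul'
        ((hqc.euler hσ).locBdd_rho hσ))).add
        ((hqc.locBdd_one hσ).one_mul' (hwc.euler hσ).2))).congr fun X _ => (hfl X).symm
  have hΦs : Sm 0 fun X => ht X ^ b * flux b k u X := by
    have : flux b k u =
        fun X => V X * euler v X + ((-1) * (w X * euler q X) + q X * euler w X) := funext hfl
    rw [this]
    exact (sm_ht_rpow b).mul (((hVs.of_le (by omega)).mul (hvs.euler.of_le (by omega))).add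
      ((((hws.of_le (by omega)).mul (hqs.euler.of_le (by omega))).const_mul _).add
        ((hqs.of_le (by omega)).mul (hws.euler.of_le (by omega)))))
  -- The field is y^b (V∇v - w∇q + q∇w). In its weighted divergence the terms in ∇q·∇w cancel, VΔ_b
  -- v = Vw cancels wΔ_b q = wV, and Δ_b w = 0, so ∇V·∇v is left. Its radial component is y^b times
  -- `flux`.
  refine integral_divergence_halfBall hb
    (F := fun j X => ht X ^ b * (V X * pd j v X + ((-1) * (w X * pd j q X) + q X * pd j w X)))
    (D := fun X => ht X ^ b * ∑ j, pd j V X * pd j v X)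
    (Φ := fun X => ht X ^ b * flux b k u X) ?_ ?_ hDs.continuousOn hDb ?_ hΦs.continuousOn hΦb
    ?_ ?_ ?_
  · intro j
    have : Sm 1 fun X => ht X ^ b * (V X * pd j v X + ((-1) * (w X * pd j q X) + q X * pd j w X)) :=
      (sm_ht_rpow b).mul (((hVs.of_le (by omega)).mul ((hvs.pderiv j).of_le (by omega))).add
        ((((hws.of_le (by omega)).mul ((hqs.pderiv j).of_le (by omega))).const_mul _).add
          ((hqs.of_le (by omega)).mul (hws.pderiv j))))
    exact this.differentiableOn (by norm_num)
  · intro X hX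
    have hy : ht X ≠ 0 := ne_of_gt hX
    have d1 := hVs.diff hX
    have d2 := hvs.diff hX
    have d3 := hws.diff hX
    have d4 := hqs.diff hX
    have d2j := fun j => (hvs.pderiv j).diff hX
    have d3j := fun j => (hws.pderiv j).diff hX
    have d4j := fun j => (hqs.pderiv j).diff hX
    have h1 : ∀ j, pd j (fun X => ht X ^ b *
        (V X * pd j v X + ((-1) * (w X * pd j q X) + q X * pd j w X))) X =
        ht X ^ b * (pd j V X * pd j v X) + ht X ^ b * (V X * pd j (pd j v) X -
          w X * pd j (pd j q) X + q X * pd j (pd j w) X) +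
        (if Fin.last n = j then ht X ^ b * (b / ht X) *
          (V X * pd j v X + ((-1) * (w X * pd j q X) + q X * pd j w X)) else 0) := fun j => by
      have e1 := d1.fun_mul (d2j j)
      have e2 := (d3.fun_mul (d4j j)).const_mul (-1)
      have e3 := d4.fun_mul (d3j j)
      rw [pd_mul (Sm.diff (m := 0) (sm_ht_rpow b) hX) (e1.fun_add (e2.fun_add e3)),
        pd_add e1 (e2.fun_add e3), pd_add e2 e3, pd_mul d1 (d2j j),
        pd_const_mul _ (d3.fun_mul (d4j j)), pd_mul d3 (d4j j), pd_mul d4 (d3j j),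
        pd_ht_rpow b j hX]
      split_ifs <;> ring
    simp only [h1, Finset.sum_add_distrib, Finset.sum_ite_eq, Finset.mem_univ, if_true,
      ← Finset.mul_sum, Finset.sum_sub_distrib]
    have l1 : w X = _ := lapB_eq_sum_pd (hvs.of_le (by omega : 2 ≤ 4)).two b hX
    have l2 := hlq hX
    rw [lapB_eq_sum_pd (hqs.of_le (by omega : 2 ≤ 5)).two b hX] at l2
    have l3 := hu.eqn X hX
    rw [lapB_eq_sum_pd hws.two b hX] at l3
    have l1' : ∑ j, pd j (pd j v) X = w X - b / ht X * pd (Fin.last n) v X := by rw [l1]; ring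
    have l2' : ∑ j, pd j (pd j q) X = V X - b / ht X * pd (Fin.last n) q X := by rw [← l2]; ring
    have l3' : ∑ j, pd j (pd j w) X = - (b / ht X * pd (Fin.last n) w X) :=
      eq_neg_of_add_eq_zero_left l3
    rw [l1', l2', l3']
    ring
  · intro X hX
    simp only
    rw [hfl, euler_eq_sum v, euler_eq_sum q, euler_eq_sum w]
    simp only [Finset.mul_sum, ← Finset.sum_add_distrib]
    exact Finset.sum_congr rfl fun j _ => by ring
  · refine ((locBdd_one_of_odd_weight hb hb12).add
      ((hqc.locBdd_one hσ).one_mul' hb3)).congr fun X _ => ?_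
    simp only
    ring
  · exact ((Cls.to_any hσ (hqc.of_le hσ (by omega : 1 ≤ 4))).continuous_bdryVal hσ).mul
      (continuous_const.mul ((hu.continuous_trace.abs.rpow_const
        fun _ => Or.inr (by linarith)).mul hu.continuous_trace))
  · intro x
    -- The terms with ∂_y v and ∂_y q are odd and vanish at the boundary; only q y^b ∂_y w has a
    -- limit, given by the nonlinear condition.
    have t1 := tendsto_lift_of_odd_weight hb hb12 x
    have t2 := ((Cls.to_any hσ (hqc.of_le hσ (by omega : 1 ≤ 4))).tendsto_bdryVal hσ x).mul
      ((hu.bdry x).comp (tendsto_lift_bdry x))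
    have t3 := t1.add t2
    rw [zero_add] at t3
    refine t3.congr fun y => ?_
    simp only [Function.comp]
    ring

lemma RegularSolution.hasDerivAt_trace_point (hu : RegularSolution b p κ u) (hb1 : b < 1) (k : ℝ)
    (x : EuclideanSpace ℝ (Fin n)) {t : ℝ} (ht0 : 0 < t) :
    HasDerivAt (fun t : ℝ => t ^ k * u (LaneEmden.bdry (t • x)))
      (t ^ (k - 1) * bdryVal (eulerPow k u 1) (t • x)) t := by
  have hσ : -1 < -b := by linarith
  have h2 : Cls (-b) 2 .any u := (hu.cls.of_le hσ (by omega)).to_any hσ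
  have he : Cls (-b) 1 .any (euler u) := h2.euler hσ
  have h1 := h2.hasDerivAt_bdryVal hσ x ht0
  have hq : bdryVal (eulerPow k u 1) (t • x) =
      bdryVal (euler u) (t • x) + k * u (LaneEmden.bdry (t • x)) := by
    rw [← bdryVal_eq hu.cont]
    exact ((he.tendsto_bdryVal hσ _).add
      (((h2.of_succ hσ).tendsto_bdryVal hσ _).const_mul k)).limUnder_eq
  simp only [bdryVal_eq hu.cont] at h1
  convert! (Real.hasDerivAt_rpow_const (p := k) (Or.inl ht0.ne')).mul h1 using 1
  rw [hq, Real.rpow_sub_one ht0.ne']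
  field_simp
  ring

lemma RegularSolution.hasDerivAt_trace (hu : RegularSolution b p κ u) (hb1 : b < 1) (hp : 1 < p)
    (k : ℝ) : HasDerivAt
      (fun t : ℝ => ∫ x in Metric.ball 0 1, |t ^ k * u (LaneEmden.bdry (t • x))| ^ (p + 1))
      (∫ x in Metric.ball 0 1, (p + 1) * (|u (LaneEmden.bdry x)| ^ (p - 1) *
        u (LaneEmden.bdry x) * bdryVal (eulerPow k u 1) x)) 1 := by
  have hσ : -1 < -b := by linarith
  have hqc : Cls (-b) 1 .any (eulerPow k u 1) :=
    (Cls.eulerPow (m := 1) (j := 1) hσ k (hu.cls.of_le hσ (by omega))).to_any hσ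
  have hq := hqc.continuous_bdryVal hσ
  have huc := hu.continuous_trace
  -- The t-derivative of the integrand, viewed as a continuous function of (t, x): its maximum over
  -- a compact set provides the dominating constant.
  set G : ℝ × EuclideanSpace ℝ (Fin n) → ℝ := fun z =>
    (p + 1) * |z.1 ^ k * u (LaneEmden.bdry (z.1 • z.2))| ^ (p + 1 - 2) *
      (z.1 ^ k * u (LaneEmden.bdry (z.1 • z.2))) *
      (z.1 ^ (k - 1) * bdryVal (eulerPow k u 1) (z.1 • z.2)) with hG
  have hsm : Continuous fun z : ℝ × EuclideanSpace ℝ (Fin n) => z.1 • z.2 := by fun_prop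
  have hzc : ∀ c : ℝ, ContinuousOn (fun z : ℝ × EuclideanSpace ℝ (Fin n) => z.1 ^ c)
      (Icc (1 / 2) 2 ×ˢ Metric.closedBall 0 1) := fun c =>
    continuous_fst.continuousOn.rpow_const fun z hz => Or.inl (by
      have : 1 / 2 ≤ z.1 := hz.1.1
      intro h; linarith)
  have hz1 := (hzc k).mul (huc.comp hsm).continuousOn
  have hGc : ContinuousOn G (Icc (1 / 2) 2 ×ˢ Metric.closedBall 0 1) :=
    ((continuousOn_const.mul (hz1.abs.rpow_const fun _ _ => Or.inr (by linarith))).mul hz1).mul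
      ((hzc (k - 1)).mul (hq.comp hsm).continuousOn)
  obtain ⟨M, hM⟩ := (isCompact_Icc.prod (isCompact_closedBall _ _)).exists_bound_of_continuousOn hGc
  have hmeas : ∀ t : ℝ, Continuous fun x : EuclideanSpace ℝ (Fin n) =>
      |t ^ k * u (LaneEmden.bdry (t • x))| ^ (p + 1) := fun t =>
    (continuous_const.mul (huc.comp (by fun_prop))).abs.rpow_const fun _ => Or.inr (by linarith)
  have hball : ∀ᵐ x ∂(volume.restrict (Metric.ball (0 : EuclideanSpace ℝ (Fin n)) 1)),
      x ∈ Metric.closedBall (0 : EuclideanSpace ℝ (Fin n)) 1 := by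
    filter_upwards [ae_restrict_mem measurableSet_ball] with x hx using
      Metric.ball_subset_closedBall hx
  have key := hasDerivAt_integral_of_dominated_loc_of_deriv_le
    (μ := volume.restrict (Metric.ball (0 : EuclideanSpace ℝ (Fin n)) 1)) (𝕜 := ℝ)
    (F := fun t x => |t ^ k * u (LaneEmden.bdry (t • x))| ^ (p + 1))
    (F' := fun t x => G (t, x)) (bound := fun _ => M) (x₀ := (1 : ℝ)) (s := Ioo (1 / 2) 2)
    (Ioo_mem_nhds (by norm_num) (by norm_num)) (.of_forall fun t => (hmeas t).aestronglyMeasurable)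
    (((hmeas 1).continuousOn.integrableOn_compact (isCompact_closedBall 0 1)).mono_set
      Metric.ball_subset_closedBall) ?_ ?_ (integrableOn_const (by simp [measure_ball_lt_top.ne])) ?_
  · convert! key.2 using 1
    refine integral_congr_ae (.of_forall fun x => ?_)
    simp only [hG, one_smul, Real.one_rpow, one_mul]
    rw [show p + 1 - 2 = p - 1 by ring]
    ring
  · have : ContinuousOn (fun x => G (1, x)) (Metric.closedBall 0 1) :=
      hGc.comp (by fun_prop) fun x hx => ⟨⟨by norm_num, by norm_num⟩, hx⟩
    exact (this.mono Metric.ball_subset_closedBall).aestronglyMeasurable measurableSet_ball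
  · filter_upwards [hball] with x hx t ht0
    exact hM (t, x) ⟨⟨ht0.1.le, ht0.2.le⟩, hx⟩
  · filter_upwards with x t ht0
    exact (hasDerivAt_abs_rpow _ (by linarith : 1 < p + 1)).comp t
      (hu.hasDerivAt_trace_point hb1 k x (by linarith [ht0.1]))

/-- The bulk density without the weight. -/
def bulkForm (b : ℝ) (u : Space n → ℝ) (X : Space n) : ℝ :=
  1 / 2 * ∑ j, pd j (lapB b u) X * pd j (lapB b u) X

/-- The energy of the rescaled function. -/
def scaledEnergy (b k p κ α β : ℝ) (u : Space n → ℝ) (t : ℝ) : ℝ :=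
  (∫ X in upper n ∩ Metric.ball 0 1, ht X ^ b * (t ^ (2 * k + 6) * bulkForm b u (t • X))) -
  κ / (p + 1) * (∫ x in Metric.ball 0 1, |t ^ k * u (bdry (t • x))| ^ (p + 1)) +
  ∫ ω in hemi n, ht (ω : Space n) ^ b *
    (t ^ (k + k) * bdryForm b k α β u (t • (ω : Space n))) ∂(surf n)

lemma Cls.bulkForm (hσ : -1 < -b) (hu : Cls (-b) 5 .even u) :
    Cls (-b) 1 .any (LaneEmden.bulkForm b u) := by
  have hv : Cls (-b) 3 .even (LaneEmden.lapB b u) := hu.lapB hσ b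
  refine Cls.const_mul (Cls.sum _ fun j _ => ?_) _
  have h1 : Cls (-b) 1 .any (LaneEmden.pd j (LaneEmden.lapB b u)) :=
    ((hv.pderiv j).of_succ hσ).to_any hσ
  exact h1.mul_any h1

/-- The operator ∂_j Δ_b lowers homogeneity by three, so ∂_j v goes with the shift k + 3 and its
square with 2k + 6; moreover ∂_j (E + k + 2) v = (E + k + 3) ∂_j v. -/
lemma euler_bulkForm (b k : ℝ) (hu : Sm 6 u) {X : Space n} (hX : X ∈ upper n) :
    euler (bulkForm b u) X + (2 * k + 6) * bulkForm b u X =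
      ∑ j, pd j (eulerPow (k + 2) (lapB b u) 1) X * pd j (lapB b u) X := by
  have hv : Sm 4 (lapB b u) := hu.lapB b
  have hd : ∀ j, DifferentiableAt ℝ (pd j (lapB b u)) X := fun j => (hv.pderiv j).diff hX
  have h1 : ∀ j, pd j (eulerPow (k + 2) (lapB b u) 1) X =
      pd j (lapB b u) X + euler (pd j (lapB b u)) X + (k + 2) * pd j (lapB b u) X := fun j => by
    change pd j (fun X => euler (lapB b u) X + (k + 2) * lapB b u X) X = _
    rw [pd_add (hv.euler.diff hX) ((hv.diff hX).const_mul _), pd_const_mul _ (hv.diff hX),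
      pd_euler (m := 2) hv j hX]
  have h2 : euler (bulkForm b u) X =
      1 / 2 * ∑ j, 2 * (euler (pd j (lapB b u)) X * pd j (lapB b u) X) := by
    change euler (fun X => 1 / 2 * ∑ j, pd j (lapB b u) X * pd j (lapB b u) X) X = _
    rw [euler_const_mul _ (DifferentiableAt.fun_sum fun j _ => (hd j).fun_mul (hd j)),
      euler_sum _ fun j _ => (hd j).fun_mul (hd j)]
    congr 1
    exact Finset.sum_congr rfl fun j _ => by rw [euler_mul (hd j) (hd j)]; ring
  rw [h2, bulkForm]
  simp only [h1, Finset.mul_sum, ← Finset.sum_add_distrib]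
  exact Finset.sum_congr rfl fun j _ => by ring

lemma ae_mem_halfBall : ∀ᵐ X ∂(volume.restrict (upper n ∩ Metric.ball (0 : Space n) 1)),
    X ∈ upper n ∧ ‖X‖ ≤ 1 := by
  filter_upwards [ae_restrict_mem (measurableSet_upper.inter measurableSet_ball)] with X hX
  exact ⟨hX.1, by simpa using (Metric.ball_subset_closedBall hX.2)⟩

lemma ae_mem_hemi : ∀ᵐ ω : Metric.sphere (0 : Space n) 1 ∂((surf n).restrict (hemi n)),
    (ω : Space n) ∈ upper n ∧ ‖(ω : Space n)‖ ≤ 1 := by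
  filter_upwards [ae_restrict_mem measurableSet_hemi] with ω hω using ⟨hω, by simp⟩

lemma integrable_rho_halfBall (hb : -1 < b) :
    Integrable (fun X : Space n => rho b X)
      (volume.restrict (upper n ∩ Metric.ball (0 : Space n) 1)) :=
  (integrableOn_rho hb 1).mono_set (inter_subset_inter_right _ Metric.ball_subset_closedBall)

/-- By the divergence theorem the bulk derivative is the flux plus κ ∫ |u|^(p-1) u p_1 over the flat
part, and the trace term contributes exactly the opposite. Only half-sphere integrals remain. -/
theorem RegularSolution.hasDerivAt_scaledEnergy (hu : RegularSolution b p κ u) (hb : -1 < b)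
    (hb1 : b < 1) (hp : 1 < p) (k α β : ℝ) :
    HasDerivAt (scaledEnergy b k p κ α β u)
      (∫ ω in hemi n, ht (ω : Space n) ^ b * (flux b k u ω + bdryForm' b k α β u ω) ∂(surf n)) 1 := by
  have hσ : -1 < -b := by linarith
  have h1 := hasDerivAt_weighted_integral measurable_id ae_mem_halfBall hσ
    (integrable_rho_halfBall hb) (2 * k + 6) (Cls.bulkForm hσ hu.cls)
  have h2 := hu.hasDerivAt_trace hb1 hp k
  have h3 := hasDerivAt_weighted_integral measurable_subtype_coe (ae_mem_hemi (n := n)) hσ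
    (integrableOn_hemi_rho hb) (k + k) (cls_bdryForm hσ b k α β hu.cls)
  have h4 := hu.integral_bulk hb hb1 hp k
  have hflux : IntegrableOn (fun ω : Metric.sphere (0 : Space n) 1 =>
      ht (ω : Space n) ^ b * flux b k u (ω : Space n)) (hemi n) (surf n) := by
    have hv : Cls (-b) 3 .even (lapB b u) := hu.cls.lapB hσ b
    have hw : Cls (-b) 1 .even (lapB b (lapB b u)) := hv.lapB hσ b
    have hp : ∀ j, j ≤ 4 → Cls (-b) 1 .any (eulerPow k u j) := fun j hj =>
      (Cls.eulerPow hσ k (hu.cls.of_le hσ (by omega))).to_any hσ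
    have hV : ∀ j, j ≤ 1 → Cls (-b) 1 .any (eulerPow (k + 2) (lapB b u) j) := fun j hj =>
      (Cls.eulerPow hσ (k + 2) (hv.of_le hσ (by omega))).to_any hσ
    have hW0 : Cls (-b) 1 .any (lapB b (lapB b u)) := hw.to_any hσ
    have hW1 : Cls (-b) 0 .any (eulerPow (k + 4) (lapB b (lapB b u)) 1) :=
      Cls.eulerPow (m := 0) (j := 1) hσ (k + 4) hW0
    have hA := (((hV 1 le_rfl).mul_any (((hV 1 le_rfl).add
      ((hV 0 (by omega)).const_mul (-(k + 2)))))).add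
      ((hW0.mul_any ((hp 2 (by omega)).add ((hp 1 (by omega)).const_mul (-k)))).const_mul (-1)))
    have hB : Cls (-b) 0 .any fun X =>
        eulerPow (k + 4) (lapB b (lapB b u)) 1 X + (-(k + 4)) * lapB b (lapB b u) X :=
      hW1.add ((hW0.of_succ hσ).const_mul _)
    refine (integrable_weight_mul_hemi hb
      (hA.continuousOn.add ((hp 1 (by omega)).continuousOn.mul hB.1))
      ((hA.locBdd_rho hσ).add (((hp 1 (by omega)).locBdd_one hσ).one_mul' hB.2))).congr_fun
      (fun ω _ => ?_) measurableSet_hemi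
    simp only [flux, eulerPow, Pi.add_apply, Pi.mul_apply]
    ring
  have h3' : ∫ ω in hemi n, ht (ω : Space n) ^ b * bdryForm' b k α β u ω ∂(surf n) =
      ∫ ω in hemi n, ht (ω : Space n) ^ b * (euler (bdryForm b k α β u) ω +
        (k + k) * bdryForm b k α β u ω) ∂(surf n) :=
    setIntegral_congr_fun measurableSet_hemi fun ω hω => by
      rw [← (shiftedEuler_bdryForm b k α β hu.sm).2 _ hω]
  have hbi : IntegrableOn (fun ω : Metric.sphere (0 : Space n) 1 =>
      ht (ω : Space n) ^ b * bdryForm' b k α β u (ω : Space n)) (hemi n) (surf n) :=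
    IntegrableOn.congr_fun h3.1 (fun ω hω => by
      rw [← (shiftedEuler_bdryForm b k α β hu.sm).2 _ hω]) measurableSet_hemi
  have h1' : ∫ X in upper n ∩ Metric.ball 0 1, ht X ^ b *
        (∑ j, pd j (eulerPow (k + 2) (lapB b u) 1) X * pd j (lapB b u) X) =
      ∫ X in upper n ∩ Metric.ball 0 1, ht X ^ b * (euler (bulkForm b u) X +
        (2 * k + 6) * bulkForm b u X) :=
    setIntegral_congr_fun (measurableSet_upper.inter measurableSet_ball) fun X hX => by
      rw [euler_bulkForm b k hu.sm hX.1]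
  have h := (h1.2.sub (h2.const_mul (κ / (p + 1)))).add h3.2
  simp only [id] at h
  convert! h using 1
  rw [← h3', ← h1', h4]
  simp only [mul_add]
  rw [integral_add hflux hbi]
  -- The factor p + 1 from differentiating |u|^(p+1) removes the denominator, so the two flat
  -- integrals match.
  have h5 : κ / (p + 1) * ∫ x in Metric.ball 0 1, (p + 1) * (|u (LaneEmden.bdry x)| ^ (p - 1) *
        u (LaneEmden.bdry x) * bdryVal (eulerPow k u 1) x) =
      - ∫ x in Metric.ball 0 1, bdryVal (eulerPow k u 1) x *
        (-κ * (|u (LaneEmden.bdry x)| ^ (p - 1) * u (LaneEmden.bdry x))) := by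
    rw [← integral_const_mul, ← integral_neg]
    refine integral_congr_ae (.of_forall fun x => ?_)
    have : p + 1 ≠ 0 := by linarith
    field_simp
  rw [h5]
  ring

end LaneEmden

end

noncomputable section

namespace LaneEmden

variable {n : ℕ} {b k p κ σ : ℝ} {m : ℕ} {f g u : Space n → ℝ}

/-! ### Dilations and translations -/

/-- The function `c f (l X)`. -/
def dilate (c l : ℝ) (f : Space n → ℝ) (X : Space n) : ℝ := c * f (l • X)

lemma fderiv_dilate (c l : ℝ) (f : Space n → ℝ) (X v : Space n) :
    fderiv ℝ (dilate c l f) X v = c * (l * fderiv ℝ f (l • X) v) := by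
  have h : dilate c l f = fun Y => c • (fun Z => f (l • Z)) Y := rfl
  rw [h, show (fun Y => c • (fun Z => f (l • Z)) Y) = c • (fun Z => f (l • Z)) from rfl,
    fderiv_const_smul_field, Pi.smul_apply, fderiv_comp_smul]
  simp

lemma pd_dilate (c l : ℝ) (f : Space n → ℝ) (j : Fin (n + 1)) :
    pd j (dilate c l f) = dilate (c * l) l (pd j f) := by
  funext X
  simp only [pd, fderiv_dilate, dilate, mul_assoc]

lemma euler_dilate (c l : ℝ) (f : Space n → ℝ) :
    euler (dilate c l f) = dilate c l (euler f) := by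
  funext X
  simp only [euler, fderiv_dilate, dilate, map_smul, smul_eq_mul]

lemma eulerPow_dilate (k c l : ℝ) (f : Space n → ℝ) (j : ℕ) :
    eulerPow k (dilate c l f) j = dilate c l (eulerPow k f j) := by
  induction j with
  | zero => rfl
  | succ j ih =>
    funext X
    simp only [eulerPow, ih, euler_dilate]
    simp only [dilate]
    ring

lemma Sm.dilate (hf : Sm m f) (c : ℝ) {l : ℝ} (hl : 0 < l) : Sm m (LaneEmden.dilate c l f) :=
  contDiffOn_const.mul (ContDiffOn.comp (t := upper n) (g := f) hf
    (contDiff_const_smul l).contDiffOn fun _ hX => (smul_mem_upper_iff hl).2 hX)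

lemma lapB_dilate (b c : ℝ) {l : ℝ} (hl : 0 < l) (hf : Sm (m + 2) f) :
    EqOn (lapB b (dilate c l f)) (dilate (c * l ^ 2) l (lapB b f)) (upper n) := fun X hX => by
  have hX' : l • X ∈ upper n := (smul_mem_upper_iff hl).2 hX
  have hy : ht X ≠ 0 := ne_of_gt hX
  rw [lapB_eq_sum_pd (hf.dilate c hl).two b hX, dilate, lapB_eq_sum_pd hf.two b hX']
  simp only [pd_dilate]
  simp only [dilate, ht_smul, ← Finset.mul_sum]
  field_simp

lemma SL_dilate (b c : ℝ) {l : ℝ} (hl : 0 < l) (hf : Sm (m + 2) f) :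
    EqOn (SL b (dilate c l f)) (dilate c l (SL b f)) (upper n) := fun X hX => by
  rw [SL, lapB_dilate b c hl hf hX, euler_dilate, euler_dilate]
  simp only [dilate, SL, norm_smul, Real.norm_eq_abs, abs_of_pos hl]
  ring

lemma Gam_dilate (c d l : ℝ) (f g : Space n → ℝ) (X : Space n) :
    Gam (dilate c l f) (dilate d l g) X = c * d * Gam f g (l • X) := by
  simp only [Gam, pd_dilate, euler_dilate]
  have : ∀ j, dilate (c * l) l (pd j f) X * dilate (d * l) l (pd j g) X =
      c * d * l ^ 2 * (pd j f (l • X) * pd j g (l • X)) := fun j => by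
    simp only [dilate]; ring
  simp only [this, ← Finset.mul_sum, norm_smul, mul_pow, Real.norm_eq_abs, sq_abs]
  simp only [dilate]
  ring

lemma LocBdd.comp_smul {w w' : Space n → ℝ} (hf : LocBdd w f) {l K : ℝ} (hl : 0 < l) (hK : 0 ≤ K)
    (hw : ∀ X ∈ upper n, w (l • X) ≤ K * w' X) : LocBdd w' fun X => f (l • X) := by
  intro R
  obtain ⟨M, hM, H⟩ := hf (l * R)
  refine ⟨M * K, by positivity, fun X hX hR => ?_⟩
  refine (H _ ((smul_mem_upper_iff hl).2 hX) ?_).trans ?_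
  · rw [norm_smul, Real.norm_eq_abs, abs_of_pos hl]
    exact mul_le_mul_of_nonneg_left hR hl.le
  · rw [mul_assoc]
    exact mul_le_mul_of_nonneg_left (hw X hX) hM

lemma rho_smul_le' (σ : ℝ) {l : ℝ} (hl : 0 < l) {X : Space n} (hX : X ∈ upper n) :
    rho σ (l • X) ≤ (1 + l ^ σ) * rho σ X := by
  have hy : 0 < ht X := hX
  rw [rho, rho, ht_smul, Real.mul_rpow hl.le hy.le]
  have h1 := Real.rpow_pos_of_pos hl σ
  have h2 := Real.rpow_pos_of_pos hy σ
  nlinarith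

lemma Cls.dilate {q : Par} (hf : Cls σ m q f) (c : ℝ) {l : ℝ} (hl : 0 < l) :
    Cls σ m q (LaneEmden.dilate c l f) := by
  have h1 : 0 ≤ 1 + l ^ σ := by positivity
  induction m generalizing q f c with
  | zero =>
    exact ⟨continuousOn_const.mul (hf.1.comp (by fun_prop)
      fun X hX => (smul_mem_upper_iff hl).2 hX),
      (locBdd_const c).one_mul' (hf.2.comp_smul hl h1 fun X hX => rho_smul_le' σ hl hX)⟩
  | succ m ih =>
    refine ⟨(differentiableOn_const c).mul (hf.1.comp (by fun_prop)
      fun X hX => (smul_mem_upper_iff hl).2 hX), (locBdd_const c).one_mul' ?_, fun j => ?_⟩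
    · refine hf.2.1.comp_smul hl (K := 1 + l * (1 + l ^ σ)) (by positivity) fun X hX => ?_
      have hy : 0 < ht X := hX
      have h3 := rho_smul_le' σ hl hX
      have h4 := rho_nonneg σ hX
      cases q
      · simp only [Par.wt]; nlinarith [mul_nonneg hl.le h1]
      · simp only [Par.wt]; nlinarith [mul_nonneg hl.le h1]
      · simp only [Par.wt, ht_smul]
        have := mul_le_mul_of_nonneg_left h3 (mul_pos hl hy).le
        nlinarith [mul_nonneg hy.le h4]
    · rw [pd_dilate]
      exact ih (hf.2.2 j) _

lemma lapB_lapB_dilate (b c : ℝ) {l : ℝ} (hl : 0 < l) (hf : Sm 4 f) :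
    EqOn (lapB b (lapB b (dilate c l f))) (dilate (c * l ^ 4) l (lapB b (lapB b f)))
      (upper n) := fun X hX => by
  rw [lapB_eqOn (lapB_dilate (m := 2) b c hl hf) b hX,
    lapB_dilate (m := 0) b _ hl (hf.lapB b) hX]
  simp only [dilate]
  ring

lemma smul_bdry (l : ℝ) (x : EuclideanSpace ℝ (Fin n)) : l • bdry x = bdry (l • x) := by
  have h := smul_lift l x 0
  simpa [lift] using h

lemma smul_mem_closedUpper {l : ℝ} (hl : 0 < l) {X : Space n} (hX : 0 ≤ ht X) :
    0 ≤ ht (l • X) := by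
  rw [ht_smul]; positivity

/-- The equation is linear and homogeneous; only the nonlinear condition fixes k. Its left side
scales like l^k l^(5-b) and its right side like l^(kp), whence k (p - 1) = 5 - b. -/
theorem RegularSolution.dilate (hu : RegularSolution b p κ u) {l : ℝ} (hl : 0 < l)
    (hk : k * (p - 1) = 5 - b) : RegularSolution b p κ (LaneEmden.dilate (l ^ k) l u) := by
  have hw : Sm 2 (lapB b (lapB b u)) := (hu.sm.lapB (m := 4) b).lapB b
  have h2 := lapB_lapB_dilate b (l ^ k) hl (hu.sm.of_le (by omega))
  refine ⟨hu.cls.dilate _ hl, hu.sm.dilate _ hl, ?_, fun X hX => ?_, fun x => ?_⟩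
  · exact continuousOn_const.mul (hu.cont.comp (by fun_prop)
      fun X hX => smul_mem_closedUpper hl hX)
  · rw [lapB_eqOn h2 b hX, lapB_dilate (m := 0) b _ hl hw hX, LaneEmden.dilate,
      hu.eqn _ ((smul_mem_upper_iff hl).2 hX), mul_zero]
  · have hmap : Tendsto (fun X : Space n => l • X) (𝓝[upper n] LaneEmden.bdry x)
        (𝓝[upper n] LaneEmden.bdry (l • x)) := by
      refine tendsto_nhdsWithin_iff.2 ⟨?_, ?_⟩
      · rw [← smul_bdry]
        exact (((continuous_const_smul l).tendsto _).mono_left nhdsWithin_le_nhds)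
      · filter_upwards [self_mem_nhdsWithin] with X hX using (smul_mem_upper_iff hl).2 hX
    have h3 := ((hu.bdry (l • x)).comp hmap).const_mul (l ^ k * l ^ (5 - b))
    have hlim : l ^ k * l ^ (5 - b) * (-κ * (|u (LaneEmden.bdry (l • x))| ^ (p - 1) *
        u (LaneEmden.bdry (l • x)))) = -κ * (|LaneEmden.dilate (l ^ k) l u (LaneEmden.bdry x)| ^
          (p - 1) * LaneEmden.dilate (l ^ k) l u (LaneEmden.bdry x)) := by
      simp only [LaneEmden.dilate, smul_bdry]
      rw [abs_mul, abs_of_pos (Real.rpow_pos_of_pos hl k),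
        Real.mul_rpow (Real.rpow_pos_of_pos hl k).le (abs_nonneg _), ← Real.rpow_mul hl.le, hk]
      ring
    rw [hlim] at h3
    refine h3.congr' ?_
    filter_upwards [self_mem_nhdsWithin] with X hX
    have hy : 0 < ht X := hX
    rw [pd_eqOn h2 _ hX, pd_dilate]
    simp only [Function.comp, LaneEmden.dilate, ht_smul]
    rw [Real.mul_rpow hl.le hy.le, Real.rpow_sub hl]
    have h5 : l ^ (5 : ℝ) = l ^ 5 := by norm_cast
    have := (Real.rpow_pos_of_pos hl b).ne'
    rw [h5]
    field_simp

lemma add_mem_upper_iff {a X : Space n} (ha : ht a = 0) : a + X ∈ upper n ↔ X ∈ upper n := by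
  change 0 < a (Fin.last n) + X (Fin.last n) ↔ 0 < X (Fin.last n)
  rw [show a (Fin.last n) = 0 from ha, zero_add]

/-- The function `f (a + X)`. -/
def translate (a : Space n) (f : Space n → ℝ) (X : Space n) : ℝ := f (a + X)

lemma pd_translate (a : Space n) (f : Space n → ℝ) (j : Fin (n + 1)) :
    pd j (translate a f) = translate a (pd j f) := by
  funext X
  have := pd_comp_add (f := f) a X j
  simp only [add_comm _ a] at this
  exact this

lemma ht_add {a X : Space n} (ha : ht a = 0) : ht (a + X) = ht X := by
  change a (Fin.last n) + X (Fin.last n) = X (Fin.last n)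
  rw [show a (Fin.last n) = 0 from ha, zero_add]

lemma Sm.translate (hf : Sm m f) {a : Space n} (ha : ht a = 0) :
    Sm m (LaneEmden.translate a f) :=
  ContDiffOn.comp (t := upper n) (g := f) hf (contDiff_const.add contDiff_id).contDiffOn
    fun _ hX => (add_mem_upper_iff ha).2 hX

lemma lapB_translate (b : ℝ) {a : Space n} (ha : ht a = 0) (hf : Sm (m + 2) f) :
    EqOn (lapB b (translate a f)) (translate a (lapB b f)) (upper n) := fun X hX => by
  rw [lapB_eq_sum_pd (hf.translate ha).two b hX, translate,
    lapB_eq_sum_pd hf.two b ((add_mem_upper_iff ha).2 hX)]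
  simp only [pd_translate]
  simp only [translate, ht_add ha]

lemma LocBdd.translate {w : Space n → ℝ} (hf : LocBdd w f) {a : Space n} (ha : ht a = 0)
    (hw : ∀ X, w (a + X) = w X) : LocBdd w (LaneEmden.translate a f) := by
  intro R
  obtain ⟨M, hM, H⟩ := hf (‖a‖ + R)
  refine ⟨M, hM, fun X hX hR => ?_⟩
  rw [← hw X]
  exact H _ ((add_mem_upper_iff ha).2 hX) ((norm_add_le _ _).trans (by linarith))

lemma Cls.translate {q : Par} (hf : Cls σ m q f) {a : Space n} (ha : ht a = 0) :
    Cls σ m q (LaneEmden.translate a f) := by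
  induction m generalizing q f with
  | zero =>
    exact ⟨hf.1.comp (by fun_prop) fun X hX => (add_mem_upper_iff ha).2 hX,
      hf.2.translate ha fun X => by simp only [rho, ht_add ha]⟩
  | succ m ih =>
    refine ⟨hf.1.comp (by fun_prop) fun X hX => (add_mem_upper_iff ha).2 hX,
      hf.2.1.translate ha fun X => ?_, fun j => ?_⟩
    · cases q <;> simp only [Par.wt, rho, ht_add ha]
    · rw [pd_translate]
      exact ih (hf.2.2 j)

lemma bdry_add (x y : EuclideanSpace ℝ (Fin n)) : bdry x + bdry y = bdry (x + y) := by
  ext i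
  refine Fin.lastCases ?_ (fun i => ?_) i
  · simp [bdry_last]
  · simp [bdry_castSucc]

theorem RegularSolution.translate (hu : RegularSolution b p κ u) (x₀ : EuclideanSpace ℝ (Fin n)) :
    RegularSolution b p κ (LaneEmden.translate (LaneEmden.bdry x₀) u) := by
  have ha : ht (LaneEmden.bdry x₀) = 0 := bdry_last x₀
  have hv : Sm 4 (lapB b u) := hu.sm.lapB b
  have hw : Sm 2 (lapB b (lapB b u)) := hv.lapB b
  have h1 := lapB_translate (m := 4) b ha hu.sm
  have h2 : EqOn (lapB b (lapB b (LaneEmden.translate (LaneEmden.bdry x₀) u)))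
      (LaneEmden.translate (LaneEmden.bdry x₀) (lapB b (lapB b u))) (upper n) := fun X hX => by
    rw [lapB_eqOn h1 b hX, lapB_translate (m := 2) b ha hv hX]
  refine ⟨hu.cls.translate ha, hu.sm.translate ha, ?_, fun X hX => ?_, fun x => ?_⟩
  · exact hu.cont.comp (by fun_prop) fun X hX => by
      change 0 ≤ ht _
      rw [ht_add ha]; exact hX
  · rw [lapB_eqOn h2 b hX, lapB_translate (m := 0) b ha hw hX]
    exact hu.eqn _ ((add_mem_upper_iff ha).2 hX)
  · have hmap : Tendsto (fun X : Space n => LaneEmden.bdry x₀ + X) (𝓝[upper n] LaneEmden.bdry x)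
        (𝓝[upper n] LaneEmden.bdry (x₀ + x)) := by
      refine tendsto_nhdsWithin_iff.2 ⟨?_, ?_⟩
      · rw [← bdry_add]
        exact (((continuous_const.add continuous_id).tendsto _).mono_left nhdsWithin_le_nhds)
      · filter_upwards [self_mem_nhdsWithin] with X hX using (add_mem_upper_iff ha).2 hX
    have h3 := (hu.bdry (x₀ + x)).comp hmap
    have hlim : LaneEmden.translate (LaneEmden.bdry x₀) u (LaneEmden.bdry x) =
        u (LaneEmden.bdry (x₀ + x)) := by rw [LaneEmden.translate, bdry_add]
    rw [hlim]
    refine h3.congr' ?_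
    filter_upwards [self_mem_nhdsWithin] with X hX
    rw [pd_eqOn h2 _ hX, pd_translate]
    simp only [Function.comp, LaneEmden.translate, ht_add ha]

theorem IsExtendedSolution.regularSolution {s : ℝ} (hs₂ : 2 < s) (hs₃ : s < 3)
    (hu : IsExtendedSolution n s p κ u) : RegularSolution (5 - 2 * s) p κ u := by
  refine ⟨?_, hu.contDiffOn, hu.continuousOn, hu.eqn, hu.bdry_two⟩
  rw [neg_sub]
  exact hu.cls hs₂ hs₃

/-! ### The energy as a functional of the rescaled function -/

/-- All operators in the form commute with dilations (|X|²Δ_b does, being homogeneous of degree 0),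
so only the square of the amplitude appears. -/
lemma bdryForm_dilate (b k α β c : ℝ) {l : ℝ} (hl : 0 < l) (hu : Sm 6 u) {X : Space n}
    (hX : X ∈ upper n) :
    bdryForm b k α β (dilate c l u) X = c ^ 2 * bdryForm b k α β u (l • X) := by
  have h1 : Sm 5 (eulerPow k u 1) := Sm.eulerPow (m := 5) (j := 1) k hu
  simp only [bdryForm, eulerPow_dilate, Gam_dilate]
  rw [show eulerPow k u 0 = u from rfl, SL_dilate (m := 4) b c hl hu hX,
    SL_dilate (m := 3) b c hl h1 hX, lapB_dilate (m := 4) b c hl hu hX]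
  simp only [dilate, norm_smul, Real.norm_eq_abs, abs_of_pos hl]
  ring

lemma bulkForm_dilate (b c : ℝ) {l : ℝ} (hl : 0 < l) (hu : Sm 6 u) {X : Space n}
    (hX : X ∈ upper n) : bulkForm b (dilate c l u) X = c ^ 2 * l ^ 6 * bulkForm b u (l • X) := by
  simp only [bulkForm, pd_eqOn (lapB_dilate (m := 4) b c hl hu) _ hX, pd_dilate]
  simp only [dilate]
  rw [mul_left_comm, Finset.mul_sum (a := c ^ 2 * l ^ 6)]
  congr 1
  exact Finset.sum_congr rfl fun j _ => by ring

/-- The energy at scale one. -/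
def unitEnergy (b k p κ α β : ℝ) (u : Space n → ℝ) : ℝ :=
  (∫ X in upper n ∩ Metric.ball 0 1, ht X ^ b * bulkForm b u X) -
  κ / (p + 1) * (∫ x in Metric.ball 0 1, |u (bdry x)| ^ (p + 1)) +
  ∫ ω in hemi n, ht (ω : Space n) ^ b * bdryForm b k α β u (ω : Space n) ∂(surf n)

lemma unitEnergy_dilate (b k p κ α β : ℝ) {l : ℝ} (hl : 0 < l) (hu : Sm 6 u) :
    unitEnergy b k p κ α β (dilate (l ^ k) l u) = scaledEnergy b k p κ α β u l := by
  have e1 : (l ^ k) ^ 2 = l ^ (k + k) := by rw [Real.rpow_add hl]; ring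
  have e2 : l ^ (2 * k + 6) = (l ^ k) ^ 2 * l ^ 6 := by
    rw [show (2 : ℝ) * k + 6 = (k + k) + (6 : ℕ) by push_cast; ring, Real.rpow_add hl,
      Real.rpow_natCast, e1]
  rw [unitEnergy, scaledEnergy]
  congr 1
  · congr 1
    · refine setIntegral_congr_fun (measurableSet_upper.inter measurableSet_ball) fun X hX => ?_
      rw [bulkForm_dilate b _ hl hu hX.1, e2]
    · simp only [dilate, smul_bdry]
  · refine setIntegral_congr_fun measurableSet_hemi fun ω hω => ?_
    rw [bdryForm_dilate b k α β _ hl hu hω, e1]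

end LaneEmden

end

noncomputable section

namespace LaneEmden

variable {n : ℕ} {b k s p κ : ℝ} {m : ℕ} {f g u : Space n → ℝ}

/-! ### Derivatives of the rescaled function in the scale -/

/-- `fallPow k f i` is the value of `λⁱ dⁱ/dλⁱ (λ ^ k f (λ X))` at `λ = 1`. -/
def fallPow (k : ℝ) (f : Space n → ℝ) : ℕ → Space n → ℝ
  | 0 => f
  | i + 1 => fun X => euler (fallPow k f i) X + (k - i) * fallPow k f i X

lemma fallPow_dilate (k c l : ℝ) (f : Space n → ℝ) (i : ℕ) :
    fallPow k (dilate c l f) i = dilate c l (fallPow k f i) := by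
  induction i with
  | zero => rfl
  | succ i ih =>
    funext X
    simp only [fallPow, ih, euler_dilate]
    simp only [dilate]
    ring

lemma Sm.fallPow (k : ℝ) {i : ℕ} (hf : Sm (m + i) f) : Sm m (LaneEmden.fallPow k f i) := by
  induction i generalizing m with
  | zero => exact hf
  | succ i ih =>
    have h : Sm (m + 1) (LaneEmden.fallPow k f i) := ih (by rwa [add_right_comm, add_assoc])
    exact h.euler.add ((h.of_le (Nat.le_succ m)).const_mul _)

lemma iteratedDeriv_rpow_mul_comp_smul (k : ℝ) (i : ℕ) (hf : Sm i f) {X : Space n}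
    (hX : X ∈ upper n) {t : ℝ} (ht : 0 < t) :
    iteratedDeriv i (fun r => r ^ k * f (r • X)) t = t ^ (k - i) * fallPow k f i (t • X) := by
  induction i generalizing t with
  | zero => simp [fallPow]
  | succ i ih =>
    have hev : iteratedDeriv i (fun r => r ^ k * f (r • X)) =ᶠ[𝓝 t]
        fun r => r ^ (k - i) * fallPow k f i (r • X) := by
      filter_upwards [lt_mem_nhds ht] with r hr
      exact ih (hf.of_le (Nat.le_succ i)) hr
    have hd := hasDerivAt_comp_smul ht.ne'
      ((Sm.fallPow (m := 1) k (i := i) (by rwa [add_comm])).diff ((smul_mem_upper_iff ht).2 hX))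
    rw [iteratedDeriv_succ, hev.deriv_eq,
      ((Real.hasDerivAt_rpow_const (p := k - i) (Or.inl ht.ne')).fun_mul hd).deriv]
    simp only [fallPow]
    rw [show k - ((i + 1 : ℕ) : ℝ) = k - i - 1 by push_cast; ring, Real.rpow_sub_one ht.ne']
    field_simp
    ring

lemma rescale_eq_dilate (s p : ℝ) (x₀ : EuclideanSpace ℝ (Fin n)) (u : Space n → ℝ) (l : ℝ) :
    rescale s p x₀ u l = dilate (l ^ (2 * s / (p - 1))) l (translate (bdry x₀) u) := rfl

lemma rescale_mul (s p : ℝ) (x₀ : EuclideanSpace ℝ (Fin n)) (u : Space n → ℝ) {l r : ℝ}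
    (hl : 0 < l) (hr : 0 < r) :
    rescale s p x₀ u (l * r) = dilate (r ^ (2 * s / (p - 1))) r (rescale s p x₀ u l) := by
  funext X
  simp only [rescale, dilate, smul_smul, Real.mul_rpow hl.le hr.le]
  ring

lemma dlam_eq (s p : ℝ) (x₀ : EuclideanSpace ℝ (Fin n)) (hu : Sm 6 u) {i : ℕ} (hi : i ≤ 6) {l : ℝ}
    (hl : 0 < l) :
    EqOn (dlam s p x₀ u i l)
      (fun X => (l ^ i)⁻¹ * fallPow (2 * s / (p - 1)) (rescale s p x₀ u l) i X) (upper n) :=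
  fun X hX => by
  have h := iteratedDeriv_rpow_mul_comp_smul (2 * s / (p - 1)) i
    ((hu.translate (bdry_last x₀)).of_le hi) hX hl
  rw [rescale_eq_dilate, fallPow_dilate, dlam]
  refine h.trans ?_
  rw [Real.rpow_sub hl, Real.rpow_natCast]
  simp only [dilate]
  ring

lemma fallPow_one (k : ℝ) (f : Space n → ℝ) : fallPow k f 1 = eulerPow k f 1 := by
  funext X
  simp [fallPow, eulerPow]

/-- Here and in the next two lemmas the coefficients 1, 1; 1, 3, 1; 1, 6, 7, 1 are Stirling numbers
of the second kind: they express (λ d/dλ)^j through λ^i d^i/dλ^i. -/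
lemma eulerPow_two (k : ℝ) (f : Space n → ℝ) (X : Space n) :
    eulerPow k f 2 X = fallPow k f 2 X + fallPow k f 1 X := by
  simp only [fallPow, eulerPow]
  push_cast
  simp only [sub_zero]
  ring

lemma eulerPow_three (k : ℝ) (hf : Sm 6 f) {X : Space n} (hX : X ∈ upper n) :
    eulerPow k f 3 X = fallPow k f 3 X + 3 * fallPow k f 2 X + fallPow k f 1 X := by
  have h1 := (Sm.fallPow (m := 1) (i := 1) k (hf.of_le (by norm_num))).diff hX
  have h2 := (Sm.fallPow (m := 1) (i := 2) k (hf.of_le (by norm_num))).diff hX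
  have e : eulerPow k f 2 = fun X => fallPow k f 2 X + fallPow k f 1 X :=
    funext (eulerPow_two k f)
  have e1 : euler (fallPow k f 1) X = fallPow k f 2 X - (k - 1) * fallPow k f 1 X := by
    simp only [fallPow]
    push_cast
    ring
  have e2 : euler (fallPow k f 2) X = fallPow k f 3 X - (k - 2) * fallPow k f 2 X := by
    simp only [fallPow]
    push_cast
    ring
  have : eulerPow k f 3 X = euler (eulerPow k f 2) X + k * eulerPow k f 2 X := rfl
  rw [this, e, euler_add h2 h1, e1, e2]
  ring

lemma eulerPow_four (k : ℝ) (hf : Sm 6 f) {X : Space n} (hX : X ∈ upper n) :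
    eulerPow k f 4 X =
      fallPow k f 4 X + 6 * fallPow k f 3 X + 7 * fallPow k f 2 X + fallPow k f 1 X := by
  have h1 := (Sm.fallPow (m := 1) (i := 1) k (hf.of_le (by norm_num))).diff hX
  have h2 := (Sm.fallPow (m := 1) (i := 2) k (hf.of_le (by norm_num))).diff hX
  have h3 := (Sm.fallPow (m := 1) (i := 3) k (hf.of_le (by norm_num))).diff hX
  have e : EqOn (eulerPow k f 3)
      (fun X => fallPow k f 3 X + 3 * fallPow k f 2 X + fallPow k f 1 X) (upper n) :=
    fun Y hY => eulerPow_three k hf hY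
  have e1 : euler (fallPow k f 1) X = fallPow k f 2 X - (k - 1) * fallPow k f 1 X := by
    simp only [fallPow]
    push_cast
    ring
  have e2 : euler (fallPow k f 2) X = fallPow k f 3 X - (k - 2) * fallPow k f 2 X := by
    simp only [fallPow]
    push_cast
    ring
  have e3 : euler (fallPow k f 3) X = fallPow k f 4 X - (k - 3) * fallPow k f 3 X := by
    simp only [fallPow]
    push_cast
    ring
  have : eulerPow k f 4 X = euler (eulerPow k f 3) X + k * eulerPow k f 3 X := rfl
  rw [this, euler_eqOn e hX, e hX, euler_add (h3.fun_add (h2.const_mul 3)) h1,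
    euler_add h3 (h2.const_mul 3), euler_const_mul 3 h2, e1, e2, e3]
  ring

/-! ### The coefficients of the energy -/

/-- The coefficients of the energy, in terms of `α = n + b - 1 - 2 k` and
`β = k (n + b - 1 - k)`. -/
def energyCoeffs (α β : ℝ) : Coeffs where
  -- Only pairs i ≤ j are used, each carrying the whole cross term. The entries are those of
  -- `bdryForm` after expanding the powers of E + k by Stirling numbers; for instance the entry at
  -- (1, 3) is -6 + 2 + (8 - 2α).
  c₁ i j := match i, j with
    | 1, 4 => -1
    | 2, 3 => 2
    | 1, 3 => 4 - 2 * α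
    | 2, 2 => α
    | 1, 2 => 4 * β + 10 * α - 7 - α ^ 2
    | 1, 1 => 3 - α - (α ^ 2 - 4 * β - 14 * α + 20) -
        (2 * β + 2 * (β + 2 * α - 4) - α * β - 2 * α ^ 2 + 8 * α)
    | 0, 1 => (β + 2 * α - 4) * β
    | 0, 0 => 2 * (β + 2 * α - 4) * β
    | _, _ => 0
  c₂ i j := match i, j with
    | 1, 2 => 4
    | 1, 1 => α
    | 0, 1 => 2 * β + 2 * α - 4
    | 0, 0 => 2 * (2 * β + 2 * α - 4)
    | _, _ => 0
  c₃ i j := match i, j with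
    | 0, 1 => 1
    | 0, 0 => 2
    | _, _ => 0

/-- The factor λ^(i+j) turns λ-derivatives into `fallPow` at scale one, and on the unit sphere the
spherical gradient and Laplacian become `Gam` and `SL`. The constant s/(p-1) + 1 is k/2 + 1. -/
lemma boundaryDensity_eq (s p α β : ℝ) (x₀ : EuclideanSpace ℝ (Fin n)) (hu : Sm 6 u) {l : ℝ}
    (hl : 0 < l) {X : Space n} (hX : X ∈ upper n) (h1 : ‖X‖ = 1) :
    boundaryDensity s p (energyCoeffs α β) x₀ u l X = ht X ^ (5 - 2 * s) *
      bdryForm (5 - 2 * s) (2 * s / (p - 1)) α β (rescale s p x₀ u l) X := by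
  set b := 5 - 2 * s with hb
  set k := 2 * s / (p - 1) with hk
  set v := rescale s p x₀ u l with hv
  have hvs : Sm 6 v := (hu.translate (bdry_last x₀)).dilate _ hl
  set U := fallPow k v with hU
  have hUs : ∀ {i m : ℕ}, m + i ≤ 6 → Sm m (U i) := fun h => Sm.fallPow k (hvs.of_le h)
  have hd : ∀ i ≤ 6, EqOn (dlam s p x₀ u i l) (fun X => (l ^ i)⁻¹ * U i X) (upper n) :=
    fun i hi => dlam_eq s p x₀ hu hi hl
  have hds : ∀ {i m : ℕ}, m + i ≤ 6 → Sm m (dlam s p x₀ u i l) := fun {i m} h =>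
    ((hUs h).const_mul _).congr fun Y hY => (hd i (by omega) hY).symm
  have hli : ∀ i : ℕ, l ^ i ≠ 0 := fun i => pow_ne_zero i hl.ne'
  have hc₁ : ∀ i j, i ≤ 6 → j ≤ 6 → ∀ c : ℝ,
      c * l ^ (i + j) * (dlam s p x₀ u i l X * dlam s p x₀ u j l X) = c * (U i X * U j X) := by
    intro i j hi hj c
    rw [hd i hi hX, hd j hj hX, pow_add]
    have := hli i
    have := hli j
    field_simp
  have hc₂ : ∀ i j, i ≤ 5 → j ≤ 5 → ∀ c : ℝ, c * l ^ (i + j) *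
      ⟪sphGrad (dlam s p x₀ u i l) X, sphGrad (dlam s p x₀ u j l) X⟫_ℝ =
        c * Gam (U i) (U j) X := by
    intro i j hi hj c
    rw [inner_sphGrad (m := 0) (hds (by omega)) (hds (by omega)) hX h1,
      Gam_eqOn (hd i (by omega)) (hd j (by omega)) hX,
      Gam_const_mul_left _ ((hUs (m := 1) (by omega)).diff hX), Gam_comm,
      Gam_const_mul_left _ ((hUs (m := 1) (by omega)).diff hX), Gam_comm, pow_add]
    have := hli i
    have := hli j
    field_simp
  have hc₃ : ∀ i j, i ≤ 4 → j ≤ 4 → ∀ c : ℝ, c * l ^ (i + j) *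
      (sphLap b (dlam s p x₀ u i l) X * sphLap b (dlam s p x₀ u j l) X) =
        c * (SL b (U i) X * SL b (U j) X) := by
    intro i j hi hj c
    rw [sphLap_eq_SL (m := 0) (hds (by omega)) b hX h1,
      sphLap_eq_SL (m := 0) (hds (by omega)) b hX h1, SL_eqOn b (hd i (by omega)) hX,
      SL_eqOn b (hd j (by omega)) hX, SL_const_mul (m := 0) b _ (hUs (by omega)) hX,
      SL_const_mul (m := 0) b _ (hUs (by omega)) hX, pow_add]
    have := hli i
    have := hli j
    field_simp
  have e2 : eulerPow k v 2 = fun X => U 2 X + U 1 X := funext (eulerPow_two k v)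
  have e3 := eulerPow_three k hvs hX
  have e4 := eulerPow_four k hvs hX
  have eG : Gam (U 1) (eulerPow k v 2) X = Gam (U 1) (U 2) X + Gam (U 1) (U 1) X := by
    rw [e2, Gam_comm, Gam_add_left ((hUs (m := 1) (by omega)).diff hX)
      ((hUs (m := 1) (by omega)).diff hX), Gam_comm]
  have hk2 : s / (p - 1) + 1 = k / 2 + 1 := by rw [hk]; ring
  rw [boundaryDensity, hk2, ← hb, ← hv]
  congr 1
  -- The powers of λ are removed before the finite sums are expanded, so that the final identity is
  -- polynomial in the `fallPow` terms.
  have s1 : (∑ i ∈ Finset.range 5, ∑ j ∈ Finset.range 5, if i + j ≤ 5 then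
        (energyCoeffs α β).c₁ i j * l ^ (i + j) * (dlam s p x₀ u i l X * dlam s p x₀ u j l X)
        else 0) = ∑ i ∈ Finset.range 5, ∑ j ∈ Finset.range 5, if i + j ≤ 5 then
        (energyCoeffs α β).c₁ i j * (U i X * U j X) else 0 :=
    Finset.sum_congr rfl fun i hi => Finset.sum_congr rfl fun j hj => by
      rw [hc₁ i j (by have := Finset.mem_range.1 hi; omega) (by have := Finset.mem_range.1 hj; omega)]
  have s2 : (∑ i ∈ Finset.range 3, ∑ j ∈ Finset.range 3, if i + j ≤ 3 then
        (energyCoeffs α β).c₂ i j * l ^ (i + j) *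
          ⟪sphGrad (dlam s p x₀ u i l) X, sphGrad (dlam s p x₀ u j l) X⟫_ℝ
        else 0) = ∑ i ∈ Finset.range 3, ∑ j ∈ Finset.range 3, if i + j ≤ 3 then
        (energyCoeffs α β).c₂ i j * Gam (U i) (U j) X else 0 :=
    Finset.sum_congr rfl fun i hi => Finset.sum_congr rfl fun j hj => by
      rw [hc₂ i j (by have := Finset.mem_range.1 hi; omega) (by have := Finset.mem_range.1 hj; omega)]
  have s3 : (∑ i ∈ Finset.range 2, ∑ j ∈ Finset.range 2, if i + j ≤ 1 then
        (energyCoeffs α β).c₃ i j * l ^ (i + j) *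
          (sphLap b (dlam s p x₀ u i l) X * sphLap b (dlam s p x₀ u j l) X)
        else 0) = ∑ i ∈ Finset.range 2, ∑ j ∈ Finset.range 2, if i + j ≤ 1 then
        (energyCoeffs α β).c₃ i j * (SL b (U i) X * SL b (U j) X) else 0 :=
    Finset.sum_congr rfl fun i hi => Finset.sum_congr rfl fun j hj => by
      rw [hc₃ i j (by have := Finset.mem_range.1 hi; omega) (by have := Finset.mem_range.1 hj; omega)]
  rw [s1, s2, s3]
  simp only [bdryForm, ← fallPow_one, ← hU, h1, e3, e4, eG]
  have e0 : eulerPow k v 0 = U 0 := rfl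
  simp only [e0, e2]
  simp only [Finset.sum_range_succ, Finset.sum_range_zero, energyCoeffs]
  norm_num
  ring

end LaneEmden

end

noncomputable section

namespace LaneEmden

variable {n : ℕ} {s p κ α β : ℝ} {u : Space n → ℝ}

/-! ### The monotonicity formula -/

lemma bulkDensity_eq (s p : ℝ) (x₀ : EuclideanSpace ℝ (Fin n)) (u : Space n → ℝ) (l : ℝ) :
    bulkDensity s p x₀ u l =
      fun X => ht X ^ (5 - 2 * s) * bulkForm (5 - 2 * s) (rescale s p x₀ u l) X := by
  funext X
  rw [bulkDensity, norm_sq_gradient, bulkForm]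
  simp only [sq]
  ring

lemma energy_eq (s p κ α β : ℝ) (x₀ : EuclideanSpace ℝ (Fin n)) (hu : Sm 6 u) {l : ℝ}
    (hl : 0 < l) : energy s p κ (energyCoeffs α β) x₀ u l =
      unitEnergy (5 - 2 * s) (2 * s / (p - 1)) p κ α β (rescale s p x₀ u l) := by
  rw [energy, unitEnergy, bulkDensity_eq]
  congr 1
  exact setIntegral_congr_fun measurableSet_hemi fun ω hω =>
    boundaryDensity_eq s p α β x₀ hu hl hω (by simp)

/-- Rescaling by lr is rescaling by l and then by r, so differentiability at any l reduces to scale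
one for another solution. -/
lemma energy_mul (s p κ α β : ℝ) (x₀ : EuclideanSpace ℝ (Fin n)) (hu : Sm 6 u) {l r : ℝ}
    (hl : 0 < l) (hr : 0 < r) : energy s p κ (energyCoeffs α β) x₀ u (l * r) =
      scaledEnergy (5 - 2 * s) (2 * s / (p - 1)) p κ α β (rescale s p x₀ u l) r := by
  rw [energy_eq s p κ α β x₀ hu (mul_pos hl hr), rescale_mul s p x₀ u hl hr]
  exact unitEnergy_dilate _ _ _ _ _ _ hr ((hu.translate (bdry_last x₀)).dilate _ hl)

theorem IsExtendedSolution.regularSolution_rescale (hs₂ : 2 < s) (hs₃ : s < 3) (hp : 1 < p)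
    (hu : IsExtendedSolution n s p κ u) (x₀ : EuclideanSpace ℝ (Fin n)) {l : ℝ} (hl : 0 < l) :
    RegularSolution (5 - 2 * s) p κ (rescale s p x₀ u l) :=
  ((hu.regularSolution hs₂ hs₃).translate x₀).dilate hl (by
    have : p - 1 ≠ 0 := by linarith
    field_simp
    ring)

theorem IsExtendedSolution.hasDerivAt_energy (hs₂ : 2 < s) (hs₃ : s < 3) (hp : 1 < p)
    (hu : IsExtendedSolution n s p κ u) (α β : ℝ) (x₀ : EuclideanSpace ℝ (Fin n)) {l : ℝ}
    (hl : 0 < l) : HasDerivAt (energy s p κ (energyCoeffs α β) x₀ u)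
      (l⁻¹ * ∫ ω in hemi n, ht (ω : Space n) ^ (5 - 2 * s) *
        (flux (5 - 2 * s) (2 * s / (p - 1)) (rescale s p x₀ u l) ω +
          bdryForm' (5 - 2 * s) (2 * s / (p - 1)) α β (rescale s p x₀ u l) ω) ∂(surf n)) l := by
  have h := (hu.regularSolution_rescale hs₂ hs₃ hp x₀ hl).hasDerivAt_scaledEnergy
    (by linarith) (by linarith) hp (2 * s / (p - 1)) α β
  have hdiv : HasDerivAt (fun t : ℝ => t / l) (1 / l) l := (hasDerivAt_id l).div_const l
  -- Chain rule through t ↦ t/l, which takes the value 1 at t = l and produces the factor l⁻¹.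
  have h2 := h.comp_of_eq l hdiv (div_self hl.ne').symm
  rw [one_div, mul_comm _ l⁻¹] at h2
  refine h2.congr_of_eventuallyEq ?_
  filter_upwards [lt_mem_nhds hl] with t ht
  rw [Function.comp, ← energy_mul s p κ α β x₀ hu.contDiffOn hl (div_pos ht hl),
    mul_div_cancel₀ _ hl.ne']

theorem IsExtendedSolution.energyConverges (hs₂ : 2 < s) (hs₃ : s < 3) (hp : 1 < p)
    (hu : IsExtendedSolution n s p κ u) (α β : ℝ) (x₀ : EuclideanSpace ℝ (Fin n)) {l : ℝ}
    (hl : 0 < l) : EnergyConverges s p (energyCoeffs α β) x₀ u l := by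
  have h := hu.regularSolution_rescale hs₂ hs₃ hp x₀ hl
  have hb : -1 < 5 - 2 * s := by linarith
  have hσ : -1 < -(5 - 2 * s) := by linarith
  refine ⟨?_, ?_, ?_⟩
  · have hB := Cls.bulkForm hσ h.cls
    rw [bulkDensity_eq]
    exact (integrableOn_of_locBdd hb
      (ContinuousOn.mul (ContDiffOn.continuousOn (sm_ht_rpow (m := 0) _)) hB.continuousOn)
      (hB.locBdd_rho hσ).ht_rpow_mul 1).mono_set
      (inter_subset_inter_right _ Metric.ball_subset_closedBall)
  · have hc : Continuous (traceDensity s p x₀ u l) :=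
      h.continuous_trace.abs.rpow_const fun _ => Or.inr (by linarith)
    exact (hc.continuousOn.integrableOn_compact (isCompact_closedBall 0 1)).mono_set
      Metric.ball_subset_closedBall
  · have hB := cls_bdryForm hσ (5 - 2 * s) (2 * s / (p - 1)) α β h.cls
    exact (integrable_weight_mul_hemi hb hB.continuousOn (hB.locBdd_rho hσ)).congr_fun
      (fun ω hω => (boundaryDensity_eq s p α β x₀ hu.contDiffOn hl hω (by simp)).symm)
      measurableSet_hemi

/-- On the sphere of radius l the weight contributes l^b, and writing u as l^(-k) times its
rescaling contributes l^(-2k) to the square. -/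
lemma dissipation_eq (s p : ℝ) (x₀ : EuclideanSpace ℝ (Fin n)) (u : Space n → ℝ) {l : ℝ}
    (hl : 0 < l) {X : Space n} (hX : X ∈ upper n) :
    dissipation s p x₀ u l (bdry x₀ + l • X) = l ^ (5 - 2 * s - 2 * (2 * s / (p - 1))) *
      (ht X ^ (5 - 2 * s) * (eulerPow (2 * s / (p - 1)) (rescale s p x₀ u l) 1 X *
        eulerPow (2 * s / (p - 1)) (rescale s p x₀ u l) 1 X)) := by
  set k := 2 * s / (p - 1) with hk
  have h1 : ht (bdry x₀ + l • X) = l * ht X := by rw [ht_add (bdry_last x₀), ht_smul]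
  have h2 : l * fderiv ℝ u (bdry x₀ + l • X) (l⁻¹ • (bdry x₀ + l • X - bdry x₀)) =
      euler (translate (bdry x₀) u) (l • X) := by
    have e : fderiv ℝ (translate (bdry x₀) u) (l • X) = fderiv ℝ u (bdry x₀ + l • X) :=
      fderiv_comp_add_left (bdry x₀)
    rw [euler, e, add_sub_cancel_left, inv_smul_smul₀ hl.ne', map_smul, smul_eq_mul]
  rw [dissipation, h1, h2, rescale_eq_dilate, ← hk, eulerPow_dilate, Real.mul_rpow hl.le (le_of_lt hX)]
  simp only [dilate, eulerPow, translate]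
  have h3 : l ^ (5 - 2 * s) = l ^ (5 - 2 * s - 2 * k) * (l ^ k * l ^ k) := by
    rw [← Real.rpow_add hl, ← Real.rpow_add hl]
    congr 1
    ring
  rw [h3]
  ring

/-- The monotonicity formula, under the sign conditions which the derivative requires. -/
theorem IsExtendedSolution.monotonicity (hs₂ : 2 < s) (hs₃ : s < 3) (hp : 1 < p)
    (hα : α = (n + (5 - 2 * s) - 1) - 2 * (2 * s / (p - 1)))
    (hβ : β = 2 * s / (p - 1) * ((n + (5 - 2 * s) - 1) - 2 * s / (p - 1)))
    (hα2 : 2 ≤ α) (hβ0 : 0 ≤ β) (hA : 0 ≤ 6 * β + 20 * α - 24 - α ^ 2)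
    (hu : IsExtendedSolution n s p κ u) (x₀ : EuclideanSpace ℝ (Fin n)) :
    MonotoneOn (energy s p κ (energyCoeffs α β) x₀ u) (Ioi 0) ∧
    ∀ l : ℝ, 0 < l → EnergyConverges s p (energyCoeffs α β) x₀ u l ∧
      DifferentiableAt ℝ (energy s p κ (energyCoeffs α β) x₀ u) l ∧
      IntegrableOn (fun ω : Metric.sphere (0 : Space n) 1 =>
        dissipation s p x₀ u l (bdry x₀ + l • (ω : Space n))) (hemi n) (surf n) ∧
      (3 * β ^ 2 + 12 * (α - 2) * β + 8 * α * (α - 2)) *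
          l ^ (2 * s * ((p + 1) / (p - 1)) - 6 - n) *
          halfSphereIntegral x₀ l (dissipation s p x₀ u l) ≤
        deriv (energy s p κ (energyCoeffs α β) x₀ u) l := by
  have hb : -1 < 5 - 2 * s := by linarith
  have hσ : -1 < -(5 - 2 * s) := by linarith
  have hd := fun {l : ℝ} (hl : 0 < l) => hu.hasDerivAt_energy hs₂ hs₃ hp α β x₀ hl
  have key : ∀ {l : ℝ}, 0 < l → _ := fun {l} hl =>
    let h := hu.regularSolution_rescale hs₂ hs₃ hp x₀ hl
    le_integral_flux_add hb (by linarith) (2 * s / (p - 1)) h.sm h.cls hα hβ hα2 hβ0 hA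
  have hC : 0 ≤ 3 * β ^ 2 + 12 * (α - 2) * β + 8 * α * (α - 2) := by
    have : 0 ≤ α - 2 := by linarith
    have : 0 ≤ α := by linarith
    positivity
  refine ⟨monotoneOn_of_deriv_nonneg (convex_Ioi 0)
    (fun l hl => (hd hl).continuousAt.continuousWithinAt)
    (fun l hl => (hd (interior_subset hl)).differentiableAt.differentiableWithinAt)
    fun l hl => ?_, fun l hl => ⟨hu.energyConverges hs₂ hs₃ hp α β x₀ hl,
      (hd hl).differentiableAt, ?_, ?_⟩⟩
  · have hl0 : 0 < l := interior_subset hl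
    rw [(hd hl0).deriv]
    refine mul_nonneg (inv_nonneg.2 hl0.le) (le_trans (mul_nonneg hC ?_) (key hl0))
    exact setIntegral_nonneg measurableSet_hemi fun ω hω =>
      mul_nonneg (Real.rpow_nonneg (le_of_lt hω) _) (mul_self_nonneg _)
  · have h := hu.regularSolution_rescale hs₂ hs₃ hp x₀ hl
    have hq : Cls (-(5 - 2 * s)) 1 .any
        (eulerPow (2 * s / (p - 1)) (rescale s p x₀ u l) 1) :=
      (Cls.eulerPow hσ _ (h.cls.of_le hσ (by omega))).to_any hσ
    have hqq := hq.mul_any hq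
    exact IntegrableOn.congr_fun ((integrable_weight_mul_hemi hb hqq.continuousOn
      (hqq.locBdd_rho hσ)).const_mul (l ^ (5 - 2 * s - 2 * (2 * s / (p - 1))))) (fun ω hω => (dissipation_eq s p x₀ u hl hω).symm) measurableSet_hemi
  · have e : halfSphereIntegral x₀ l (dissipation s p x₀ u l) =
        l ^ n * (l ^ (5 - 2 * s - 2 * (2 * s / (p - 1))) *
          ∫ ω in hemi n, ht (ω : Space n) ^ (5 - 2 * s) *
            (eulerPow (2 * s / (p - 1)) (rescale s p x₀ u l) 1 ω *
              eulerPow (2 * s / (p - 1)) (rescale s p x₀ u l) 1 ω) ∂(surf n)) := by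
      rw [halfSphereIntegral]
      congr 1
      rw [← integral_const_mul]
      exact setIntegral_congr_fun measurableSet_hemi fun ω hω => dissipation_eq s p x₀ u hl hω
    -- As 2s(p+1)/(p-1) = 2s + 2k, the exponents add up to (2s + 2k - 6 - n) + n + (5 - 2s - 2k) =
    -- -1, the power coming from the chain rule.
    have hexp : l ^ (2 * s * ((p + 1) / (p - 1)) - 6 - n) *
        (l ^ n * l ^ (5 - 2 * s - 2 * (2 * s / (p - 1)))) = l⁻¹ := by
      rw [← Real.rpow_natCast, ← Real.rpow_add hl, ← Real.rpow_add hl, ← Real.rpow_neg_one]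
      congr 1
      have : p - 1 ≠ 0 := by linarith
      field_simp
      ring
    rw [(hd hl).deriv, e]
    calc _ = l⁻¹ * ((3 * β ^ 2 + 12 * (α - 2) * β + 8 * α * (α - 2)) *
          ∫ ω in hemi n, ht (ω : Space n) ^ (5 - 2 * s) *
            (eulerPow (2 * s / (p - 1)) (rescale s p x₀ u l) 1 ω *
              eulerPow (2 * s / (p - 1)) (rescale s p x₀ u l) 1 ω) ∂(surf n)) := by
          rw [← hexp]
          ring
      _ ≤ _ := mul_le_mul_of_nonneg_left (key hl) (inv_nonneg.2 hl.le)

end LaneEmden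

end

noncomputable section

namespace LaneEmden

/-! ### The condition on Gamma functions -/

/-- Log-convexity of Γ between x + 2 and x + 3, whose convex combination with weights 1 - q, q is x
+ 2 + q, followed by the functional equation. -/
lemma Gamma_add_two_add_le {x q : ℝ} (hx : 0 < x) (hq : 0 < q) (hq1 : q < 1) :
    Real.Gamma (x + (2 + q)) ≤ x * (x + 1) * (x + 2) ^ q * Real.Gamma x := by
  have h := Real.Gamma_mul_add_mul_le_rpow_Gamma_mul_rpow_Gamma (s := x + 2) (t := x + 3)
    (by linarith) (by linarith) (sub_pos.2 hq1) hq (by ring)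
  have e3 : Real.Gamma (x + 3) = (x + 2) * Real.Gamma (x + 2) := by
    rw [← Real.Gamma_add_one (by linarith)]
    ring_nf
  have e2 : Real.Gamma (x + 2) = (x + 1) * (x * Real.Gamma x) := by
    rw [← Real.Gamma_add_one hx.ne', ← Real.Gamma_add_one (by linarith)]
    ring_nf
  have hG : 0 < Real.Gamma (x + 2) := Real.Gamma_pos_of_pos (by linarith)
  have e : (1 - q) * (x + 2) + q * (x + 3) = x + (2 + q) := by ring
  rw [e, e3, Real.mul_rpow (by linarith) hG.le, mul_left_comm, ← Real.rpow_add hG,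
    sub_add_cancel, Real.rpow_one, e2] at h
  linarith

/-- Log-convexity the other way round: x + 3 lies between x + 2 + q and x + 3 + q, with weights q
and 1 - q. The base x + 2 + q is then enlarged to x + 3, the one needed in `Gamma_ratio_le`. -/
lemma le_Gamma_add_two_add {x q : ℝ} (hx : 0 < x) (hq : 0 < q) (hq1 : q < 1) :
    x * (x + 1) * (x + 2) * Real.Gamma x ≤ Real.Gamma (x + (2 + q)) * (x + 3) ^ (1 - q) := by
  have h := Real.Gamma_mul_add_mul_le_rpow_Gamma_mul_rpow_Gamma (s := x + (2 + q))
    (t := x + (2 + q) + 1) (by linarith) (by linarith) hq (sub_pos.2 hq1) (by ring)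
  have e3 : Real.Gamma (x + 3) = (x + 2) * ((x + 1) * (x * Real.Gamma x)) := by
    rw [← Real.Gamma_add_one hx.ne', ← Real.Gamma_add_one (by linarith),
      show x + 1 + 1 = x + 2 by ring, ← Real.Gamma_add_one (by linarith)]
    ring_nf
  have hG : 0 < Real.Gamma (x + (2 + q)) := Real.Gamma_pos_of_pos (by linarith)
  have e : q * (x + (2 + q)) + (1 - q) * (x + (2 + q) + 1) = x + 3 := by ring
  rw [e, Real.Gamma_add_one (by linarith), Real.mul_rpow (by linarith) hG.le, mul_left_comm,
    ← Real.rpow_add hG, add_sub_cancel, Real.rpow_one, e3] at h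
  have h2 : (x + (2 + q)) ^ (1 - q) ≤ (x + 3) ^ (1 - q) :=
    Real.rpow_le_rpow (by linarith) (by linarith) (by linarith)
  nlinarith [mul_le_mul_of_nonneg_right h2 hG.le]

/-- The four factors regroup as ((c+1)² - δ²)((c+1)² - (δ-1)²). The hypothesis bounds the first by
(2/5) c(c+2) and the second by the same plus 2δ - 1, which is less than 2c - 1. It also forces c >
3, because δ < c, and what is left is a quartic inequality in c alone. -/
lemma polynomial_bound {c δ : ℝ} (hδ : 0 < δ) (hδc : δ < c)
    (h : 24 * (c + 1) ^ 2 + 16 < 40 * δ ^ 2) :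
    (c + δ) * (c + δ + 1) * ((c - δ + 1) * (c - δ + 2)) * (c + 3) ^ 2 ≤
      (c * (c + 1) * (c + 2)) ^ 2 := by
  have hc : 3 < c := by nlinarith
  have h1 : (c + δ + 1) * (c - δ + 1) ≤ 2 / 5 * (c * (c + 2)) := by nlinarith
  have h2 : (c + δ) * (c - δ + 2) ≤ 2 / 5 * (c * (c + 2)) + 2 * c - 1 := by nlinarith
  have h3 : 2 / 5 * (2 / 5 * (c * (c + 2)) + 2 * c - 1) * (c + 3) ^ 2 ≤
      c * (c + 1) ^ 2 * (c + 2) := by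
    nlinarith [mul_pos (sub_pos.2 hc) (sub_pos.2 hc), pow_pos (sub_pos.2 hc) 3,
      pow_pos (sub_pos.2 hc) 4]
  have h4 : (c + δ + 1) * (c - δ + 1) * ((c + δ) * (c - δ + 2)) ≤
      2 / 5 * (c * (c + 2)) * (2 / 5 * (c * (c + 2)) + 2 * c - 1) :=
    mul_le_mul h1 h2 (mul_nonneg (by linarith) (by linarith)) (by positivity)
  calc _ = (c + δ + 1) * (c - δ + 1) * ((c + δ) * (c - δ + 2)) * (c + 3) ^ 2 := by ring
    _ ≤ 2 / 5 * (c * (c + 2)) * (2 / 5 * (c * (c + 2)) + 2 * c - 1) * (c + 3) ^ 2 :=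
      mul_le_mul_of_nonneg_right h4 (by positivity)
    _ = c * (c + 2) * (2 / 5 * (2 / 5 * (c * (c + 2)) + 2 * c - 1) * (c + 3) ^ 2) := by ring
    _ ≤ c * (c + 2) * (c * (c + 1) ^ 2 * (c + 2)) := mul_le_mul_of_nonneg_left h3 (by positivity)
    _ = _ := by ring

/-- With q = s - 2, this is the reverse of the Gamma hypothesis when δ is large. Upper bounds at c +
δ and c - δ + 1 are played against the lower bound at c; since (c+δ+2)(c-δ+3) ≤ (c+3)², the
fractional powers combine to (c+3)², and `polynomial_bound` finishes. -/
lemma Gamma_ratio_le {c δ q : ℝ} (hq : 0 < q) (hq1 : q < 1) (hδ : 0 < δ) (hδc : δ < c)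
    (h : 24 * (c + 1) ^ 2 + 16 < 40 * δ ^ 2) :
    Real.Gamma (c + δ + (2 + q)) * Real.Gamma (c - δ + 1 + (2 + q)) * Real.Gamma c ^ 2 ≤
      Real.Gamma (c + (2 + q)) ^ 2 * (Real.Gamma (c + δ) * Real.Gamma (c - δ + 1)) := by
  have hc : 0 < c := hδ.trans hδc
  have hG1 : 0 < Real.Gamma (c + δ) := Real.Gamma_pos_of_pos (by linarith)
  have hG2 : 0 < Real.Gamma (c - δ + 1) := Real.Gamma_pos_of_pos (by linarith)
  have hG : 0 < Real.Gamma c := Real.Gamma_pos_of_pos hc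
  have hGs : 0 < Real.Gamma (c + (2 + q)) := Real.Gamma_pos_of_pos (by linarith)
  have u1 := Gamma_add_two_add_le (x := c + δ) (by linarith) hq hq1
  have u2 := Gamma_add_two_add_le (x := c - δ + 1) (by linarith) hq hq1
  have l1 := le_Gamma_add_two_add hc hq hq1
  have hP := polynomial_bound hδ hδc h
  have hM : (c + δ + 2) ^ q * (c - δ + 1 + 2) ^ q ≤ ((c + 3) ^ q) ^ 2 := by
    rw [← Real.mul_rpow (by linarith) (by linarith), sq, ← Real.mul_rpow (by linarith) (by linarith)]
    exact Real.rpow_le_rpow (mul_nonneg (by linarith) (by linarith)) (by nlinarith) hq.le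
  have hr : (c + 3) ^ (1 - q) * (c + 3) ^ q = c + 3 := by
    rw [← Real.rpow_add (by linarith), sub_add_cancel, Real.rpow_one]
  set A := (c + 3) ^ q with hA
  set B := (c + 3) ^ (1 - q) with hB
  have hA0 : 0 < A := Real.rpow_pos_of_pos (by linarith) _
  have hB0 : 0 < B := Real.rpow_pos_of_pos (by linarith) _
  set Q := (c + δ) * (c + δ + 1) * ((c - δ + 1) * (c - δ + 2)) with hQ
  have hQ0 : 0 ≤ Q := mul_nonneg (mul_nonneg (by linarith) (by linarith))
    (mul_nonneg (by linarith) (by linarith))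
  have hGG : 0 < Real.Gamma (c + δ) * Real.Gamma (c - δ + 1) := mul_pos hG1 hG2
  have hu : Real.Gamma (c + δ + (2 + q)) * Real.Gamma (c - δ + 1 + (2 + q)) ≤
      Q * A ^ 2 * (Real.Gamma (c + δ) * Real.Gamma (c - δ + 1)) := by
    refine (mul_le_mul u1 u2 (Real.Gamma_pos_of_pos (by linarith)).le (by positivity)).trans ?_
    calc _ = Q * ((c + δ + 2) ^ q * (c - δ + 1 + 2) ^ q) *
          (Real.Gamma (c + δ) * Real.Gamma (c - δ + 1)) := by rw [hQ]; ring
      _ ≤ _ := mul_le_mul_of_nonneg_right (mul_le_mul_of_nonneg_left hM hQ0) hGG.le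
  have hl : (c * (c + 1) * (c + 2)) ^ 2 * Real.Gamma c ^ 2 ≤
      Real.Gamma (c + (2 + q)) ^ 2 * B ^ 2 := by
    rw [← mul_pow, ← mul_pow]
    exact pow_le_pow_left₀ (by positivity) l1 2
  have hkey : Q * A ^ 2 * Real.Gamma c ^ 2 ≤ Real.Gamma (c + (2 + q)) ^ 2 := by
    -- Multiplying by B² replaces the fractional powers by BA = c + 3.
    refine le_of_mul_le_mul_right ?_ (pow_pos hB0 2)
    calc _ = Q * (B * A) ^ 2 * Real.Gamma c ^ 2 := by ring
      _ ≤ (c * (c + 1) * (c + 2)) ^ 2 * Real.Gamma c ^ 2 := by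
        rw [hr]
        exact mul_le_mul_of_nonneg_right hP (by positivity)
      _ ≤ _ := hl
  calc _ ≤ Q * A ^ 2 * (Real.Gamma (c + δ) * Real.Gamma (c - δ + 1)) * Real.Gamma c ^ 2 :=
        mul_le_mul_of_nonneg_right hu (by positivity)
    _ = Q * A ^ 2 * Real.Gamma c ^ 2 * (Real.Gamma (c + δ) * Real.Gamma (c - δ + 1)) := by ring
    _ ≤ _ := mul_le_mul_of_nonneg_right hkey hGG.le

/-- The condition on Gamma functions, in terms of `c = (n - 2 s) / 4` and `t = s / (p - 1)`. -/
lemma quadratic_bound_of_Gamma {c t s p : ℝ} (hs₂ : 2 < s) (hs₃ : s < 3) (ht : 0 < t) (htc : t < c)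
    (hpt : p * t = t + s)
    (hΓ : Real.Gamma (c + s) ^ 2 / Real.Gamma c ^ 2 <
      p * (Real.Gamma (2 * c + s - t) * Real.Gamma (s + t) /
        (Real.Gamma t * Real.Gamma (2 * c - t)))) :
    40 * (c - t) ^ 2 ≤ 24 * (c + 1) ^ 2 + 16 := by
  by_contra! h
  -- Taken at δ = c - t, so that c + δ = 2c - t and c - δ + 1 = t + 1. The factor p = (t + s)/t of
  -- the hypothesis is what shifts Γ(s+t)/Γ(t) to Γ(s+t+1)/Γ(t+1).
  have hle := Gamma_ratio_le (q := s - 2) (by linarith) (by linarith) (sub_pos.2 htc)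
    (by linarith : c - t < c) h
  rw [show c + (c - t) + (2 + (s - 2)) = 2 * c + s - t by ring,
    show c - (c - t) + 1 + (2 + (s - 2)) = s + t + 1 by ring,
    show c + (2 + (s - 2)) = c + s by ring, show c + (c - t) = 2 * c - t by ring,
    show c - (c - t) + 1 = t + 1 by ring, Real.Gamma_add_one (by linarith),
    Real.Gamma_add_one ht.ne'] at hle
  have hGt : 0 < Real.Gamma t := Real.Gamma_pos_of_pos ht
  have hGct : 0 < Real.Gamma (2 * c - t) := Real.Gamma_pos_of_pos (by linarith)
  have hGc : 0 < Real.Gamma c := Real.Gamma_pos_of_pos (by linarith)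
  rw [← mul_div_assoc, div_lt_div_iff₀ (by positivity) (by positivity)] at hΓ
  have := mul_lt_mul_of_pos_right hΓ ht
  have e : p * (Real.Gamma (2 * c + s - t) * Real.Gamma (s + t)) * Real.Gamma c ^ 2 * t =
      (t + s) * (Real.Gamma (2 * c + s - t) * Real.Gamma (s + t)) * Real.Gamma c ^ 2 := by
    rw [← hpt]
    ring
  rw [e] at this
  linarith

end LaneEmden

end

/-- It remains to check the signs of α - 2, β and A. In the parameters t = s/(p-1) and c = (n -
2s)/4 they become explicit, and the constant of the theorem is the coefficient of p_1² in the final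
form. -/
theorem theorem2p4 (n : ℕ) (s p : ℝ) (hs₂ : 2 < s) (hs₃ : s < 3) (hn : 2 * s < n)
    (hp : (n + 2 * s) / (n - 2 * s) < p)
    (hΓ : Real.Gamma ((n + 2 * s) / 4) ^ 2 / Real.Gamma ((n - 2 * s) / 4) ^ 2 <
      p * (Real.Gamma (n / 2 - s / (p - 1)) * Real.Gamma (s + s / (p - 1)) /
        (Real.Gamma (s / (p - 1)) * Real.Gamma ((n - 2 * s) / 2 - s / (p - 1))))) :
    ∃ (c : LaneEmden.Coeffs) (C : ℝ), 0 < C ∧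
      ∀ (κ : ℝ), 0 < κ → ∀ (u : LaneEmden.Space n → ℝ), LaneEmden.IsExtendedSolution n s p κ u →
        ∀ x₀ : EuclideanSpace ℝ (Fin n),
          MonotoneOn (LaneEmden.energy s p κ c x₀ u) (Set.Ioi 0) ∧
          ∀ lam : ℝ, 0 < lam →
            LaneEmden.EnergyConverges s p c x₀ u lam ∧
            DifferentiableAt ℝ (LaneEmden.energy s p κ c x₀ u) lam ∧
            MeasureTheory.IntegrableOn (fun ω : Metric.sphere (0 : LaneEmden.Space n) 1 =>
              LaneEmden.dissipation s p x₀ u lam (LaneEmden.bdry x₀ + lam • (ω : LaneEmden.Space n)))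
              (LaneEmden.hemi n) (LaneEmden.surf n) ∧
            C * lam ^ (2 * s * ((p + 1) / (p - 1)) - 6 - n) *
                LaneEmden.halfSphereIntegral x₀ lam (LaneEmden.dissipation s p x₀ u lam) ≤
              deriv (LaneEmden.energy s p κ c x₀ u) lam := by
  have hns : 0 < (n : ℝ) - 2 * s := by linarith
  rw [div_lt_iff₀ hns] at hp
  have hp1 : 1 < p := by nlinarith
  have hpm : 0 < p - 1 := by linarith
  obtain ⟨t, ht⟩ : ∃ t, t = s / (p - 1) := ⟨_, rfl⟩
  obtain ⟨c, hc⟩ : ∃ c : ℝ, c = (n - 2 * s) / 4 := ⟨_, rfl⟩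
  have ht0 : 0 < t := by rw [ht]; positivity
  have htp : t * (p - 1) = s := by rw [ht]; field_simp
  -- Supercriticality of p in disguise: s/(p-1) < (n-2s)/4 is equivalent to p > (n+2s)/(n-2s).
  have htc : t < c := by
    rw [ht, hc, div_lt_div_iff₀ hpm (by norm_num)]
    linarith
  have hquad := LaneEmden.quadratic_bound_of_Gamma (p := p) hs₂ hs₃ ht0 htc (by linarith) (by
    rwa [← ht, ← hc, show (n + 2 * s) / 4 = c + s by linarith,
      show (n : ℝ) / 2 = 2 * c + s by linarith, show ((n : ℝ) - 2 * s) / 2 = 2 * c by linarith]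
      at hΓ)
  have hk : 2 * s / (p - 1) = 2 * t := by rw [ht]; ring
  have hn4 : (n : ℝ) = 4 * c + 2 * s := by linarith
  obtain ⟨α, hα⟩ : ∃ α : ℝ, α = (n + (5 - 2 * s) - 1) - 2 * (2 * s / (p - 1)) := ⟨_, rfl⟩
  obtain ⟨β, hβ⟩ : ∃ β : ℝ,
      β = 2 * s / (p - 1) * ((n + (5 - 2 * s) - 1) - 2 * s / (p - 1)) := ⟨_, rfl⟩
  have hα' : α = 4 * (c - t) + 4 := by rw [hα, hk, hn4]; ring
  have hβ' : β = 4 * t * (2 * c + 2 - t) := by rw [hβ, hk, hn4]; ring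
  have hα2 : 2 < α := by linarith
  have hβ0 : 0 < β := by rw [hβ']; exact mul_pos (by linarith) (by linarith)
  -- In these parameters the left-hand expression equals 24(c+1)² + 16 - 40(c-t)², which is the
  -- quadratic bound just obtained.
  have hA : 0 ≤ 6 * β + 20 * α - 24 - α ^ 2 := by rw [hα', hβ']; linarith
  have hα3 : 0 < α - 2 := by linarith
  exact ⟨LaneEmden.energyCoeffs α β, 3 * β ^ 2 + 12 * (α - 2) * β + 8 * α * (α - 2), by positivity,
    fun κ _ u hu x₀ => hu.monotonicity hs₂ hs₃ hp1 hα hβ hα2.le hβ0.le hA x₀⟩
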